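/- For an integer $N\ge 2$ let $\mathcal A(S_N^+)$ be the Hopf $*$-algebra of the quantum permutation group: the universal unital complex $*$-algebra generated by elements $u_{ij}$, $1\le i,j\le N$, subject to the relations that every $u_{ij}$ is a projection ($u_{ij}=u_{ij}^*=u_{ij}^2$), that projections in the same row, and in the same column, are mutually orthogonal, and that $\sum_j u_{ij}=1=\sum_j u_{ji}$ for all $i$; its comultiplication, counit and antipode are given by $\Delta(u_{ij})=\sum_k u_{ik}\otimes u_{kj}$, $\varepsilon(u_{ij})=\delta_{ij}$, $S(u_{ij})=u_{ji}$. Let $X_N\subset M_N(M_N(\mathbb C))$ be the (compact) space of $N\times N$ matrices $P=(P_{ij})$ whose entries $P_{ij}\in M_N(\mathbb C)$ are rank-one orthogonal projections with $\sum_j P_{ij}=1=\sum_j P_{ji}$ for all $i$. The universal flat matrix model of $S_N^+$ is the unital $*$-homomorphism $$\pi_N:\mathcal A(S_N^+)\to C(X_N,M_N(\mathbb C))\cong M_N(C(X_N)),\qquad \pi_N(u_{ij})(P)=P_{ij}.$$ A $*$-homomorphism $\pi:\mathcal A\to B$ from a Hopf $*$-algebra to a $*$-algebra is called inner faithful if $\ker\pi$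 contains no nonzero Hopf $*$-ideal, i.e. no nonzero two-sided ideal $I$ with $I^*\subseteq I$, $\Delta(I)\subseteq I\otimes\mathcal A+\mathcal A\otimes I$, $\varepsilon(I)=0$ and $S(I)\subseteq I$. **Proposition.** Let $M\ge 5$ and $N\ge 2M$ be integers. If $\pi_M$ is inner faithful, then $\pi_N$ is inner faithful. -/

import Mathlib

open scoped TensorProduct

noncomputable section

namespace QPerm

/-! ### Magic unitaries and the Hopf star-algebra of the quantum permutation group -/

/-- The algebraic relations of an `N × N` magic unitary in a unital algebra: the entries of each
row and of each column are mutually orthogonal idempotents with sum `1`. -/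
structure IsMagic {N : ℕ} {B : Type*} [Semiring B] (p : Fin N → Fin N → B) : Prop where
  row_mul : ∀ i j k, p i j * p i k = if j = k then p i j else 0
  col_mul : ∀ i j k, p i k * p j k = if i = j then p i k else 0
  row_sum : ∀ i, ∑ j, p i j = 1
  col_sum : ∀ j, ∑ i, p i j = 1

/-- The defining relations of the algebra of the quantum permutation group, on the free complex
algebra on letters `(i, j)`. The letters are self-adjoint for the involution put on the quotient
below, so that they become projections. (The orthogonality relations, which in a C⋆-algebra follow
from the sums of projections being `1`, belong to the presentation of the dense Hopf star-algebra:
they hold in the universal C⋆-algebra generated by a magic unitary.) -/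
inductive Rel (N : ℕ) :
    FreeAlgebra ℂ (Fin N × Fin N) → FreeAlgebra ℂ (Fin N × Fin N) → Prop
  | row_mul (i j k : Fin N) : Rel N
      (FreeAlgebra.ι ℂ (i, j) * FreeAlgebra.ι ℂ (i, k))
      (if j = k then FreeAlgebra.ι ℂ (i, j) else 0)
  | col_mul (i j k : Fin N) : Rel N
      (FreeAlgebra.ι ℂ (i, k) * FreeAlgebra.ι ℂ (j, k))
      (if i = j then FreeAlgebra.ι ℂ (i, k) else 0)
  | row_sum (i : Fin N) : Rel N (∑ j, FreeAlgebra.ι ℂ (i, j)) 1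
  | col_sum (j : Fin N) : Rel N (∑ i, FreeAlgebra.ι ℂ (i, j)) 1

/-- The algebra `𝒜(S_N⁺)`, i.e. the universal unital complex algebra generated by a magic
unitary; its Hopf star-algebra structure is built below. -/
def Alg (N : ℕ) : Type := RingQuot (Rel N)

namespace Alg

variable {N : ℕ}

instance instRing : Ring (Alg N) := inferInstanceAs (Ring (RingQuot (Rel N)))

instance instAlgebra : Algebra ℂ (Alg N) := inferInstanceAs (Algebra ℂ (RingQuot (Rel N)))

/-- The quotient map from the free algebra. -/
def mk (N : ℕ) : FreeAlgebra ℂ (Fin N × Fin N) →ₐ[ℂ] Alg N := RingQuot.mkAlgHom ℂ (Rel N)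

theorem mk_surjective : Function.Surjective (mk N) := RingQuot.mkAlgHom_surjective ℂ (Rel N)

/-- The canonical generators `u i j` of `𝒜(S_N⁺)`. -/
def u (i j : Fin N) : Alg N := mk N (FreeAlgebra.ι ℂ (i, j))

theorem isMagic_u : IsMagic (u : Fin N → Fin N → Alg N) where
  row_mul i j k := by
    have h := RingQuot.mkAlgHom_rel ℂ (Rel.row_mul i j k)
    change mk N _ = mk N _ at h
    rw [map_mul] at h
    rw [u, u, h]; split_ifs <;> simp
  col_mul i j k := by
    have h := RingQuot.mkAlgHom_rel ℂ (Rel.col_mul i j k)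
    change mk N _ = mk N _ at h
    rw [map_mul] at h
    rw [u, u, h]; split_ifs <;> simp
  row_sum i := by
    have h := RingQuot.mkAlgHom_rel ℂ (Rel.row_sum i)
    change mk N _ = mk N _ at h
    rwa [map_sum, map_one] at h
  col_sum j := by
    have h := RingQuot.mkAlgHom_rel ℂ (Rel.col_sum j)
    change mk N _ = mk N _ at h
    rwa [map_sum, map_one] at h

/-- The universal property: a magic unitary in `B` gives an algebra morphism `𝒜(S_N⁺) → B`. -/
def lift {B : Type*} [Semiring B] [Algebra ℂ B] (p : Fin N → Fin N → B) (hp : IsMagic p) :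
    Alg N →ₐ[ℂ] B :=
  RingQuot.liftAlgHom ℂ ⟨FreeAlgebra.lift ℂ fun x : Fin N × Fin N => p x.1 x.2, by
    intro x y h
    induction h with
    | row_mul i j k =>
      rw [map_mul]; simp only [FreeAlgebra.lift_ι_apply, hp.row_mul]; split_ifs <;> simp
    | col_mul i j k =>
      rw [map_mul]; simp only [FreeAlgebra.lift_ι_apply, hp.col_mul]; split_ifs <;> simp
    | row_sum i => simp [map_sum, hp.row_sum]
    | col_sum j => simp [map_sum, hp.col_sum]⟩

@[simp] theorem lift_u {B : Type*} [Semiring B] [Algebra ℂ B] (p : Fin N → Fin N → B)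
    (hp : IsMagic p) (i j : Fin N) : lift p hp (u i j) = p i j := by
  refine Eq.trans ?_ (FreeAlgebra.lift_ι_apply (R := ℂ)
    (fun x : Fin N × Fin N => p x.1 x.2) (i, j))
  exact RingQuot.liftAlgHom_mkAlgHom_apply ℂ _ _ _

/-- `𝒜(S_N⁺)` is generated by the `u i j`. -/
@[elab_as_elim]
theorem induction {motive : Alg N → Prop} (scalar : ∀ c : ℂ, motive (algebraMap ℂ _ c))
    (gen : ∀ i j, motive (u i j)) (mul : ∀ a b, motive a → motive b → motive (a * b))
    (add : ∀ a b, motive a → motive b → motive (a + b)) (a : Alg N) : motive a := by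
  obtain ⟨x, rfl⟩ := mk_surjective a
  induction x with
  | grade0 c => simpa using scalar c
  | grade1 x => exact gen x.1 x.2
  | mul a b ha hb => simpa using mul _ _ ha hb
  | add a b ha hb => simpa using add _ _ ha hb

theorem hom_ext {B : Type*} [Semiring B] [Algebra ℂ B] {f g : Alg N →ₐ[ℂ] B}
    (h : ∀ i j, f (u i j) = g (u i j)) : f = g := by
  ext a
  induction a using induction with
  | scalar c => simp
  | gen i j => exact h i j
  | mul a b ha hb => simp [ha, hb]
  | add a b ha hb => simp [ha, hb]

/-! ### The involution -/

/-- The opposite ring of `B`, regarded as a complex algebra through complex conjugation. -/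
def ConjOp (B : Type*) : Type _ := Bᵐᵒᵖ

/-- An element of `B` as an element of the conjugate opposite algebra. -/
def toConjOp {B : Type*} (b : B) : ConjOp B := MulOpposite.op b

instance {B : Type*} [Ring B] : Ring (ConjOp B) := inferInstanceAs (Ring Bᵐᵒᵖ)

instance {B : Type*} [Ring B] [Algebra ℂ B] : Algebra ℂ (ConjOp B) :=
  ((algebraMap ℂ Bᵐᵒᵖ).comp (starRingEnd ℂ)).toAlgebra' fun c x =>
    Algebra.commutes (A := Bᵐᵒᵖ) (starRingEnd ℂ c) x

/-- The involution as a conjugate-linear antimultiplicative map that fixes the generators. -/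
def starHom (N : ℕ) : Alg N →ₐ[ℂ] ConjOp (Alg N) :=
  lift (fun i j => toConjOp (u i j))
    { row_mul := fun i j k => by
        have : (MulOpposite.op (u i k * u i j) : (Alg N)ᵐᵒᵖ) =
            if j = k then MulOpposite.op (u i j) else 0 := by
          rw [isMagic_u.row_mul]
          by_cases h : j = k
          · subst h; simp
          · rw [if_neg h, if_neg (Ne.symm h)]; rfl
        exact this
      col_mul := fun i j k => by
        have : (MulOpposite.op (u j k * u i k) : (Alg N)ᵐᵒᵖ) =
            if i = j then MulOpposite.op (u i k) else 0 := by
          rw [isMagic_u.col_mul]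
          by_cases h : i = j
          · subst h; simp
          · rw [if_neg h, if_neg (Ne.symm h)]; rfl
        exact this
      row_sum := fun i => by
        refine Eq.trans ?_ (congrArg MulOpposite.op (isMagic_u.row_sum i))
        exact (map_sum (MulOpposite.opAddEquiv (α := Alg N)) _ _).symm
      col_sum := fun j => by
        refine Eq.trans ?_ (congrArg MulOpposite.op (isMagic_u.col_sum j))
        exact (map_sum (MulOpposite.opAddEquiv (α := Alg N)) _ _).symm }

instance instStar : Star (Alg N) where
  star a := MulOpposite.unop (starHom N a : (Alg N)ᵐᵒᵖ)

theorem star_def (a : Alg N) : star a = MulOpposite.unop (starHom N a : (Alg N)ᵐᵒᵖ) := rfl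

@[simp] theorem star_u (i j : Fin N) : star (u i j) = u i j := by
  exact congrArg MulOpposite.unop (lift_u (fun i j => toConjOp (u i j)) _ i j)

theorem star_mul' (a b : Alg N) : star (a * b) = star b * star a := by
  rw [star_def, map_mul]; rfl

theorem star_add' (a b : Alg N) : star (a + b) = star a + star b := by
  rw [star_def, map_add]; rfl

theorem star_scalar (c : ℂ) :
    star (algebraMap ℂ (Alg N) c) = algebraMap ℂ (Alg N) (star c) := by
  rw [star_def, AlgHom.commutes]; rfl

instance instStarRing : StarRing (Alg N) where
  star_involutive a := by
    induction a using induction with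
    | scalar c => rw [star_scalar, star_scalar, star_star]
    | gen i j => rw [star_u, star_u]
    | mul a b ha hb => rw [star_mul', star_mul', ha, hb]
    | add a b ha hb => rw [star_add', star_add', ha, hb]
  star_mul := star_mul'
  star_add := star_add'

instance instStarModule : StarModule ℂ (Alg N) where
  star_smul c a := by
    rw [Algebra.smul_def, star_mul, star_scalar, Algebra.smul_def, Algebra.commutes]

theorem isStarProjection_u (i j : Fin N) : IsStarProjection (u i j) where
  isIdempotentElem := (isMagic_u.row_mul i j j).trans (if_pos rfl)
  isSelfAdjoint := star_u i j

/-! ### The Hopf algebra structure -/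

/-- The comultiplication, `Δ(u i j) = ∑ k, u i k ⊗ u k j`. -/
def comulHom (N : ℕ) : Alg N →ₐ[ℂ] Alg N ⊗[ℂ] Alg N :=
  lift (fun i j => ∑ k, u i k ⊗ₜ[ℂ] u k j)
    { row_mul := fun i j k => by
        simp only [Finset.sum_mul_sum, Algebra.TensorProduct.tmul_mul_tmul, isMagic_u.row_mul]
        simp only [TensorProduct.ite_tmul, Finset.sum_ite_eq,
          Finset.mem_univ, if_true, isMagic_u.row_mul]
        split_ifs <;> simp
      col_mul := fun i j k => by
        simp only [Finset.sum_mul_sum, Algebra.TensorProduct.tmul_mul_tmul, isMagic_u.col_mul]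
        simp only [TensorProduct.tmul_ite, Finset.sum_ite_eq,
          Finset.mem_univ, if_true, isMagic_u.col_mul, TensorProduct.ite_tmul]
        split_ifs <;> simp
      row_sum := fun i => by
        rw [Finset.sum_comm]
        simp only [← TensorProduct.tmul_sum, isMagic_u.row_sum, ← TensorProduct.sum_tmul]
        rfl
      col_sum := fun j => by
        rw [Finset.sum_comm]
        simp only [← TensorProduct.sum_tmul, isMagic_u.col_sum, ← TensorProduct.tmul_sum]
        rfl }

@[simp] theorem comulHom_u (i j : Fin N) : comulHom N (u i j) = ∑ k, u i k ⊗ₜ[ℂ] u k j :=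
  lift_u _ _ i j

/-- The counit, `ε(u i j) = δ_{ij}`. -/
def counitHom (N : ℕ) : Alg N →ₐ[ℂ] ℂ :=
  lift (fun i j => if i = j then 1 else 0)
    { row_mul := fun i j k => by by_cases h : i = j <;> by_cases h' : j = k <;> simp_all
      col_mul := fun i j k => by
        by_cases h : i = j <;> by_cases h' : j = k <;> simp_all
      row_sum := fun i => by simp
      col_sum := fun j => by simp }

@[simp] theorem counitHom_u (i j : Fin N) : counitHom N (u i j) = if i = j then 1 else 0 :=
  lift_u _ _ i j

instance instBialgebra : Bialgebra ℂ (Alg N) :=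
  Bialgebra.ofAlgHom (comulHom N) (counitHom N)
    (hom_ext fun i j => by
      simp only [AlgHom.comp_apply, comulHom_u, map_sum, Algebra.TensorProduct.map_tmul,
        AlgHom.coe_id, id_eq, TensorProduct.sum_tmul, TensorProduct.tmul_sum]
      rw [Finset.sum_comm]
      rfl)
    (hom_ext fun i j => by
      simp [TensorProduct.ite_tmul])
    (hom_ext fun i j => by
      simp [TensorProduct.tmul_ite])

/-- The antipode as an antimultiplicative map, `S(u i j) = u j i`. -/
def antipodeHom (N : ℕ) : Alg N →ₐ[ℂ] (Alg N)ᵐᵒᵖ :=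
  lift (fun i j => MulOpposite.op (u j i))
    { row_mul := fun i j k => by
        rw [← MulOpposite.op_mul, isMagic_u.col_mul]
        by_cases h : j = k
        · subst h; simp
        · rw [if_neg h, if_neg (Ne.symm h), MulOpposite.op_zero]
      col_mul := fun i j k => by
        rw [← MulOpposite.op_mul, isMagic_u.row_mul]
        by_cases h : i = j
        · subst h; simp
        · rw [if_neg h, if_neg (Ne.symm h), MulOpposite.op_zero]
      row_sum := fun i => by rw [← Finset.op_sum, isMagic_u.col_sum, MulOpposite.op_one]
      col_sum := fun j => by rw [← Finset.op_sum, isMagic_u.row_sum, MulOpposite.op_one] }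

/-- The antipode as a linear map. -/
def antipodeLin (N : ℕ) : Alg N →ₗ[ℂ] Alg N :=
  (MulOpposite.opLinearEquiv ℂ).symm.toLinearMap ∘ₗ (antipodeHom N).toLinearMap

@[simp] theorem antipodeLin_u (i j : Fin N) : antipodeLin N (u i j) = u j i := by
  simp [antipodeLin, antipodeHom]

theorem antipodeLin_mul (a b : Alg N) :
    antipodeLin N (a * b) = antipodeLin N b * antipodeLin N a := by
  simp [antipodeLin]

theorem antipodeLin_scalar (c : ℂ) :
    antipodeLin N (algebraMap ℂ _ c) = algebraMap ℂ _ c := by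
  simp [antipodeLin]

theorem antipode_left (a : Alg N) :
    LinearMap.mul' ℂ (Alg N) ((antipodeLin N).rTensor (Alg N) (comulHom N a)) =
      algebraMap ℂ (Alg N) (counitHom N a) := by
  induction a using induction with
  | scalar c =>
    simp [Algebra.TensorProduct.algebraMap_apply, antipodeLin_scalar]
  | gen i j =>
    simp only [comulHom_u, map_sum, LinearMap.rTensor_tmul, LinearMap.mul'_apply, antipodeLin_u,
      isMagic_u.row_mul, counitHom_u]
    split_ifs with h
    · simp [isMagic_u.col_sum]
    · simp
  | mul a b ha hb =>
    have key : ∀ t s : Alg N ⊗[ℂ] Alg N, ∀ c : ℂ,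
        LinearMap.mul' ℂ (Alg N) ((antipodeLin N).rTensor (Alg N) t) = algebraMap ℂ _ c →
        LinearMap.mul' ℂ (Alg N) ((antipodeLin N).rTensor (Alg N) (t * s)) =
          c • LinearMap.mul' ℂ (Alg N) ((antipodeLin N).rTensor (Alg N) s) := by
      intro t s c hc
      induction s with
      | zero => simp
      | add x y hx hy => rw [mul_add, map_add, map_add, hx, hy, map_add, map_add, smul_add]
      | tmul x y =>
        have : LinearMap.mul' ℂ (Alg N) ((antipodeLin N).rTensor (Alg N) (t * x ⊗ₜ y)) =
            antipodeLin N x * LinearMap.mul' ℂ (Alg N) ((antipodeLin N).rTensor (Alg N) t) * y := by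
          clear hc
          induction t with
          | zero => simp
          | add p q hp hq => rw [add_mul, map_add, map_add, hp, hq, map_add, map_add, mul_add,
              add_mul]
          | tmul p q => simp [antipodeLin_mul, mul_assoc]
        rw [this, hc, ← Algebra.commutes, mul_assoc, ← Algebra.smul_def]
        simp
    rw [map_mul, key _ _ _ ha, hb, map_mul, map_mul, Algebra.smul_def]
  | add a b ha hb => simp only [map_add, ha, hb]

theorem antipode_right (a : Alg N) :
    LinearMap.mul' ℂ (Alg N) ((antipodeLin N).lTensor (Alg N) (comulHom N a)) =
      algebraMap ℂ (Alg N) (counitHom N a) := by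
  induction a using induction with
  | scalar c =>
    simp [Algebra.TensorProduct.algebraMap_apply]
    rw [← map_one (algebraMap ℂ (Alg N)), antipodeLin_scalar]
    simp
  | gen i j =>
    simp only [comulHom_u, map_sum, LinearMap.lTensor_tmul, LinearMap.mul'_apply, antipodeLin_u,
      isMagic_u.col_mul, counitHom_u]
    split_ifs with h
    · simp [isMagic_u.row_sum]
    · simp
  | mul a b ha hb =>
    have key : ∀ t s : Alg N ⊗[ℂ] Alg N, ∀ c : ℂ,
        LinearMap.mul' ℂ (Alg N) ((antipodeLin N).lTensor (Alg N) s) = algebraMap ℂ _ c →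
        LinearMap.mul' ℂ (Alg N) ((antipodeLin N).lTensor (Alg N) (t * s)) =
          c • LinearMap.mul' ℂ (Alg N) ((antipodeLin N).lTensor (Alg N) t) := by
      intro t s c hc
      induction t with
      | zero => simp
      | add x y hx hy => rw [add_mul, map_add, map_add, hx, hy, map_add, map_add, smul_add]
      | tmul x y =>
        have : LinearMap.mul' ℂ (Alg N) ((antipodeLin N).lTensor (Alg N) (x ⊗ₜ y * s)) =
            x * LinearMap.mul' ℂ (Alg N) ((antipodeLin N).lTensor (Alg N) s) * antipodeLin N y := by
          clear hc
          induction s with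
          | zero => simp
          | add p q hp hq => rw [mul_add, map_add, map_add, hp, hq, map_add, map_add, mul_add,
              add_mul]
          | tmul p q => simp [antipodeLin_mul, mul_assoc]
        rw [this, hc, ← Algebra.commutes, mul_assoc, ← Algebra.smul_def]
        simp
    rw [map_mul, key _ _ _ hb, ha, map_mul, map_mul, Algebra.smul_def, Algebra.commutes]
  | add a b ha hb => simp only [map_add, ha, hb]

instance instHopfAlgebra : HopfAlgebra ℂ (Alg N) where
  antipode := antipodeLin N
  mul_antipode_rTensor_comul := LinearMap.ext antipode_left
  mul_antipode_lTensor_comul := LinearMap.ext antipode_right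

end Alg

/-! ### Hopf star-algebras and inner faithfulness -/

/-- A Hopf algebra with an involution is a Hopf star-algebra if the comultiplication is a morphism
of star-algebras. -/
class IsHopfStarAlgebra (A : Type*) [Ring A] [HopfAlgebra ℂ A] [StarRing A] [StarModule ℂ A] :
    Prop where
  comul_star : ∀ a : A, Coalgebra.comul (R := ℂ) (star a) = star (Coalgebra.comul (R := ℂ) a)

instance Alg.instIsHopfStarAlgebra {N : ℕ} : IsHopfStarAlgebra (Alg N) where
  comul_star a := by
    change comulHom N (star a) = star (comulHom N a)
    induction a using Alg.induction with
    | scalar c =>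
      simp [Alg.star_scalar, Algebra.TensorProduct.algebraMap_apply]
    | gen i j => simp [star_sum]
    | mul a b ha hb => simp [ha, hb]
    | add a b ha hb => simp [ha, hb]

/-- A Hopf star-ideal: a two-sided ideal `I`, stable under the involution, with
`Δ(I) ⊆ I ⊗ A + A ⊗ I`, `ε(I) = 0` and `S(I) ⊆ I`. -/
structure IsHopfStarIdeal {A : Type*} [Ring A] [HopfAlgebra ℂ A] [StarRing A]
    (I : Ideal A) : Prop where
  isTwoSided : I.IsTwoSided
  isHopfIdeal : I.IsHopfIdeal ℂ
  star_mem : ∀ x ∈ I, star x ∈ I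

/-- A star-morphism from a Hopf star-algebra to a star-algebra is inner faithful if its kernel
contains no Hopf star-ideal other than `0`. -/
def InnerFaithful {A B : Type*} [Ring A] [HopfAlgebra ℂ A] [StarRing A] [StarModule ℂ A]
    [IsHopfStarAlgebra A] [Ring B] [Algebra ℂ B] [StarRing B] (π : A →⋆ₐ[ℂ] B) : Prop :=
  ∀ I : Ideal A, IsHopfStarIdeal I → (∀ x ∈ I, π x = 0) → I = ⊥

/-! ### The universal flat matrix model -/

/-- The space `X_N` of `N × N` bistochastic matrices whose entries are rank-one (orthogonal)
projections in `M_N(ℂ)`, topologised as a subspace of `M_N(M_N(ℂ))`. -/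
def FlatSpace (N : ℕ) : Type :=
  {P : Matrix (Fin N) (Fin N) (Matrix (Fin N) (Fin N) ℂ) //
    (∀ i j, IsStarProjection (P i j) ∧ (P i j).rank = 1) ∧
    (∀ i, ∑ j, P i j = 1) ∧ (∀ j, ∑ i, P i j = 1)}

instance (N : ℕ) : TopologicalSpace (FlatSpace N) := instTopologicalSpaceSubtype

open scoped MatrixOrder ComplexOrder in
/-- Projections in `M_n(ℂ)` with sum `1` are mutually orthogonal. -/
theorem mul_eq_zero_of_sum_eq_one {n : ℕ} {ι : Type*} [Fintype ι] [DecidableEq ι]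
    {p : ι → Matrix (Fin n) (Fin n) ℂ} (hp : ∀ i, IsStarProjection (p i))
    (hs : ∑ i, p i = 1) {i j : ι} (h : i ≠ j) : p i * p j = 0 := by
  have e : ∀ k, star (p k * p j) * (p k * p j) = p j * p k * p j := fun k => by
    rw [star_mul, (hp k).isSelfAdjoint.star_eq, (hp j).isSelfAdjoint.star_eq, mul_assoc,
      ← mul_assoc (p k), (hp k).isIdempotentElem.eq, mul_assoc]
  have h1 : ∑ k, p j * p k * p j = p j := by
    rw [← Finset.sum_mul, ← Finset.mul_sum, hs, mul_one, (hp j).isIdempotentElem.eq]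
  rw [← Finset.add_sum_erase _ _ (Finset.mem_univ j), (hp j).isIdempotentElem.eq,
    (hp j).isIdempotentElem.eq, add_eq_left] at h1
  rw [Finset.sum_congr rfl fun k _ => (e k).symm,
    Finset.sum_eq_zero_iff_of_nonneg fun k _ => star_mul_self_nonneg _] at h1
  exact Matrix.conjTranspose_mul_self_eq_zero.mp (h1 i (by simp [h]))

namespace FlatSpace

variable {N : ℕ}

/-- The `(i, j)` entry, as a continuous function `X_N → M_N(ℂ)`. -/
def entry (i j : Fin N) : C(FlatSpace N, Matrix (Fin N) (Fin N) ℂ) where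
  toFun P := P.1 i j
  continuous_toFun := continuous_subtype_val.matrix_elem i j

theorem isMagic_entry : IsMagic (entry : Fin N → Fin N → C(FlatSpace N, _)) where
  row_mul i j k := by
    ext1 P
    change P.1 i j * P.1 i k = _
    split_ifs with h
    · subst h; exact (P.2.1 i j).1.isIdempotentElem
    · exact mul_eq_zero_of_sum_eq_one (fun j => (P.2.1 i j).1) (P.2.2.1 i) h
  col_mul i j k := by
    ext1 P
    change P.1 i k * P.1 j k = _
    split_ifs with h
    · subst h; exact (P.2.1 i k).1.isIdempotentElem
    · exact mul_eq_zero_of_sum_eq_one (fun i => (P.2.1 i k).1) (P.2.2.2 k) h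
  row_sum i := by
    ext1 P
    rw [ContinuousMap.sum_apply]
    exact P.2.2.1 i
  col_sum j := by
    ext1 P
    rw [ContinuousMap.sum_apply]
    exact P.2.2.2 j

theorem star_entry (i j : Fin N) : star (entry i j) = entry i j := by
  ext1 P
  exact (P.2.1 i j).1.isSelfAdjoint

end FlatSpace

/-- The universal flat matrix model `π : 𝒜(S_N⁺) → C(X_N, M_N(ℂ)) ≅ M_N(C(X_N))`,
`π(u i j)(P) = P i j`. -/
def universalFlatModel (N : ℕ) :
    Alg N →⋆ₐ[ℂ] C(FlatSpace N, Matrix (Fin N) (Fin N) ℂ) :=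
  { Alg.lift FlatSpace.entry FlatSpace.isMagic_entry with
    map_star' := fun a => by
      change Alg.lift _ FlatSpace.isMagic_entry (star a) =
        star (Alg.lift _ FlatSpace.isMagic_entry a)
      induction a using Alg.induction with
      | scalar c =>
        rw [Alg.star_scalar, AlgHom.commutes, AlgHom.commutes, algebraMap_star_comm]
      | gen i j => rw [Alg.star_u, Alg.lift_u, FlatSpace.star_entry]
      | mul a b ha hb => rw [star_mul, map_mul, map_mul, star_mul, ha, hb]
      | add a b ha hb => rw [star_add, map_add, map_add, star_add, ha, hb] }

theorem universalFlatModel_u {N : ℕ} (i j : Fin N) (P : FlatSpace N) :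
    universalFlatModel N (Alg.u i j) P = P.1 i j :=
  congrArg (fun f : C(FlatSpace N, Matrix (Fin N) (Fin N) ℂ) => f P)
    (Alg.lift_u FlatSpace.entry FlatSpace.isMagic_entry i j)

end QPerm

end

/-!
A tensor in `(ℂ ^ N)^{⊗k}` is a function on words of length `k`, and the noncrossing vectors `NC` are
the combinations of indicator functions of noncrossing partitions. They are exactly the vectors fixed
by the powers of the fundamental corepresentation of the quantum permutation group: the entries of the
projection onto the noncrossing vectors are the values of the Haar functional, and this functional
only sees noncrossing vectors (`mem_NC_of_isFixed_u`).

Inner faithfulness of the flat model is equivalent to the statement that every vector which is fixed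
at all points of the model is noncrossing. In one direction, the relations that make these vectors
fixed generate a Hopf star-ideal in the kernel (`mem_NC_of_isFlatFixed`). In the other direction, let
`I` be a Hopf star-ideal in the kernel. The functionals that vanish on `I` give star-algebras of
matrices, whose commutants are spanned by noncrossing vectors, and the double commutant theorem
(`mem_of_forall_commute`) shows that these functionals separate the points of the algebra
(`innerFaithful_of_mem_NC`).

For the step from `M` to `N = M + n` with `n ≥ M`, a point `P` of the model for `M` and a unitary
matrix `U` of size `M` give points of the model for `N` that are block diagonal over `ℂ ^ M ⊕ ℂ ^ n`.
Their compression to `ℂ ^ M` has the block `P` and a circulant block built from the projections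
`U e_k U⋆`. The remaining cells are filled with the other coordinate projections by Hall's theorem
(`IsFlatFixed.isFixedPow_extMat`). Pairing a leg in `ℂ ^ n` with a character of the cyclic group of
order `n` turns it into a scalar letter, the unitary matrix `∑ ζ ^ k U e_k U⋆`
(`sum_smul_slot_powMat`). Hence a vector fixed by the model for `N` gives vectors fixed by words that
consist of legs, on which `P` acts, and scalar letters.

If the fixed vectors of the model for `M` are noncrossing, so are those of all words with scalar
letters (`mem_NC_of_isModelFixed`); in particular a primitive vector, all of whose sums over a leg and
merges of neighbouring legs vanish, is only fixed if it is zero. This follows from Schur's lemma for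
primitive vectors (`schurProperty`), which is proved by induction on the number of letters. The main
point is that an intertwiner which inserts legs in front of a word is trivial if it is orthogonal to
the noncrossing vectors (`eq_zero_of_centred`). By induction, the operator `ξ ξ⋆`, traced over the
last block, is a scalar. That this scalar vanishes is seen for `U = 1 - p + t p`, where `p` is the
projection onto the constant vectors: the coefficients of highest degree in `t` of the scalar letters
`Z` are `p Z (1 - p)` (`Intertwines.degenerate`), and words in these can be computed explicitly
(`exists_probe`).

A vector fixed by the model for `N` is therefore noncrossing as soon as the places of its legs in
`ℂ ^ n` and their letters are prescribed. It is also invariant under permutations of the `N` letters,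
and a noncrossing vector is determined by its values on words in four letters
(`NC.eq_zero_of_four_letters`). The latter is shown with the functions on four points replaced by the
`2 × 2` matrices, where diagrams become Dyck words and the matrix of their values is triangular. As
`M ≥ 5`, there is a letter besides the four, which can be exchanged with a letter of `ℂ ^ n`, and an
induction on the number of letters of `ℂ ^ n` shows that the vector is noncrossing
(`mem_NC_of_isFlatFixed_of_le`).
-/

noncomputable section

namespace QPerm

/-! ### Words and noncrossing vectors -/

section Words

variable (ι : Type*) [Fintype ι]

/-- The finite set of words of length `k` in the alphabet `ι`. A tensor in `(ℂ^ι)^{⊗k}` is encoded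
as a function `List ι → ℂ`, of which only the values on `words ι k` matter. -/
def words (k : ℕ) : Finset (List ι) := (List.finite_length_eq ι k).toFinset

variable {ι}

@[simp] theorem mem_words {k : ℕ} {l : List ι} : l ∈ words ι k ↔ l.length = k := by
  simp [words]

variable {B : Type*} [AddCommMonoid B]

@[simp] theorem sum_words_zero (f : List ι → B) : ∑ l ∈ words ι 0, f l = f [] := by
  have : words ι 0 = {[]} := by ext l; simp
  rw [this, Finset.sum_singleton]

theorem sum_words_append (a b : ℕ) (f : List ι → B) :
    ∑ l ∈ words ι (a + b), f l = ∑ x ∈ words ι a, ∑ y ∈ words ι b, f (x ++ y) := by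
  rw [← Finset.sum_product']
  symm
  refine Finset.sum_bij (fun x _ => x.1 ++ x.2) ?_ ?_ ?_ (fun _ _ => rfl)
  · rintro ⟨x, y⟩ h; simp at h ⊢; omega
  · rintro ⟨x, y⟩ h ⟨x', y'⟩ h' e
    simp only [Finset.mem_product, mem_words] at h h' e
    obtain ⟨rfl, rfl⟩ := List.append_inj e (h.1.trans h'.1.symm)
    rfl
  · intro l h
    rw [mem_words] at h
    exact ⟨(l.take a, l.drop a), by simp; omega, List.take_append_drop a l⟩

theorem sum_words_one (f : List ι → B) : ∑ l ∈ words ι 1, f l = ∑ j, f [j] := by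
  symm
  refine Finset.sum_bij (fun x _ => [x]) (by simp) (by simp) ?_ (fun _ _ => rfl)
  intro l h
  rw [mem_words, List.length_eq_one_iff] at h
  obtain ⟨a, rfl⟩ := h
  exact ⟨a, by simp⟩

theorem sum_words_succ (k : ℕ) (f : List ι → B) :
    ∑ l ∈ words ι (k + 1), f l = ∑ j, ∑ l ∈ words ι k, f (j :: l) := by
  rw [add_comm, sum_words_append, sum_words_one]; rfl

theorem sum_words_insert (a b : ℕ) (f : List ι → B) :
    ∑ l ∈ words ι (a + 1 + b), f l =
      ∑ x ∈ words ι a, ∑ y ∈ words ι b, ∑ j, f (x ++ j :: y) := by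
  rw [add_assoc, add_comm 1 b, sum_words_append]
  refine Finset.sum_congr rfl fun x _ => ?_
  rw [sum_words_succ, Finset.sum_comm]

theorem sum_words_reverse (k : ℕ) (f : List ι → B) :
    ∑ l ∈ words ι k, f l.reverse = ∑ l ∈ words ι k, f l :=
  Finset.sum_nbij' List.reverse List.reverse (by simp) (by simp) (by simp) (by simp) (by simp)


end Words

theorem exists_split {ι : Type*} {l : List ι} {p : ℕ} (h : p < l.length) :
    ∃ a i b, l = a ++ i :: b ∧ a.length = p :=
  ⟨l.take p, l[p], l.drop (p + 1), by simp, by simp; omega⟩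

section Noncrossing

variable {ι : Type*}

/-- Insertion of a free leg at position `p`. -/
def Ins (p : ℕ) : (List ι → ℂ) →ₗ[ℂ] (List ι → ℂ) where
  toFun f l := if p < l.length then f (l.eraseIdx p) else 0
  map_add' f g := by ext l; dsimp; split_ifs <;> simp
  map_smul' c f := by ext l; dsimp; split_ifs <;> simp

theorem Ins_append {p : ℕ} {a : List ι} (h : a.length = p) (f : List ι → ℂ) (i : ι)
    (b : List ι) : Ins p f (a ++ i :: b) = f (a ++ b) := by
  subst h
  simp [Ins, List.eraseIdx_append_of_length_le]

theorem Ins_of_le {p : ℕ} {l : List ι} (h : l.length ≤ p) (f : List ι → ℂ) : Ins p f l = 0 :=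
  if_neg (by omega)

variable [DecidableEq ι]

/-- Doubling of the leg at position `p`. -/
def Dup (p : ℕ) : (List ι → ℂ) →ₗ[ℂ] (List ι → ℂ) where
  toFun f l := if p + 1 < l.length ∧ l[p]? = l[p + 1]? then f (l.eraseIdx p) else 0
  map_add' f g := by ext l; dsimp; split_ifs <;> simp
  map_smul' c f := by ext l; dsimp; split_ifs <;> simp

theorem Dup_append {p : ℕ} {a : List ι} (h : a.length = p) (f : List ι → ℂ) (i j : ι)
    (b : List ι) : Dup p f (a ++ i :: j :: b) = if i = j then f (a ++ j :: b) else 0 := by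
  subst h
  simp [Dup, List.eraseIdx_append_of_length_le]

theorem Dup_of_le {p : ℕ} {l : List ι} (h : l.length ≤ p + 1) (f : List ι → ℂ) :
    Dup p f l = 0 := if_neg (by omega)

/-- Noncrossing diagrams on points of a line, presented by the moves that build them: `ins p`
inserts a singleton block at position `p`, and `dup p` doubles the point at position `p` inside its
block. Every noncrossing partition arises in this way, in general from several diagrams. -/
inductive Diagram
  | nil
  | ins (p : ℕ) (d : Diagram)
  | dup (p : ℕ) (d : Diagram)

/-- The number of points of a diagram. -/
def Diagram.size : Diagram → ℕ
  | nil => 0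
  | ins _ d => d.size + 1
  | dup _ d => d.size + 1

/-- The vector of a diagram: the indicator function of the words that are constant on its
blocks. -/
def Diagram.ev : Diagram → List ι → ℂ
  | nil => fun l => if l = [] then 1 else 0
  | ins p d => Ins p d.ev
  | dup p d => Dup p d.ev

theorem Diagram.ev_of_length_ne (d : Diagram) {l : List ι} (h : l.length ≠ d.size) :
    d.ev l = 0 := by
  induction d generalizing l with
  | nil => exact if_neg fun e => h (by simp [e, size])
  | ins p d ih =>
    rw [size] at h
    rw [ev]
    rcases le_or_gt l.length p with h' | h'
    · exact Ins_of_le h' _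
    · obtain ⟨a, i, b, rfl, ha⟩ := exists_split h'
      rw [Ins_append ha]
      exact ih (by simp at h ⊢; omega)
  | dup p d ih =>
    rw [size] at h
    rw [ev]
    change (if p + 1 < l.length ∧ l[p]? = l[p + 1]? then d.ev (l.eraseIdx p) else 0) = 0
    split_ifs with h'
    · refine ih ?_
      rw [List.length_eraseIdx]
      split_ifs <;> omega
    · rfl

theorem Diagram.conj_ev (d : Diagram) (l : List ι) : (starRingEnd ℂ) (d.ev l) = d.ev l := by
  induction d generalizing l with
  | nil => simp only [ev]; split_ifs <;> simp
  | ins p d ih =>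
    change (starRingEnd ℂ) (if _ then _ else _) = if _ then _ else _
    split_ifs <;> simp [ih]
  | dup p d ih =>
    change (starRingEnd ℂ) (if _ then _ else _) = if _ then _ else _
    split_ifs <;> simp [ih]

theorem Diagram.ev_map {κ : Type*} [DecidableEq κ] (e : ι → κ) (he : Function.Injective e)
    (d : Diagram) (l : List ι) : d.ev (l.map e) = d.ev l := by
  induction d generalizing l with
  | nil => simp [ev]
  | ins p d ih =>
    rw [ev, ev]
    rcases le_or_gt l.length p with h' | h'
    · rw [Ins_of_le h', Ins_of_le (by simpa using h')]
    · obtain ⟨a, i, b, rfl, ha⟩ := exists_split h'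
      rw [Ins_append ha, List.map_append, List.map_cons, Ins_append (by simpa using ha), ← ih,
        List.map_append]
  | dup p d ih =>
    rw [ev, ev]
    rcases le_or_gt l.length (p + 1) with h' | h'
    · rw [Dup_of_le h', Dup_of_le (by simpa using h')]
    · obtain ⟨a, i, b, rfl, ha⟩ := exists_split (show p < l.length by omega)
      obtain _ | ⟨j, b⟩ := b
      · simp at h'; omega
      rw [Dup_append ha, List.map_append, List.map_cons, List.map_cons,
        Dup_append (by simpa using ha), ← ih, List.map_append, List.map_cons]
      simp only [he.eq_iff]

variable (ι) in
/-- The space spanned by the vectors of all diagrams. -/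
def ncSpan : Submodule ℂ (List ι → ℂ) := Submodule.span ℂ (Set.range Diagram.ev)

theorem Diagram.ev_mem (d : Diagram) : (d.ev : List ι → ℂ) ∈ ncSpan ι :=
  Submodule.subset_span ⟨d, rfl⟩

theorem Ins_mem (p : ℕ) {f : List ι → ℂ} (hf : f ∈ ncSpan ι) : Ins p f ∈ ncSpan ι := by
  refine Submodule.span_induction (p := fun f _ => Ins p f ∈ ncSpan ι) ?_ ?_ ?_ ?_ hf
  · rintro _ ⟨d, rfl⟩; exact (Diagram.ins p d).ev_mem
  · rw [map_zero]; exact zero_mem _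
  · intro f g _ _ h h'; rw [map_add]; exact add_mem h h'
  · intro c f _ h; rw [map_smul]; exact Submodule.smul_mem _ _ h

theorem Dup_mem (p : ℕ) {f : List ι → ℂ} (hf : f ∈ ncSpan ι) : Dup p f ∈ ncSpan ι := by
  refine Submodule.span_induction (p := fun f _ => Dup p f ∈ ncSpan ι) ?_ ?_ ?_ ?_ hf
  · rintro _ ⟨d, rfl⟩; exact (Diagram.dup p d).ev_mem
  · rw [map_zero]; exact zero_mem _
  · intro f g _ _ h h'; rw [map_add]; exact add_mem h h'
  · intro c f _ h; rw [map_smul]; exact Submodule.smul_mem _ _ h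

/-- Summing a leg of the vector of a diagram gives a noncrossing vector. -/
theorem Diagram.exists_sum [Fintype ι] (d : Diagram) (q : ℕ) : ∃ g ∈ ncSpan ι, ∀ l r : List ι,
    l.length = q → ∑ j, d.ev (l ++ j :: r) = g (l ++ r) := by
  induction d generalizing q with
  | nil => exact ⟨0, zero_mem _, fun l r _ => by simp [ev]⟩
  | ins p d ih =>
    simp only [ev]
    rcases lt_trichotomy p q with h | h | h
    · obtain ⟨g, hg, hgs⟩ := ih (q - 1)
      refine ⟨Ins p g, Ins_mem p hg, fun l r hl => ?_⟩
      obtain ⟨a, i, b, rfl, ha⟩ := exists_split (h.trans_eq hl.symm)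
      have := hgs (a ++ b) r (by simp at hl ⊢; omega)
      simp only [List.append_assoc, List.cons_append, Ins_append ha] at this ⊢
      exact this
    · subst h
      refine ⟨(Fintype.card ι : ℂ) • d.ev, Submodule.smul_mem _ _ d.ev_mem, fun l r hl => ?_⟩
      simp [Ins_append hl]
    · obtain ⟨g, hg, hgs⟩ := ih q
      refine ⟨Ins (p - 1) g, Ins_mem _ hg, fun l r hl => ?_⟩
      rcases le_or_gt r.length (p - 1 - q) with h' | h'
      · rw [Ins_of_le (by simp; omega)]
        exact Finset.sum_eq_zero fun j _ => Ins_of_le (by simp; omega) _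
      · obtain ⟨a, i, b, rfl, ha⟩ := exists_split h'
        have := hgs l (a ++ b) hl
        rw [← List.append_assoc, Ins_append (by simp; omega), List.append_assoc, ← this]
        refine Finset.sum_congr rfl fun j _ => ?_
        have := Ins_append (p := p) (a := l ++ j :: a) (by simp; omega) d.ev i b
        simpa using this
  | dup p d ih =>
    simp only [ev]
    rcases lt_or_ge (p + 1) q with h | h
    · obtain ⟨g, hg, hgs⟩ := ih (q - 1)
      refine ⟨Dup p g, Dup_mem p hg, fun l r hl => ?_⟩
      obtain ⟨a, i, b, rfl, ha⟩ := exists_split (show p < l.length by omega)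
      obtain _ | ⟨i', b⟩ := b
      · simp at hl; omega
      have := hgs (a ++ i' :: b) r (by simp at hl ⊢; omega)
      simp only [List.append_assoc, List.cons_append, Dup_append ha] at this ⊢
      split_ifs
      · exact this
      · simp
    rcases eq_or_lt_of_le h with h | h
    · refine ⟨d.ev, d.ev_mem, fun l r hl => ?_⟩
      obtain ⟨a, i, b, rfl, ha⟩ := exists_split (show p < l.length by omega)
      obtain rfl : b = [] := List.length_eq_zero_iff.1 (by simp at hl; omega)
      simp [Dup_append ha]
    rcases eq_or_lt_of_le (Nat.lt_succ_iff.1 h) with h | h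
    · subst h
      rcases le_or_gt d.size q with h' | h'
      · refine ⟨0, zero_mem _, fun l r hl => Finset.sum_eq_zero fun j _ => ?_⟩
        obtain _ | ⟨i, r⟩ := r
        · exact Dup_of_le (by simp; omega) _
        · rw [Dup_append hl, ev_of_length_ne, ite_self]
          simp; omega
      · refine ⟨d.ev, d.ev_mem, fun l r hl => ?_⟩
        obtain _ | ⟨i, r⟩ := r
        · rw [ev_of_length_ne _ (by simp; omega)]
          exact Finset.sum_eq_zero fun j _ => Dup_of_le (by simp; omega) _
        · simp [Dup_append hl]
    · obtain ⟨g, hg, hgs⟩ := ih q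
      refine ⟨Dup (p - 1) g, Dup_mem _ hg, fun l r hl => ?_⟩
      rcases le_or_gt r.length (p - q) with h' | h'
      · rw [Dup_of_le (by simp; omega)]
        exact Finset.sum_eq_zero fun j _ => Dup_of_le (by simp; omega) _
      · obtain ⟨a, i, b, rfl, ha⟩ := exists_split (show p - 1 - q < r.length by omega)
        obtain _ | ⟨i', b⟩ := b
        · simp at h'; omega
        have := hgs l (a ++ i' :: b) hl
        rw [← List.append_assoc, Dup_append (by simp; omega), List.append_assoc, ← this]
        have := fun j => Dup_append (p := p) (a := l ++ j :: a) (by simp; omega) d.ev i i' b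
        simp only [List.append_assoc, List.cons_append] at this
        simp only [this]
        split_ifs <;> simp

/-- Merging two adjacent legs of the vector of a diagram gives a noncrossing vector. -/
theorem Diagram.exists_merge (d : Diagram) (q : ℕ) : ∃ g ∈ ncSpan ι, ∀ (l : List ι) (j : ι)
    (r : List ι), l.length = q → d.ev (l ++ j :: j :: r) = g (l ++ j :: r) := by
  induction d generalizing q with
  | nil => exact ⟨0, zero_mem _, fun l j r _ => by simp [ev]⟩
  | ins p d ih =>
    simp only [ev]
    rcases lt_or_ge p q with h | h
    · obtain ⟨g, hg, hgs⟩ := ih (q - 1)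
      refine ⟨Ins p g, Ins_mem p hg, fun l j r hl => ?_⟩
      obtain ⟨a, i, b, rfl, ha⟩ := exists_split (h.trans_eq hl.symm)
      have := hgs (a ++ b) j r (by simp at hl ⊢; omega)
      simp only [List.append_assoc, List.cons_append, Ins_append ha] at this ⊢
      exact this
    rcases eq_or_lt_of_le h with h | h
    · refine ⟨d.ev, d.ev_mem, fun l j r hl => ?_⟩
      rw [Ins_append (hl.trans h)]
    rcases eq_or_lt_of_le (Nat.succ_le_of_lt h) with h | h
    · refine ⟨d.ev, d.ev_mem, fun l j r hl => ?_⟩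
      have := Ins_append (p := p) (a := l ++ [j]) (by simp; omega) d.ev j r
      simpa using this
    · obtain ⟨g, hg, hgs⟩ := ih q
      refine ⟨Ins (p - 1) g, Ins_mem _ hg, fun l j r hl => ?_⟩
      rcases le_or_gt r.length (p - 2 - q) with h' | h'
      · rw [Ins_of_le (by simp; omega), Ins_of_le (by simp; omega)]
      · obtain ⟨a, i, b, rfl, ha⟩ := exists_split h'
        have := hgs l j (a ++ b) hl
        have e1 := Ins_append (p := p) (a := l ++ j :: j :: a) (by simp; omega) d.ev i b
        have e2 := Ins_append (p := p - 1) (a := l ++ j :: a) (by simp; omega) g i b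
        simp only [List.append_assoc, List.cons_append] at e1 e2
        rw [e1, e2, this]
  | dup p d ih =>
    simp only [ev]
    rcases lt_or_ge (p + 1) q with h | h
    · obtain ⟨g, hg, hgs⟩ := ih (q - 1)
      refine ⟨Dup p g, Dup_mem p hg, fun l j r hl => ?_⟩
      obtain ⟨a, i, b, rfl, ha⟩ := exists_split (show p < l.length by omega)
      obtain _ | ⟨i', b⟩ := b
      · simp at hl; omega
      have := hgs (a ++ i' :: b) j r (by simp at hl ⊢; omega)
      simp only [List.append_assoc, List.cons_append, Dup_append ha] at this ⊢
      rw [this]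
    rcases eq_or_lt_of_le h with h | h
    · obtain ⟨g, hg, hgs⟩ := ih (q - 1)
      refine ⟨Dup p g, Dup_mem p hg, fun l j r hl => ?_⟩
      obtain ⟨a, i, b, rfl, ha⟩ := exists_split (show p < l.length by omega)
      obtain rfl : b = [] := List.length_eq_zero_iff.1 (by simp at hl; omega)
      have := hgs a j r (by omega)
      simp only [List.append_assoc, List.cons_append, List.nil_append, Dup_append ha]
      rw [this]
    rcases eq_or_lt_of_le (Nat.lt_succ_iff.1 h) with h | h
    · subst h
      exact ⟨d.ev, d.ev_mem, fun l j r hl => by simp [Dup_append hl]⟩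
    · obtain ⟨g, hg, hgs⟩ := ih q
      refine ⟨Dup (p - 1) g, Dup_mem _ hg, fun l j r hl => ?_⟩
      rcases le_or_gt r.length (p - q - 1) with h' | h'
      · rw [Dup_of_le (by simp; omega), Dup_of_le (by simp; omega)]
      rcases eq_or_lt_of_le (Nat.succ_le_of_lt h) with h1 | h1
      · obtain _ | ⟨i, r⟩ := r
        · simp at h'
        have e1 := Dup_append (p := p) (a := l ++ [j]) (by simp; omega) d.ev j i r
        have e2 := Dup_append (p := p - 1) (a := l) (by omega) g j i r
        simp only [List.append_assoc, List.cons_append, List.nil_append] at e1 e2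
        rw [e1, e2]
        split_ifs with hji
        · subst hji; exact hgs l j r hl
        · rfl
      · obtain ⟨a, i, b, rfl, ha⟩ := exists_split (show p - 2 - q < r.length by omega)
        obtain _ | ⟨i', b⟩ := b
        · simp at h'; omega
        have := hgs l j (a ++ i' :: b) hl
        have e1 := Dup_append (p := p) (a := l ++ j :: j :: a) (by simp; omega) d.ev i i' b
        have e2 := Dup_append (p := p - 1) (a := l ++ j :: a) (by simp; omega) g i i' b
        simp only [List.append_assoc, List.cons_append] at e1 e2
        rw [e1, e2, this]

variable (ι) in
/-- The space of noncrossing vectors of length `k`: functions that agree with a combination of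
diagrams on the words of length `k`. -/
def NC (k : ℕ) : Submodule ℂ (List ι → ℂ) where
  carrier := {f | ∃ g ∈ ncSpan ι, ∀ l : List ι, l.length = k → f l = g l}
  zero_mem' := ⟨0, zero_mem _, fun _ _ => rfl⟩
  add_mem' := by
    rintro f f' ⟨g, hg, h⟩ ⟨g', hg', h'⟩
    exact ⟨g + g', add_mem hg hg', fun l hl => by simp [h l hl, h' l hl]⟩
  smul_mem' := by
    rintro c f ⟨g, hg, h⟩
    exact ⟨c • g, Submodule.smul_mem _ _ hg, fun l hl => by simp [h l hl]⟩

theorem NC.congr {k : ℕ} {f g : List ι → ℂ} (hf : f ∈ NC ι k)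
    (h : ∀ l : List ι, l.length = k → g l = f l) : g ∈ NC ι k := by
  obtain ⟨t, ht, hft⟩ := hf
  exact ⟨t, ht, fun l hl => (h l hl).trans (hft l hl)⟩

theorem Diagram.ev_mem_NC (d : Diagram) (k : ℕ) : (d.ev : List ι → ℂ) ∈ NC ι k :=
  ⟨_, d.ev_mem, fun _ _ => rfl⟩

@[elab_as_elim]
theorem NC.induction {k : ℕ} {motive : (f : List ι → ℂ) → f ∈ NC ι k → Prop}
    (diagram : ∀ d : Diagram, d.size = k → motive d.ev (d.ev_mem_NC k))
    (zero : motive 0 (zero_mem _))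
    (add : ∀ f g hf hg, motive f hf → motive g hg → motive (f + g) (add_mem hf hg))
    (smul : ∀ (c : ℂ) f hf, motive f hf → motive (c • f) (Submodule.smul_mem _ c hf))
    (congr : ∀ f g hf (h : ∀ l : List ι, l.length = k → g l = f l), motive f hf →
      motive g (NC.congr hf h))
    {f : List ι → ℂ} (hf : f ∈ NC ι k) : motive f hf := by
  obtain ⟨t, ht, hft⟩ := hf
  suffices H : ∃ h, motive t h from congr t f H.1 hft H.2
  refine Submodule.span_induction (p := fun f _ => ∃ h, motive f h) ?_ ⟨_, zero⟩ ?_ ?_ ht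
  · rintro _ ⟨d, rfl⟩
    by_cases h : d.size = k
    · exact ⟨_, diagram d h⟩
    · exact ⟨_, congr 0 _ _ (fun l hl => d.ev_of_length_ne (by omega)) zero⟩
  · rintro f g _ _ ⟨h, h'⟩ ⟨h1, h1'⟩
    exact ⟨_, add f g h h1 h' h1'⟩
  · rintro c f _ ⟨h, h'⟩
    exact ⟨_, smul c f h h'⟩

theorem conj_mem_NC {k : ℕ} {f : List ι → ℂ} (hf : f ∈ NC ι k) :
    (fun l => (starRingEnd ℂ) (f l)) ∈ NC ι k := by
  induction hf using NC.induction with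
  | diagram d _ => exact NC.congr (d.ev_mem_NC k) fun l _ => d.conj_ev l
  | zero => exact NC.congr (zero_mem _) fun l _ => by simp
  | add f g _ _ hf hg => exact NC.congr (add_mem hf hg) fun l _ => by simp
  | smul c f _ hf => exact NC.congr (Submodule.smul_mem _ (starRingEnd ℂ c) hf) fun l _ => by simp
  | congr f g _ h hf => exact NC.congr hf fun l hl => by simp [h l hl]

theorem NC.ins {k : ℕ} (p : ℕ) (hp : p ≤ k) {f : List ι → ℂ} (hf : f ∈ NC ι k) :
    Ins p f ∈ NC ι (k + 1) := by
  obtain ⟨t, ht, hft⟩ := hf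
  refine ⟨Ins p t, Ins_mem p ht, fun l hl => ?_⟩
  obtain ⟨a, i, b, rfl, ha⟩ := exists_split (show p < l.length by omega)
  rw [Ins_append ha, Ins_append ha, hft]
  simp at hl ⊢; omega

theorem NC.dup {k : ℕ} (p : ℕ) (hp : p < k) {f : List ι → ℂ} (hf : f ∈ NC ι k) :
    Dup p f ∈ NC ι (k + 1) := by
  obtain ⟨t, ht, hft⟩ := hf
  refine ⟨Dup p t, Dup_mem p ht, fun l hl => ?_⟩
  obtain ⟨a, i, b, rfl, ha⟩ := exists_split (show p < l.length by omega)
  obtain _ | ⟨j, b⟩ := b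
  · simp at hl; omega
  rw [Dup_append ha, Dup_append ha, hft]
  simp at hl ⊢; omega

/-- Noncrossing vectors are stable under summation of a leg. -/
theorem NC.sum [Fintype ι] {k q : ℕ} {f g : List ι → ℂ} (hq : q ≤ k) (hf : f ∈ NC ι (k + 1))
    (h : ∀ l r : List ι, l.length = q → l.length + r.length = k →
      g (l ++ r) = ∑ j, f (l ++ j :: r)) : g ∈ NC ι k := by
  suffices H : (fun l : List ι => ∑ j, f (l.take q ++ j :: l.drop q)) ∈ NC ι k by
    refine NC.congr H fun l hl => ?_
    rw [← h _ _ (by simp; omega) (by simp; omega), List.take_append_drop]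
  clear h
  induction hf using NC.induction with
  | diagram d _ =>
    obtain ⟨t, ht, h⟩ := d.exists_sum (ι := ι) q
    exact ⟨t, ht, fun l hl => by
      rw [← List.take_append_drop q l, ← h _ _ (by simp; omega), List.take_append_drop]⟩
  | zero => exact NC.congr (zero_mem _) fun l _ => by simp
  | add f g _ _ hf hg =>
    exact NC.congr (add_mem hf hg) fun l _ => by simp [Finset.sum_add_distrib]
  | smul c f _ hf => exact NC.congr (Submodule.smul_mem _ c hf) fun l _ => by simp [Finset.mul_sum]
  | congr f g _ h hf =>
    refine NC.congr hf fun l hl => Finset.sum_congr rfl fun j _ => h _ ?_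
    simp; omega

/-- Noncrossing vectors are stable under merging two adjacent legs. -/
theorem NC.merge {k q : ℕ} {f g : List ι → ℂ} (hq : q < k) (hf : f ∈ NC ι (k + 1))
    (h : ∀ (l : List ι) (j : ι) (r : List ι), l.length = q → l.length + r.length + 1 = k →
      g (l ++ j :: r) = f (l ++ j :: j :: r)) : g ∈ NC ι k := by
  suffices H : (fun l : List ι => f (l.take (q + 1) ++ l.drop q)) ∈ NC ι k by
    refine NC.congr H fun l hl => ?_
    obtain ⟨a, i, b, rfl, ha⟩ := exists_split (show q < l.length by omega)
    rw [h _ _ _ ha (by simp at hl; omega)]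
    subst ha
    simp [List.take_append, List.take_of_length_le]
  clear h
  induction hf using NC.induction with
  | diagram d _ =>
    obtain ⟨t, ht, h⟩ := d.exists_merge (ι := ι) q
    refine ⟨t, ht, fun l hl => ?_⟩
    obtain ⟨a, i, b, rfl, ha⟩ := exists_split (show q < l.length by omega)
    rw [← h _ _ _ ha]
    subst ha
    simp [List.take_append, List.take_of_length_le]
  | zero => exact NC.congr (zero_mem _) fun l _ => by simp
  | add f g _ _ hf hg => exact NC.congr (add_mem hf hg) fun l _ => by simp
  | smul c f _ hf => exact NC.congr (Submodule.smul_mem _ c hf) fun l _ => by simp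
  | congr f g _ h hf =>
    refine NC.congr hf fun l hl => h _ ?_
    simp; omega

/-- A noncrossing vector of length `0` is arbitrary. -/
theorem NC.of_zero (f : List ι → ℂ) : f ∈ NC ι 0 := by
  refine NC.congr (Submodule.smul_mem _ (f []) (Diagram.nil.ev_mem_NC 0)) fun l hl => ?_
  rw [List.length_eq_zero_iff] at hl
  simp [hl, Diagram.ev]

/-! ### The projection onto the noncrossing vectors -/

section Kernel

variable [Fintype ι]

variable (ι) in
/-- A kernel on words of length `k` that represents the projection onto the noncrossing vectors:
its columns are noncrossing, and it reproduces noncrossing vectors from either side. -/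
structure IsNCKernel (k : ℕ) (R : List ι → List ι → ℂ) : Prop where
  col_mem : ∀ m, (fun l => R l m) ∈ NC ι k
  symm : ∀ l m, R l m = R m l
  repr : ∀ t ∈ NC ι k, ∀ l : List ι, l.length = k → ∑ m ∈ words ι k, R l m * t m = t l

/-- The bilinear pairing is nondegenerate on the noncrossing vectors, since they are stable under
complex conjugation. -/
theorem NC.eq_zero_of_orthogonal {k : ℕ} {f : List ι → ℂ} (hf : f ∈ NC ι k)
    (h : ∀ t ∈ NC ι k, ∑ l ∈ words ι k, f l * t l = 0) {l : List ι} (hl : l.length = k) :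
    f l = 0 := by
  have := h _ (conj_mem_NC hf)
  simp only [Complex.mul_conj] at this
  norm_cast at this
  rw [Finset.sum_eq_zero_iff_of_nonneg fun _ _ => Complex.normSq_nonneg _] at this
  exact Complex.normSq_eq_zero.1 (this l (by simpa using hl))

variable (ι) in
/-- The kernel of the orthogonal projection is real, since the noncrossing vectors are stable under
complex conjugation; hence it is symmetric. -/
theorem exists_isNCKernel (k : ℕ) : ∃ R, IsNCKernel ι k R := by
  classical
  let E := EuclideanSpace ℂ (words ι k)
  let T : E → List ι → ℂ := fun x l => if h : l ∈ words ι k then x ⟨l, h⟩ else 0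
  let V : Submodule ℂ E :=
    { carrier := {x | T x ∈ NC ι k}
      zero_mem' := NC.congr (zero_mem _) fun l _ => by simp [T]
      add_mem' := fun {x y} hx hy => NC.congr (add_mem hx hy) fun l hl => by
        simp [T, hl]; rfl
      smul_mem' := fun c x hx => NC.congr (Submodule.smul_mem _ c hx) fun l hl => by
        simp [T, hl]; rfl }
  let e : List ι → E := fun m => WithLp.toLp 2 fun l => if l.1 = m then 1 else 0
  let R0 : List ι → List ι → ℂ := fun l m => T (V.starProjection (e m)) l
  have hinner : ∀ x y : E, inner ℂ x y = ∑ l ∈ words ι k, starRingEnd ℂ (T x l) * T y l := by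
    intro x y
    rw [PiLp.inner_apply, ← Finset.sum_coe_sort (words ι k)]
    refine Finset.sum_congr rfl fun l _ => ?_
    simp only [T, dif_pos l.2, mul_comm, RCLike.inner_apply]
  have hcol : ∀ m, (fun l => R0 l m) ∈ NC ι k := fun m => V.starProjection_apply_mem (e m)
  have hTe : ∀ m, ∀ l ∈ words ι k, T (e m) l = if l = m then 1 else 0 := fun m l hl => by
    simp only [T, dif_pos hl]; rfl
  have hherm : ∀ l ∈ words ι k, ∀ m ∈ words ι k, R0 l m = starRingEnd ℂ (R0 m l) := by
    intro l hl m hm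
    have h1 := V.inner_starProjection_left_eq_right (e l) (e m)
    rw [hinner, hinner] at h1
    have e1 : ∀ f : List ι → ℂ, ∑ x ∈ words ι k, starRingEnd ℂ (T (e l) x) * f x = f l := by
      intro f
      rw [Finset.sum_congr rfl fun x hx => by rw [hTe _ x hx]]
      simp [hl]
    have e2 : ∀ f : List ι → ℂ, ∑ x ∈ words ι k, f x * T (e m) x = f m := by
      intro f
      rw [Finset.sum_congr rfl fun x hx => by rw [hTe _ x hx]]
      simp [hm]
    rw [e1, e2 fun x => starRingEnd ℂ (T (V.starProjection (e l)) x)] at h1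
    exact h1.symm
  have hrepr : ∀ t ∈ NC ι k, ∀ l ∈ words ι k, ∑ m ∈ words ι k, R0 l m * t m = t l := by
    intro t ht l hl
    let x : E := WithLp.toLp 2 fun l => t l.1
    have hTx : ∀ l ∈ words ι k, T x l = t l := fun l hl => by simp only [T, dif_pos hl]; rfl
    have hx : x ∈ V := NC.congr ht fun l hl => hTx l (by simpa using hl)
    have h1 := V.inner_starProjection_left_eq_right (e l) x
    rw [Submodule.starProjection_eq_self_iff.2 hx, hinner, hinner] at h1
    rw [← hTx l hl]
    have e1 : ∑ y ∈ words ι k, starRingEnd ℂ (T (e l) y) * T x y = T x l := by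
      rw [Finset.sum_congr rfl fun x hx => by rw [hTe _ x hx]]
      simp [hl]
    rw [e1] at h1
    rw [← h1]
    refine Finset.sum_congr rfl fun m hm => ?_
    rw [hherm l hl m hm, hTx m hm]
  have hreal : ∀ l ∈ words ι k, ∀ m ∈ words ι k, starRingEnd ℂ (R0 l m) = R0 l m := by
    intro l hl m hm
    have hlk : l.length = k := by simpa using hl
    have h0 : (fun l => R0 l m - starRingEnd ℂ (R0 l m)) ∈ NC ι k :=
      sub_mem (hcol m) (conj_mem_NC (hcol m))
    refine (sub_eq_zero.1 (NC.eq_zero_of_orthogonal h0 (fun t ht => ?_) hlk)).symm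
    simp only [sub_mul, Finset.sum_sub_distrib]
    have e1 := congrArg (starRingEnd ℂ) (hrepr _ (conj_mem_NC ht) m hm)
    have e2 := hrepr t ht m hm
    rw [map_sum] at e1
    simp only [map_mul, Complex.conj_conj] at e1
    rw [sub_eq_zero, Finset.sum_congr rfl fun x hx => by rw [hherm x hx m hm], e1, ← e2]
    exact Finset.sum_congr rfl fun x hx => by rw [← hherm m hm x hx]
  refine ⟨fun l m => if l ∈ words ι k ∧ m ∈ words ι k then R0 l m else 0, ⟨fun m => ?_,
    fun l m => ?_, fun t ht l hl => ?_⟩⟩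
  · by_cases hm : m ∈ words ι k
    · exact NC.congr (hcol m) fun l hl => if_pos ⟨by simpa using hl, hm⟩
    · exact NC.congr (zero_mem _) fun l hl => if_neg fun h => hm h.2
  · by_cases h : l ∈ words ι k ∧ m ∈ words ι k
    · rw [if_pos h, if_pos h.symm, ← hreal l h.1 m h.2, ← hherm m h.2 l h.1]
    · rw [if_neg h, if_neg fun h' => h h'.symm]
  · have hl' : l ∈ words ι k := by simpa using hl
    rw [← hrepr t ht l hl']
    exact Finset.sum_congr rfl fun m hm => by rw [if_pos ⟨hl', hm⟩]

theorem IsNCKernel.row_mem {k : ℕ} {R : List ι → List ι → ℂ} (h : IsNCKernel ι k R)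
    (l : List ι) : R l ∈ NC ι k :=
  NC.congr (h.col_mem l) fun m _ => h.symm l m

theorem IsNCKernel.repr' {k : ℕ} {R : List ι → List ι → ℂ} (h : IsNCKernel ι k R)
    {t : List ι → ℂ} (ht : t ∈ NC ι k) {m : List ι} (hm : m.length = k) :
    ∑ l ∈ words ι k, R l m * t l = t m := by
  simp only [fun l => h.symm l m, h.repr t ht m hm]

end Kernel

end Noncrossing

/-! ### Matrix coefficients of words and intertwiners -/

/-- The relations of a magic unitary with an arbitrary index set. -/
structure Magic {ι B : Type*} [Fintype ι] [DecidableEq ι] [Semiring B] (p : ι → ι → B) :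
    Prop where
  row_mul : ∀ i j k, p i j * p i k = if j = k then p i j else 0
  col_mul : ∀ i j k, p i k * p j k = if i = j then p i k else 0
  row_sum : ∀ i, ∑ j, p i j = 1
  col_sum : ∀ j, ∑ i, p i j = 1

theorem IsMagic.magic {N : ℕ} {B : Type*} [Semiring B] {p : Fin N → Fin N → B}
    (h : IsMagic p) : Magic p := ⟨h.row_mul, h.col_mul, h.row_sum, h.col_sum⟩

section WordMat

variable {ι Z B : Type*}

/-- The number of legs of a word. The entries `none` of a word stand for legs, the entries
`some z` for scalar letters. -/
def legs : List (Option Z) → ℕ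
  | [] => 0
  | none :: w => legs w + 1
  | some _ :: w => legs w

@[simp] theorem legs_nil : legs ([] : List (Option Z)) = 0 := rfl
@[simp] theorem legs_none (w : List (Option Z)) : legs (none :: w) = legs w + 1 := rfl
@[simp] theorem legs_some (z : Z) (w : List (Option Z)) : legs (some z :: w) = legs w := rfl

@[simp] theorem legs_append (w w' : List (Option Z)) : legs (w ++ w') = legs w + legs w' := by
  induction w with
  | nil => simp
  | cons a w ih => cases a <;> simp [ih]; omega

@[simp] theorem legs_replicate (k : ℕ) : legs (List.replicate k (none : Option Z)) = k := by
  induction k with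
  | zero => rfl
  | succ k ih => simp [List.replicate_succ, ih]

variable [Semiring B]

/-- The matrix coefficients of a word: a leg contributes the matrix `p`, a letter `z` the
scalar matrix `Y z`, and the factors are multiplied from left to right. -/
def wordMat (p : ι → ι → B) (Y : Z → B) : List (Option Z) → List ι → List ι → B
  | [], [], [] => 1
  | none :: w, i :: l, j :: m => p i j * wordMat p Y w l m
  | some z :: w, l, m => Y z * wordMat p Y w l m
  | [], _ :: _, _ => 0
  | [], [], _ :: _ => 0
  | none :: _, [], _ => 0
  | none :: _, _ :: _, [] => 0

variable (p : ι → ι → B) (Y : Z → B)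

@[simp] theorem wordMat_nil : wordMat p Y [] [] [] = 1 := rfl

@[simp] theorem wordMat_none (w : List (Option Z)) (i j : ι) (l m : List ι) :
    wordMat p Y (none :: w) (i :: l) (j :: m) = p i j * wordMat p Y w l m := rfl

@[simp] theorem wordMat_some (z : Z) (w : List (Option Z)) (l m : List ι) :
    wordMat p Y (some z :: w) l m = Y z * wordMat p Y w l m := by
  cases l <;> cases m <;> rfl

theorem wordMat_append {w w' : List (Option Z)} {l l' m m' : List ι} (hl : l.length = legs w)
    (hm : m.length = legs w) :
    wordMat p Y (w ++ w') (l ++ l') (m ++ m') = wordMat p Y w l m * wordMat p Y w' l' m' := by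
  induction w generalizing l m with
  | nil =>
    rw [legs_nil, List.length_eq_zero_iff] at hl hm
    simp [hl, hm]
  | cons a w ih =>
    cases a with
    | none =>
      obtain _ | ⟨i, l⟩ := l
      · simp at hl
      obtain _ | ⟨j, m⟩ := m
      · simp at hm
      simp only [List.cons_append, wordMat_none]
      rw [ih (by simpa using hl) (by simpa using hm), mul_assoc]
    | some z =>
      simp only [List.cons_append, wordMat_some]
      rw [ih hl hm, mul_assoc]

theorem wordMat_insert {w w' : List (Option Z)} {l l' m m' : List ι} (hl : l.length = legs w)
    (hm : m.length = legs w) (i j : ι) :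
    wordMat p Y (w ++ none :: w') (l ++ i :: l') (m ++ j :: m') =
      wordMat p Y w l m * (p i j * wordMat p Y w' l' m') := by
  rw [wordMat_append p Y hl hm, wordMat_none]

theorem wordMat_append_some (p : ι → ι → B) (Y : Z → B) (z : Z) {w : List (Option Z)} {l m : List ι}
    (hl : l.length = legs w) (hm : m.length = legs w) :
    wordMat p Y (w ++ [some z]) l m = wordMat p Y w l m * Y z := by
  have := wordMat_append p Y (w' := [some z]) (l' := []) (m' := []) hl hm
  simpa using this

theorem map_wordMat {B' : Type*} [Semiring B'] (φ : B →+* B') (w : List (Option Z))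
    (l m : List ι) :
    φ (wordMat p Y w l m) = wordMat (fun i j => φ (p i j)) (fun z => φ (Y z)) w l m := by
  induction w generalizing l m with
  | nil => cases l <;> cases m <;> simp [wordMat]
  | cons a w ih =>
    cases a with
    | none => cases l <;> cases m <;> simp [wordMat, ih]
    | some z => simp [ih]

theorem sum_words_legs [Fintype ι] {C : Type*} [AddCommMonoid C] (w w' : List (Option Z))
    (F : List ι → C) : ∑ x ∈ words ι (legs (w ++ none :: w')), F x =
      ∑ x ∈ words ι (legs w), ∑ y ∈ words ι (legs w'), ∑ j, F (x ++ j :: y) := by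
  rw [legs_append, legs_none, add_comm (legs w'), ← add_assoc, sum_words_insert]

theorem exists_split_legs {w w' : List (Option Z)} {l : List ι}
    (h : l.length = legs (w ++ none :: w')) :
    ∃ a i b, l = a ++ i :: b ∧ a.length = legs w ∧ b.length = legs w' := by
  obtain ⟨a, i, b, rfl, ha⟩ := exists_split (l := l) (p := legs w) (by simp at h; omega)
  exact ⟨a, i, b, rfl, ha, by simp at h; omega⟩

end WordMat

section Intertwiners

variable {ι Z B : Type*} [Fintype ι] [Semiring B] [Algebra ℂ B]

/-- The matrix `ξ` of scalars intertwines the words `v` and `w` for `p` and `Y`, that is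
`wordMat w * ξ = ξ * wordMat v`. -/
def Intertwines (p : ι → ι → B) (Y : Z → B) (v w : List (Option Z)) (ξ : List ι → List ι → ℂ) :
    Prop :=
  ∀ l m : List ι, l.length = legs w → m.length = legs v →
    ∑ x ∈ words ι (legs w), ξ x m • wordMat p Y w l x =
      ∑ y ∈ words ι (legs v), ξ l y • wordMat p Y v y m

/-- The vector `f` is fixed by the word `w`. -/
def IsFixed (p : ι → ι → B) (Y : Z → B) (w : List (Option Z)) (f : List ι → ℂ) : Prop :=
  Intertwines p Y [] w fun l _ => f l

variable {p : ι → ι → B} {Y : Z → B}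

theorem isFixed_iff {w : List (Option Z)} {f : List ι → ℂ} : IsFixed p Y w f ↔
    ∀ l : List ι, l.length = legs w →
      ∑ x ∈ words ι (legs w), f x • wordMat p Y w l x = f l • (1 : B) := by
  refine ⟨fun h l hl => ?_, fun h l m hl hm => ?_⟩
  · simpa using h l [] hl rfl
  · rw [legs_nil, List.length_eq_zero_iff] at hm
    subst hm
    simpa using h l hl

theorem Intertwines.congr {v w : List (Option Z)} {ξ η : List ι → List ι → ℂ}
    (h : Intertwines p Y v w ξ) (e : ∀ l m : List ι, l.length = legs w → m.length = legs v →
      η l m = ξ l m) : Intertwines p Y v w η := by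
  intro l m hl hm
  rw [Finset.sum_congr rfl fun x hx => by rw [e x m (by simpa using hx) hm], h l m hl hm]
  exact Finset.sum_congr rfl fun x hx => by rw [e l x hl (by simpa using hx)]

theorem IsFixed.congr {w : List (Option Z)} {f g : List ι → ℂ} (h : IsFixed p Y w f)
    (e : ∀ l : List ι, l.length = legs w → g l = f l) : IsFixed p Y w g :=
  Intertwines.congr h fun l _ hl _ => e l hl

theorem Intertwines.zero (v w : List (Option Z)) :
    Intertwines p Y v w (0 : List ι → List ι → ℂ) := by
  intro l m _ _; simp

theorem Intertwines.add {v w : List (Option Z)} {ξ η : List ι → List ι → ℂ}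
    (h : Intertwines p Y v w ξ) (h' : Intertwines p Y v w η) :
    Intertwines p Y v w (ξ + η) := by
  intro l m hl hm
  simp only [Pi.add_apply, add_smul, Finset.sum_add_distrib, h l m hl hm, h' l m hl hm]

theorem Intertwines.smul {v w : List (Option Z)} {ξ : List ι → List ι → ℂ} (c : ℂ)
    (h : Intertwines p Y v w ξ) : Intertwines p Y v w (c • ξ) := by
  intro l m hl hm
  simp only [Pi.smul_apply, smul_assoc, ← Finset.smul_sum, h l m hl hm]

theorem Intertwines.comp {u v w : List (Option Z)} {ξ η : List ι → List ι → ℂ}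
    (hξ : Intertwines p Y v w ξ) (hη : Intertwines p Y u v η) :
    Intertwines p Y u w fun l m => ∑ y ∈ words ι (legs v), ξ l y * η y m := by
  intro l m hl hm
  calc _ = ∑ y ∈ words ι (legs v), η y m • ∑ x ∈ words ι (legs w), ξ x y • wordMat p Y w l x := by
        simp only [Finset.sum_smul, Finset.smul_sum]
        rw [Finset.sum_comm]
        simp only [smul_smul, mul_comm]
    _ = ∑ y ∈ words ι (legs v), ∑ y' ∈ words ι (legs v),
          ξ l y' • η y m • wordMat p Y v y' y := by
        refine Finset.sum_congr rfl fun y hy => ?_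
        rw [hξ l y hl (by simpa using hy), Finset.smul_sum]
        exact Finset.sum_congr rfl fun y' _ => smul_comm _ _ _
    _ = ∑ y' ∈ words ι (legs v), ξ l y' • ∑ z ∈ words ι (legs u), η y' z • wordMat p Y u z m := by
        rw [Finset.sum_comm]
        refine Finset.sum_congr rfl fun y' hy' => ?_
        rw [← hη y' m (by simpa using hy') hm, Finset.smul_sum]
    _ = _ := by
        simp only [Finset.sum_smul, Finset.smul_sum, smul_smul]
        rw [Finset.sum_comm]

/-- Intertwiners are preserved by injective algebra morphisms, and reflected by them. -/
theorem Intertwines.of_map {B' : Type*} [Semiring B'] [Algebra ℂ B'] (φ : B →ₐ[ℂ] B')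
    (hφ : Function.Injective φ) {v w : List (Option Z)} {ξ : List ι → List ι → ℂ}
    (h : Intertwines (fun i j => φ (p i j)) (fun z => φ (Y z)) v w ξ) :
    Intertwines p Y v w ξ := by
  intro l m hl hm
  apply hφ
  have hw := map_wordMat p Y (φ : B →+* B')
  simp only [RingHom.coe_coe] at hw
  simpa only [map_sum, map_smul, hw] using h l m hl hm

theorem Intertwines.map {B' : Type*} [Semiring B'] [Algebra ℂ B'] (φ : B →ₐ[ℂ] B')
    {v w : List (Option Z)} {ξ : List ι → List ι → ℂ} (h : Intertwines p Y v w ξ) :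
    Intertwines (fun i j => φ (p i j)) (fun z => φ (Y z)) v w ξ := by
  intro l m hl hm
  have hw := map_wordMat p Y (φ : B →+* B')
  simp only [RingHom.coe_coe] at hw
  simpa only [map_sum, map_smul, hw] using congrArg φ (h l m hl hm)

/-- A common first letter with a left inverse can be cancelled. -/
theorem Intertwines.strip_left {z : Z} (hz : ∃ y, y * Y z = 1) {v w : List (Option Z)}
    {ξ : List ι → List ι → ℂ} (h : Intertwines p Y (some z :: v) (some z :: w) ξ) :
    Intertwines p Y v w ξ := by
  obtain ⟨y, hy⟩ := hz
  intro l m hl hm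
  have := congrArg (y * ·) (h l m hl hm)
  simpa [Finset.mul_sum, ← mul_assoc, hy] using this

theorem Intertwines.add_left (z : Z) {v w : List (Option Z)}
    {ξ : List ι → List ι → ℂ} (h : Intertwines p Y v w ξ) :
    Intertwines p Y (some z :: v) (some z :: w) ξ := by
  intro l m hl hm
  have := congrArg (Y z * ·) (h l m hl hm)
  simpa [Finset.mul_sum] using this

/-- A common last letter with a right inverse can be cancelled. -/
theorem Intertwines.strip_right {z : Z} (hz : ∃ y, Y z * y = 1) {v w : List (Option Z)}
    {ξ : List ι → List ι → ℂ} (h : Intertwines p Y (v ++ [some z]) (w ++ [some z]) ξ) :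
    Intertwines p Y v w ξ := by
  obtain ⟨y, hy⟩ := hz
  intro l m hl hm
  have := congrArg (· * y) (h l m (by simpa using hl) (by simpa using hm))
  simp only [legs_append, legs_some, legs_nil, add_zero, Finset.sum_mul] at this
  rw [Finset.sum_congr rfl fun x hx => by
    rw [wordMat_append_some p Y z hl (by simpa using hx), smul_mul_assoc, mul_assoc, hy, mul_one],
    ] at this
  rw [this]
  exact Finset.sum_congr rfl fun x hx => by
    rw [wordMat_append_some p Y z (by simpa using hx) hm, smul_mul_assoc, mul_assoc, hy, mul_one]

variable [DecidableEq ι]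

/-- Frobenius reciprocity: the first leg of the source becomes the first leg of the target. -/
theorem Intertwines.bend_in (hp : Magic p) {v w : List (Option Z)} {ξ η : List ι → List ι → ℂ}
    (h : Intertwines p Y (none :: v) w ξ)
    (e : ∀ j l m, l.length = legs w → m.length = legs v → η (j :: l) m = ξ l (j :: m)) :
    Intertwines p Y v (none :: w) η := by
  intro l m hl hm
  obtain _ | ⟨i, l⟩ := l
  · simp at hl
  have hl' : l.length = legs w := by simpa using hl
  have h1 : ∀ j, p i j * ∑ x ∈ words ι (legs w), ξ x (j :: m) • wordMat p Y w l x =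
      ∑ y ∈ words ι (legs v), ξ l (i :: y) • (p i j * wordMat p Y v y m) := by
    intro j
    rw [h l (j :: m) hl' (by simp [hm]), legs_none, sum_words_succ, Finset.mul_sum,
      Finset.sum_eq_single i]
    · simp [Finset.mul_sum, ← mul_assoc, hp.row_mul]
    · intro i' _ hi'
      simp [Finset.mul_sum, ← mul_assoc, hp.col_mul, hi'.symm]
    · simp
  rw [legs_none, sum_words_succ]
  have h2 : ∀ j, ∑ x ∈ words ι (legs w), η (j :: x) m • wordMat p Y (none :: w) (i :: l) (j :: x) =
      p i j * ∑ x ∈ words ι (legs w), ξ x (j :: m) • wordMat p Y w l x := by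
    intro j
    rw [Finset.mul_sum]
    refine Finset.sum_congr rfl fun x hx => ?_
    rw [e j x m (by simpa using hx) hm, wordMat_none, mul_smul_comm]
  simp only [h2, h1]
  rw [Finset.sum_comm]
  refine Finset.sum_congr rfl fun y hy => ?_
  rw [← Finset.smul_sum, ← Finset.sum_mul, hp.row_sum, one_mul, e i l y hl' (by simpa using hy)]

/-- Frobenius reciprocity: the first leg of the target becomes the first leg of the source. -/
theorem Intertwines.bend_out (hp : Magic p) {v w : List (Option Z)} {ξ η : List ι → List ι → ℂ}
    (h : Intertwines p Y v (none :: w) ξ)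
    (e : ∀ j l m, l.length = legs w → m.length = legs v → η l (j :: m) = ξ (j :: l) m) :
    Intertwines p Y (none :: v) w η := by
  intro l m hl hm
  obtain _ | ⟨j, m⟩ := m
  · simp at hm
  have hm' : m.length = legs v := by simpa using hm
  have h1 : ∀ i, p i j * ∑ y ∈ words ι (legs v), ξ (i :: l) y • wordMat p Y v y m =
      ∑ x ∈ words ι (legs w), ξ (j :: x) m • (p i j * wordMat p Y w l x) := by
    intro i
    rw [← h (i :: l) m (by simp [hl]) hm', legs_none, sum_words_succ, Finset.mul_sum,
      Finset.sum_eq_single j]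
    · simp [Finset.mul_sum, ← mul_assoc, hp.row_mul]
    · intro i' _ hi'
      simp [Finset.mul_sum, ← mul_assoc, hp.row_mul, hi'.symm]
    · simp
  rw [legs_none, sum_words_succ]
  have h2 : ∀ i, ∑ y ∈ words ι (legs v), η l (i :: y) • wordMat p Y (none :: v) (i :: y) (j :: m) =
      p i j * ∑ y ∈ words ι (legs v), ξ (i :: l) y • wordMat p Y v y m := by
    intro i
    rw [Finset.mul_sum]
    refine Finset.sum_congr rfl fun x hx => ?_
    rw [e i l x hl (by simpa using hx), wordMat_none, mul_smul_comm]
  simp only [h2, h1]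
  rw [Finset.sum_comm]
  refine Finset.sum_congr rfl fun x hx => ?_
  rw [← Finset.smul_sum, ← Finset.sum_mul, hp.col_sum, one_mul, e j x m (by simpa using hx) hm']

/-- Summation of a leg of the target. -/
theorem Intertwines.sum (hp : Magic p) {v w w' : List (Option Z)} {ξ η : List ι → List ι → ℂ}
    (h : Intertwines p Y v (w ++ none :: w') ξ)
    (e : ∀ l r m, l.length = legs w → r.length = legs w' → m.length = legs v →
      η (l ++ r) m = ∑ j, ξ (l ++ j :: r) m) : Intertwines p Y v (w ++ w') η := by
  intro l m hl hm
  obtain ⟨l, r, rfl, hl, hr⟩ : ∃ a b, l = a ++ b ∧ a.length = legs w ∧ b.length = legs w' :=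
    ⟨l.take (legs w), l.drop (legs w), by simp, by simp at hl ⊢; omega, by simp at hl ⊢; omega⟩
  have h1 : ∑ i, ∑ x ∈ words ι (legs (w ++ none :: w')), ξ x m •
      wordMat p Y (w ++ none :: w') (l ++ i :: r) x =
      ∑ y ∈ words ι (legs v), η (l ++ r) y • wordMat p Y v y m := by
    have hh := fun i => h (l ++ i :: r) m (by simp; omega) hm
    simp only [hh]
    rw [Finset.sum_comm]
    exact Finset.sum_congr rfl fun y hy => by
      rw [e l r y hl hr (by simpa using hy), Finset.sum_smul]
  simp only [sum_words_legs] at h1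
  rw [← h1, legs_append, sum_words_append]
  conv_rhs => rw [Finset.sum_comm]
  refine Finset.sum_congr rfl fun x hx => ?_
  conv_rhs => rw [Finset.sum_comm]
  refine Finset.sum_congr rfl fun y hy => ?_
  rw [mem_words] at hx hy
  conv_rhs => rw [Finset.sum_comm]
  rw [e x y m hx hy hm, Finset.sum_smul]
  refine Finset.sum_congr rfl fun j _ => ?_
  simp only [wordMat_insert p Y hl hx, ← Finset.smul_sum, ← Finset.mul_sum, ← Finset.sum_mul,
    hp.col_sum, one_mul, wordMat_append p Y hl hx]

/-- Insertion of a free leg in the target. -/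
theorem Intertwines.ins (hp : Magic p) {v w w' : List (Option Z)} {ξ η : List ι → List ι → ℂ}
    (h : Intertwines p Y v (w ++ w') ξ)
    (e : ∀ l i r m, l.length = legs w → r.length = legs w' → m.length = legs v →
      η (l ++ i :: r) m = ξ (l ++ r) m) : Intertwines p Y v (w ++ none :: w') η := by
  intro l m hL hm
  obtain ⟨l, i, r, rfl, hl, hr⟩ := exists_split_legs hL
  clear hL
  have h1 := h (l ++ r) m (by simp; omega) hm
  conv_rhs => rw [Finset.sum_congr rfl fun y hy => by rw [e l i r y hl hr (by simpa using hy)], ← h1]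
  rw [sum_words_legs, legs_append, sum_words_append]
  refine Finset.sum_congr rfl fun x hx => Finset.sum_congr rfl fun y hy => ?_
  rw [mem_words] at hx hy
  simp only [e x _ y m hx hy hm, wordMat_insert p Y hl hx, ← Finset.smul_sum, ← Finset.mul_sum,
    ← Finset.sum_mul, hp.row_sum, one_mul, wordMat_append p Y hl hx]

/-- Merging of two adjacent legs of the target. -/
theorem Intertwines.merge (hp : Magic p) {v w w' : List (Option Z)} {ξ η : List ι → List ι → ℂ}
    (h : Intertwines p Y v (w ++ none :: none :: w') ξ)
    (e : ∀ l j r m, l.length = legs w → r.length = legs w' → m.length = legs v →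
      η (l ++ j :: r) m = ξ (l ++ j :: j :: r) m) : Intertwines p Y v (w ++ none :: w') η := by
  intro l m hL hm
  obtain ⟨l, i, r, rfl, hl, hr⟩ := exists_split_legs hL
  clear hL
  have h1 := h (l ++ i :: i :: r) m (by simp; omega) hm
  conv_rhs => rw [Finset.sum_congr rfl fun y hy => by rw [e l i r y hl hr (by simpa using hy)], ← h1]
  rw [sum_words_legs, sum_words_legs]
  refine Finset.sum_congr rfl fun x hx => ?_
  rw [mem_words] at hx
  rw [legs_none, sum_words_succ, Finset.sum_comm]
  refine Finset.sum_congr rfl fun j _ => ?_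
  refine Finset.sum_congr rfl fun y hy => ?_
  rw [mem_words] at hy
  rw [Finset.sum_eq_single j]
  · rw [e x j y m hx hy hm, wordMat_insert p Y hl hx, wordMat_insert p Y hl hx, wordMat_none,
      ← mul_assoc (p i j) (p i j), hp.row_mul, if_pos rfl]
  · intro j' _ hj'
    rw [wordMat_insert p Y hl hx, wordMat_none, ← mul_assoc (p i j'), hp.row_mul, if_neg hj']
    simp
  · simp

/-- Doubling of a leg of the target. -/
theorem Intertwines.dup (hp : Magic p) {v w w' : List (Option Z)} {ξ η : List ι → List ι → ℂ}
    (h : Intertwines p Y v (w ++ none :: w') ξ)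
    (e : ∀ l i j r m, l.length = legs w → r.length = legs w' → m.length = legs v →
      η (l ++ i :: j :: r) m = if i = j then ξ (l ++ j :: r) m else 0) :
    Intertwines p Y v (w ++ none :: none :: w') η := by
  intro l m hL hm
  obtain ⟨l, i, r, rfl, hl, hr⟩ := exists_split_legs hL
  clear hL
  obtain _ | ⟨i', r⟩ := r
  · simp at hr
  have hr' : r.length = legs w' := by simpa using hr
  conv_rhs => rw [Finset.sum_congr rfl fun y hy => by rw [e l i i' r y hl hr' (by simpa using hy)]]
  have h3 : ∀ x ∈ words ι (legs w), ∑ y ∈ words ι (legs (none :: w')), ∑ j,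
      η (x ++ j :: y) m • wordMat p Y (w ++ none :: none :: w') (l ++ i :: i' :: r) (x ++ j :: y) =
      if i = i' then ∑ y ∈ words ι (legs w'), ∑ j, ξ (x ++ j :: y) m •
        wordMat p Y (w ++ none :: w') (l ++ i' :: r) (x ++ j :: y) else 0 := by
    intro x hx
    rw [mem_words] at hx
    have h4 : ∀ j, ∀ y ∈ words ι (legs w'), ∑ j', η (x ++ j' :: j :: y) m •
        wordMat p Y (w ++ none :: none :: w') (l ++ i :: i' :: r) (x ++ j' :: j :: y) =
        if i = i' then ξ (x ++ j :: y) m •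
          wordMat p Y (w ++ none :: w') (l ++ i' :: r) (x ++ j :: y) else 0 := by
      intro j y hy
      rw [mem_words] at hy
      rw [Finset.sum_eq_single j]
      · rw [e x j j y m hx hy hm, wordMat_insert p Y hl hx, wordMat_insert p Y hl hx,
          wordMat_none, ← mul_assoc (p i j) (p i' j), hp.col_mul, if_pos rfl]
        split_ifs with hi
        · subst hi; rfl
        · simp
      · intro j' _ hj'
        rw [e x j' j y m hx hy hm, if_neg hj', zero_smul]
      · simp
    rw [legs_none, sum_words_succ, Finset.sum_congr rfl fun j _ => Finset.sum_congr rfl (h4 j),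
      Finset.sum_comm]
    split_ifs <;> simp
  rw [sum_words_legs, Finset.sum_congr rfl h3]
  split_ifs with hi
  · rw [← sum_words_legs w w' fun x => ξ x m • wordMat p Y (w ++ none :: w') (l ++ i' :: r) x]
    exact h (l ++ i' :: r) m (by simp; omega) hm
  · simp

/-- Summing out the last leg on both sides. -/
theorem Intertwines.trace_last (hp : Magic p) {v w : List (Option Z)} {ξ η : List ι → List ι → ℂ}
    (h : Intertwines p Y (v ++ [none]) (w ++ [none]) ξ)
    (e : ∀ l m, l.length = legs w → m.length = legs v →
      η l m = ∑ j, ξ (l ++ [j]) (m ++ [j])) : Intertwines p Y v w η := by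
  intro l m hl hm
  have h1 : ∀ j j', (∑ x ∈ words ι (legs w), ξ (x ++ [j']) (m ++ [j']) • wordMat p Y w l x) *
      p j j' = (∑ y ∈ words ι (legs v), ξ (l ++ [j]) (y ++ [j]) • wordMat p Y v y m) * p j j' := by
    intro j j'
    have h2 := congrArg (· * p j j') (h (l ++ [j]) (m ++ [j']) (by simp; omega) (by simp; omega))
    simp only [sum_words_legs, Finset.sum_mul, legs_nil, sum_words_zero] at h2 ⊢
    rw [Finset.sum_congr rfl fun x hx => by
      rw [Finset.sum_eq_single j' (by
        intro j1 _ hj1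
        rw [wordMat_insert p Y hl (by simpa using hx), wordMat_nil, mul_one, smul_mul_assoc,
          mul_assoc, hp.row_mul, if_neg hj1]
        simp) (by simp), wordMat_insert p Y hl (by simpa using hx), wordMat_nil, mul_one,
        smul_mul_assoc, mul_assoc, hp.row_mul, if_pos rfl]] at h2
    simp only [smul_mul_assoc]
    rw [h2]
    exact Finset.sum_congr rfl fun x hx => by
      rw [Finset.sum_eq_single j (by
        intro j1 _ hj1
        rw [wordMat_insert p Y (by simpa using hx) hm, wordMat_nil, mul_one, smul_mul_assoc,
          mul_assoc, hp.col_mul, if_neg hj1]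
        simp) (by simp), wordMat_insert p Y (by simpa using hx) hm, wordMat_nil, mul_one,
        smul_mul_assoc, mul_assoc, hp.col_mul, if_pos rfl]
  have h2 : ∀ j', ∑ x ∈ words ι (legs w), ξ (x ++ [j']) (m ++ [j']) • wordMat p Y w l x =
      ∑ j, (∑ y ∈ words ι (legs v), ξ (l ++ [j]) (y ++ [j]) • wordMat p Y v y m) * p j j' := by
    intro j'
    rw [← Finset.sum_congr rfl fun j _ => h1 j j', ← Finset.mul_sum, hp.col_sum, mul_one]
  calc _ = ∑ j', ∑ x ∈ words ι (legs w), ξ (x ++ [j']) (m ++ [j']) • wordMat p Y w l x := by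
        rw [Finset.sum_comm]
        exact Finset.sum_congr rfl fun x hx => by
          rw [e x m (by simpa using hx) hm, Finset.sum_smul]
    _ = ∑ j, ∑ y ∈ words ι (legs v), ξ (l ++ [j]) (y ++ [j]) • wordMat p Y v y m := by
        simp only [h2]
        rw [Finset.sum_comm]
        simp only [← Finset.mul_sum, hp.row_sum, mul_one]
    _ = _ := by
        rw [Finset.sum_comm]
        exact Finset.sum_congr rfl fun x hx => by
          rw [e l x hl (by simpa using hx), Finset.sum_smul]

/-- Noncrossing vectors are fixed by every magic unitary. -/
theorem isFixed_of_mem_NC (hp : Magic p) {k : ℕ} {f : List ι → ℂ} (hf : f ∈ NC ι k) :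
    IsFixed p Y (List.replicate k none) f := by
  induction hf using NC.induction with
  | diagram d hd =>
    subst hd
    induction d with
    | nil =>
      rw [isFixed_iff]
      intro l hl
      rw [legs_replicate, Diagram.size, List.length_eq_zero_iff] at hl
      subst hl
      simp [Diagram.size]
    | ins q d ih =>
      rcases le_or_gt q d.size with h | h
      · obtain ⟨c, hc⟩ := Nat.exists_eq_add_of_le h
        have e1 : List.replicate d.size (none : Option Z) =
          List.replicate q none ++ List.replicate c none := by rw [hc, List.replicate_add]
        have e2 : List.replicate (Diagram.ins q d).size (none : Option Z) =
            List.replicate q none ++ none :: List.replicate c none := by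
          rw [Diagram.size, hc, add_assoc, List.replicate_add, List.replicate_succ]
        rw [e1] at ih
        rw [e2]
        exact Intertwines.ins hp ih fun l i r m hl _ _ => Ins_append (by simpa using hl) _ _ _
      · exact (Intertwines.zero _ _).congr fun l m hl _ =>
          Ins_of_le (by simp [Diagram.size] at hl; omega) _
    | dup q d ih =>
      rcases lt_or_ge q d.size with h | h
      · obtain ⟨c, hc⟩ := Nat.exists_eq_add_of_lt h
        have e1 : List.replicate d.size (none : Option Z) =
            List.replicate q none ++ none :: List.replicate c none := by
          rw [hc, add_assoc, List.replicate_add, List.replicate_succ]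
        have e2 : List.replicate (Diagram.dup q d).size (none : Option Z) =
            List.replicate q none ++ none :: none :: List.replicate c none := by
          rw [Diagram.size, hc, add_assoc, add_assoc, List.replicate_add]; rfl
        rw [e1] at ih
        rw [e2]
        exact Intertwines.dup hp ih fun l i j r m hl _ _ => Dup_append (by simpa using hl) _ _ _ _
      · exact (Intertwines.zero _ _).congr fun l m hl _ =>
          Dup_of_le (by simp [Diagram.size] at hl; omega) _
  | zero => exact Intertwines.zero _ _
  | add f g _ _ hf hg => exact hf.add hg
  | smul c f _ hf => exact hf.smul c
  | congr f g _ h hf => exact hf.congr fun l hl => h l (by simpa using hl)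

end Intertwiners

section Unitary

variable {ι Z B : Type*} [Fintype ι] [DecidableEq ι] [Semiring B] [StarRing B]

/-- The star-relations of a magic unitary and of a family of unitary letters. -/
structure IsUnitaryTest (p : ι → ι → B) (Y : Z → B) : Prop extends Magic p where
  star_p : ∀ i j, star (p i j) = p i j
  Y_mul_star : ∀ z, Y z * star (Y z) = 1
  star_mul_Y : ∀ z, star (Y z) * Y z = 1

variable {p : ι → ι → B} {Y : Z → B}

/-- The three forms of unitarity of the matrix of a word. The second and the third one express that
the matrix and its entrywise adjoint are isometries. -/
theorem IsUnitaryTest.wordMat_mul_star (h : IsUnitaryTest p Y) (w : List (Option Z))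
    {l l' : List ι} (hl : l.length = legs w) (hl' : l'.length = legs w) :
    ∑ m ∈ words ι (legs w), wordMat p Y w l m * star (wordMat p Y w l' m) =
      if l = l' then 1 else 0 := by
  induction w generalizing l l' with
  | nil =>
    rw [legs_nil, List.length_eq_zero_iff] at hl hl'
    simp [hl, hl']
  | cons a w ih =>
    cases a with
    | none =>
      obtain _ | ⟨i, l⟩ := l
      · simp at hl
      obtain _ | ⟨i', l'⟩ := l'
      · simp at hl'
      simp only [legs_none, List.length_cons, add_left_inj] at hl hl'
      rw [legs_none, sum_words_succ]
      simp only [wordMat_none, star_mul, h.star_p]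
      have : ∀ j, ∑ m ∈ words ι (legs w), p i j * wordMat p Y w l m *
          (star (wordMat p Y w l' m) * p i' j) = p i j * (if l = l' then 1 else 0) * p i' j := by
        intro j
        rw [← ih hl hl', Finset.mul_sum, Finset.sum_mul]
        simp only [mul_assoc]
      simp only [this]
      split_ifs with h1 h2 h2
      · simp only [List.cons.injEq] at h2
        simp [← h2.1, h.row_mul, h.row_sum]
      · have : i ≠ i' := by rintro rfl; exact h2 (by rw [h1])
        simp [h.col_mul, this]
      · simp only [List.cons.injEq] at h2
        exact absurd h2.2 h1
      · simp
    | some z =>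
      simp only [legs_some, wordMat_some, star_mul] at hl hl' ⊢
      have := congrArg (fun x => Y z * x * star (Y z)) (ih hl hl')
      simp only [Finset.mul_sum, Finset.sum_mul] at this
      calc _ = _ := by
            refine Eq.trans ?_ this
            simp only [mul_assoc]
        _ = _ := by split_ifs <;> simp [h.Y_mul_star]

theorem IsUnitaryTest.star_mul_wordMat (h : IsUnitaryTest p Y) (w : List (Option Z))
    {m m' : List ι} (hm : m.length = legs w) (hm' : m'.length = legs w) :
    ∑ l ∈ words ι (legs w), star (wordMat p Y w l m) * wordMat p Y w l m' =
      if m = m' then 1 else 0 := by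
  induction w generalizing m m' with
  | nil =>
    rw [legs_nil, List.length_eq_zero_iff] at hm hm'
    simp [hm, hm']
  | cons a w ih =>
    cases a with
    | none =>
      obtain _ | ⟨j, m⟩ := m
      · simp at hm
      obtain _ | ⟨j', m'⟩ := m'
      · simp at hm'
      simp only [legs_none, List.length_cons, add_left_inj] at hm hm'
      rw [legs_none, sum_words_succ, Finset.sum_comm]
      simp only [wordMat_none, star_mul, h.star_p]
      have : ∀ l, ∑ i, star (wordMat p Y w l m) * p i j * (p i j' * wordMat p Y w l m') =
          if j = j' then star (wordMat p Y w l m) * wordMat p Y w l m' else 0 := by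
        intro l
        simp only [mul_assoc, ← Finset.mul_sum, ← mul_assoc (p _ j), h.row_mul]
        rw [← Finset.sum_mul]
        split_ifs <;> simp [h.col_sum]
      simp only [this]
      by_cases hj : j = j'
      · simp only [hj, if_true, ih hm hm', List.cons.injEq, true_and]
      · simp [hj]
    | some z =>
      simp only [legs_some, wordMat_some, star_mul] at hm hm' ⊢
      rw [← ih hm hm']
      refine Finset.sum_congr rfl fun l _ => ?_
      rw [mul_assoc, ← mul_assoc (star (Y z)), h.star_mul_Y, one_mul]

theorem IsUnitaryTest.wordMat_mul_star' (h : IsUnitaryTest p Y) (w : List (Option Z))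
    {m m' : List ι} (hm : m.length = legs w) (hm' : m'.length = legs w) :
    ∑ l ∈ words ι (legs w), wordMat p Y w l m * star (wordMat p Y w l m') =
      if m = m' then 1 else 0 := by
  induction w generalizing m m' with
  | nil =>
    rw [legs_nil, List.length_eq_zero_iff] at hm hm'
    simp [hm, hm']
  | cons a w ih =>
    cases a with
    | none =>
      obtain _ | ⟨j, m⟩ := m
      · simp at hm
      obtain _ | ⟨j', m'⟩ := m'
      · simp at hm'
      simp only [legs_none, List.length_cons, add_left_inj] at hm hm'
      rw [legs_none, sum_words_succ]
      simp only [wordMat_none, star_mul, h.star_p]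
      have : ∀ i, ∑ l ∈ words ι (legs w), p i j * wordMat p Y w l m *
          (star (wordMat p Y w l m') * p i j') = p i j * (if m = m' then 1 else 0) * p i j' := by
        intro i
        rw [← ih hm hm', Finset.mul_sum, Finset.sum_mul]
        simp only [mul_assoc]
      simp only [this]
      by_cases hm : m = m' <;> by_cases hj : j = j' <;> simp [hm, hj, h.row_mul, h.col_sum]
    | some z =>
      simp only [legs_some, wordMat_some, star_mul] at hm hm' ⊢
      have := congrArg (fun x => Y z * x * star (Y z)) (ih hm hm')
      simp only [Finset.mul_sum, Finset.sum_mul] at this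
      calc _ = _ := by
            refine Eq.trans ?_ this
            simp only [mul_assoc]
        _ = _ := by split_ifs <;> simp [h.Y_mul_star]

variable [Algebra ℂ B] [StarModule ℂ B]

/-- For unitary tests, the adjoint of an intertwiner is an intertwiner. -/
theorem Intertwines.adjoint (hp : IsUnitaryTest p Y) {v w : List (Option Z)}
    {ξ : List ι → List ι → ℂ} (h : Intertwines p Y v w ξ) :
    Intertwines p Y w v fun m l => starRingEnd ℂ (ξ l m) := by
  -- First `ξ * star V = star W * ξ`, from `W * ξ = ξ * V` and unitarity.
  have key : ∀ l m : List ι, l.length = legs w → m.length = legs v →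
      ∑ y ∈ words ι (legs v), ξ l y • star (wordMat p Y v m y) =
        ∑ x ∈ words ι (legs w), ξ x m • star (wordMat p Y w x l) := by
    intro l m hl hm
    have h1 : ∑ x ∈ words ι (legs w), ∑ y ∈ words ι (legs v), star (wordMat p Y w x l) *
        (∑ x' ∈ words ι (legs w), ξ x' y • wordMat p Y w x x') * star (wordMat p Y v m y) =
        ∑ x ∈ words ι (legs w), ∑ y ∈ words ι (legs v), star (wordMat p Y w x l) *
        (∑ y' ∈ words ι (legs v), ξ x y' • wordMat p Y v y' y) * star (wordMat p Y v m y) :=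
      Finset.sum_congr rfl fun x hx => Finset.sum_congr rfl fun y hy => by
        rw [h x y (by simpa using hx) (by simpa using hy)]
    have h2 : ∑ x ∈ words ι (legs w), ∑ y ∈ words ι (legs v), star (wordMat p Y w x l) *
        (∑ x' ∈ words ι (legs w), ξ x' y • wordMat p Y w x x') * star (wordMat p Y v m y) =
        ∑ y ∈ words ι (legs v), ξ l y • star (wordMat p Y v m y) := by
      rw [Finset.sum_comm]
      refine Finset.sum_congr rfl fun y _ => ?_
      rw [← Finset.sum_mul]
      simp only [Finset.mul_sum, mul_smul_comm]
      rw [Finset.sum_comm]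
      rw [Finset.sum_congr rfl fun x' hx' => by
        rw [← Finset.smul_sum, hp.star_mul_wordMat w hl (by simpa using hx')]]
      simp [hl]
    have h3 : ∑ x ∈ words ι (legs w), ∑ y ∈ words ι (legs v), star (wordMat p Y w x l) *
        (∑ y' ∈ words ι (legs v), ξ x y' • wordMat p Y v y' y) * star (wordMat p Y v m y) =
        ∑ x ∈ words ι (legs w), ξ x m • star (wordMat p Y w x l) := by
      refine Finset.sum_congr rfl fun x _ => ?_
      simp only [mul_assoc, ← Finset.mul_sum]
      simp only [Finset.sum_mul, smul_mul_assoc]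
      rw [Finset.sum_comm, Finset.sum_congr rfl fun y' hy' => by
        rw [← Finset.smul_sum, hp.wordMat_mul_star v (by simpa using hy') hm]]
      simp [hm]
    rw [← h2, h1, h3]
  intro m l hm hl
  have := congrArg star (key l m hl hm)
  simp only [star_sum, star_smul, star_star] at this
  exact this

end Unitary

/-! ### Fixed vectors of the quantum permutation group are noncrossing -/

section Haar

variable {ι : Type*} [Fintype ι] [DecidableEq ι]

omit [DecidableEq ι] in
theorem sum_mul_Ins (a b : ℕ) (F t : List ι → ℂ) :
    ∑ x ∈ words ι (a + 1 + b), F x * Ins a t x =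
      ∑ x ∈ words ι a, ∑ y ∈ words ι b, (∑ j, F (x ++ j :: y)) * t (x ++ y) := by
  rw [sum_words_insert]
  refine Finset.sum_congr rfl fun x hx => Finset.sum_congr rfl fun y _ => ?_
  rw [mem_words] at hx
  simp only [Ins_append hx, Finset.sum_mul]

theorem sum_mul_Dup (a b : ℕ) (F t : List ι → ℂ) :
    ∑ x ∈ words ι (a + 1 + b + 1), F x * Dup a t x =
      ∑ x ∈ words ι a, ∑ y ∈ words ι b, ∑ j, F (x ++ j :: j :: y) * t (x ++ j :: y) := by
  refine (sum_words_insert a (b + 1) _).trans (Finset.sum_congr rfl fun x hx => ?_)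
  rw [mem_words] at hx
  rw [sum_words_succ, Finset.sum_comm]
  refine Finset.sum_congr rfl fun y _ => Finset.sum_congr rfl fun j _ => ?_
  rw [Finset.sum_eq_single j]
  · rw [Dup_append hx, if_pos rfl]
  · intro j' _ hj
    rw [Dup_append hx, if_neg hj, mul_zero]
  · simp

variable (ι) in
/-- The kernel of the projection onto the noncrossing vectors of length `k`. -/
def ncKer (k : ℕ) : List ι → List ι → ℂ := (exists_isNCKernel ι k).choose

variable (ι) in
theorem ncKer_spec (k : ℕ) : IsNCKernel ι k (ncKer ι k) := (exists_isNCKernel ι k).choose_spec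

theorem ncKer_symm (k : ℕ) (l m : List ι) : ncKer ι k l m = ncKer ι k m l :=
  (ncKer_spec ι k).symm l m

/-- A noncrossing vector that represents a multiple of the evaluation at `m` is this multiple of
a column of the kernel. -/
theorem eq_smul_ncKer {k : ℕ} {f : List ι → ℂ} (hf : f ∈ NC ι k) {m : List ι} (c : ℂ)
    (hm : m.length = k) (h : ∀ t ∈ NC ι k, ∑ l ∈ words ι k, f l * t l = c * t m) {l : List ι}
    (hl : l.length = k) : f l = c * ncKer ι k l m := by
  have := NC.eq_zero_of_orthogonal
    (sub_mem hf (Submodule.smul_mem _ c ((ncKer_spec ι k).col_mem m))) (fun t ht => ?_) hl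
  · exact sub_eq_zero.1 this
  · simp only [Pi.sub_apply, Pi.smul_apply, smul_eq_mul, sub_mul, Finset.sum_sub_distrib, h t ht,
      mul_assoc, ← Finset.mul_sum]
    rw [(ncKer_spec ι k).repr' ht hm, sub_self]

/-- The relations `u i j * u i j' = δ u i j`, for the Haar functional. -/
theorem ncKer_merge {a b a' b' : List ι} (ha : a.length = a'.length)
    (hb : b.length = b'.length) (i j j' : ι) :
    ncKer ι (a.length + 1 + b.length + 1) (a ++ i :: i :: b) (a' ++ j :: j' :: b') =
      if j = j' then ncKer ι (a.length + 1 + b.length) (a ++ i :: b) (a' ++ j' :: b') else 0 := by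
  let y := a' ++ j :: j' :: b'
  let q := a.length
  let X : List ι → ℂ := fun l => ncKer ι (q + 1 + b.length + 1) (l.take (q + 1) ++ l.drop q) y
  have hX : ∀ l : List ι, ∀ i r, l.length = q → X (l ++ i :: r) =
      ncKer ι (q + 1 + b.length + 1) (l ++ i :: i :: r) y := by
    intro l i r hl
    simp only [X]
    rw [← hl]
    simp [List.take_append, List.take_of_length_le]
  have hXm : X ∈ NC ι (q + 1 + b.length) :=
    NC.merge (by omega) ((ncKer_spec ι (q + 1 + b.length + 1)).col_mem y)
      fun l i r hl hr => hX l i r hl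
  have hXt : ∀ t ∈ NC ι (q + 1 + b.length), ∑ l ∈ words ι (q + 1 + b.length), X l * t l =
      (if j = j' then 1 else 0) * t (a' ++ j' :: b') := by
    intro t ht
    have h1 := (ncKer_spec ι (q + 1 + b.length + 1)).repr' (NC.dup q (by omega) ht)
      (m := y) (by simp [y, q, ha, hb]; omega)
    rw [Dup_append ha.symm t] at h1
    rw [ite_mul, one_mul, zero_mul, ← h1, sum_mul_Dup, sum_words_insert]
    refine Finset.sum_congr rfl fun x hx => Finset.sum_congr rfl fun z _ =>
      Finset.sum_congr rfl fun i _ => ?_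
    rw [hX x i z (by simpa using hx)]
  rw [← hX a i b rfl, eq_smul_ncKer hXm _ (by simp [q, ha, hb]; omega) hXt (by simp [q]; omega)]
  split_ifs <;> simp [q]

/-- The relation `∑ j, u i j = 1`, for the Haar functional. -/
theorem ncKer_sum {a b a' b' : List ι} (ha : a.length = a'.length)
    (hb : b.length = b'.length) (i : ι) :
    ∑ j, ncKer ι (a.length + 1 + b.length) (a ++ i :: b) (a' ++ j :: b') =
      ncKer ι (a.length + b.length) (a ++ b) (a' ++ b') := by
  let q := a.length
  let X : List ι → ℂ := fun l =>
    ∑ j, ncKer ι (q + 1 + b.length) (a ++ i :: b) (l.take q ++ j :: l.drop q)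
  have hX : ∀ l r : List ι, l.length = q → X (l ++ r) =
      ∑ j, ncKer ι (q + 1 + b.length) (a ++ i :: b) (l ++ j :: r) := by
    intro l r hl
    simp only [X]
    rw [← hl]
    simp
  have hXm : X ∈ NC ι (q + b.length) := by
    have := (ncKer_spec ι (q + 1 + b.length)).row_mem (a ++ i :: b)
    rw [add_right_comm] at this
    refine NC.sum (q := q) (by omega) this fun l r hl hr => ?_
    rw [hX l r hl, add_right_comm]
  have hXt : ∀ t ∈ NC ι (q + b.length), ∑ l ∈ words ι (q + b.length), X l * t l =
      1 * t (a ++ b) := by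
    intro t ht
    have h0 := NC.ins q (by omega) ht
    rw [add_right_comm] at h0
    have h1 := (ncKer_spec ι (q + 1 + b.length)).repr _ h0 (a ++ i :: b) (by simp [q]; omega)
    rw [Ins_append rfl, sum_mul_Ins] at h1
    rw [one_mul, ← h1, sum_words_append]
    refine Finset.sum_congr rfl fun x hx => Finset.sum_congr rfl fun z _ => ?_
    rw [hX x z (by simpa using hx)]
  rw [← hX a' b' ha.symm, eq_smul_ncKer hXm _ (by simp [q]) hXt (by simp [q, ha, hb]), one_mul,
    ncKer_symm]

/-- The monomial of a word in the letters of a free algebra. -/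
def monomial {X : Type*} (w : List X) : FreeAlgebra ℂ X := (w.map (FreeAlgebra.ι ℂ)).prod

theorem monomial_append {X : Type*} (w w' : List X) :
    monomial (w ++ w') = monomial w * monomial w' := by simp [monomial]

theorem monomial_cons {X : Type*} (x : X) (w : List X) :
    monomial (x :: w) = FreeAlgebra.ι ℂ x * monomial w := by simp [monomial]

theorem equiv_monomial {X : Type*} (w : List X) :
    FreeAlgebra.equivMonoidAlgebraFreeMonoid (monomial w) =
      MonoidAlgebra.single (FreeMonoid.ofList w) (1 : ℂ) := by
  induction w with
  | nil => simp [monomial]; rfl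
  | cons x w ih =>
    rw [monomial_cons, map_mul, ih]
    have : FreeAlgebra.equivMonoidAlgebraFreeMonoid (FreeAlgebra.ι ℂ x) =
        MonoidAlgebra.single (FreeMonoid.of x) (1 : ℂ) := by
      simp [FreeAlgebra.equivMonoidAlgebraFreeMonoid, MonoidAlgebra.of]
    rw [this, MonoidAlgebra.single_mul_single, one_mul]
    rfl

theorem span_monomial {X : Type*} :
    Submodule.span ℂ (Set.range (monomial : List X → FreeAlgebra ℂ X)) = ⊤ := by
  rw [eq_top_iff]
  rintro x -
  induction x with
  | grade0 c =>
    rw [Algebra.algebraMap_eq_smul_one]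
    exact Submodule.smul_mem _ _ (Submodule.subset_span ⟨[], by simp [monomial]⟩)
  | grade1 x => exact Submodule.subset_span ⟨[x], by simp [monomial]⟩
  | mul a b ha hb =>
    have := Submodule.mul_mem_mul ha hb
    rw [Submodule.span_mul_span] at this
    refine Submodule.span_mono ?_ this
    rintro _ ⟨_, ⟨w, rfl⟩, _, ⟨w', rfl⟩, rfl⟩
    exact ⟨w ++ w', monomial_append w w'⟩
  | add a b ha hb => exact add_mem ha hb

/-- The linear functional on a free algebra with prescribed values on monomials. -/
def monomialFunctional {X : Type*} (F : List X → ℂ) : FreeAlgebra ℂ X →ₗ[ℂ] ℂ :=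
  (Finsupp.linearCombination ℂ fun w : FreeMonoid X => F w.toList) ∘ₗ
    (MonoidAlgebra.coeffLinearEquiv ℂ).toLinearMap ∘ₗ
    (FreeAlgebra.equivMonoidAlgebraFreeMonoid (R := ℂ) (X := X)).toLinearMap

theorem monomialFunctional_monomial {X : Type*} (F : List X → ℂ) (w : List X) :
    monomialFunctional F (monomial w) = F w := by
  simp [monomialFunctional, equiv_monomial]

end Haar

/-- The Haar functional of the quantum permutation group, on the free algebra: its values on the
monomials of degree `k` are the entries of the projection onto the noncrossing vectors. -/
def haar (N : ℕ) : FreeAlgebra ℂ (Fin N × Fin N) →ₗ[ℂ] ℂ :=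
  monomialFunctional fun w => ncKer (Fin N) w.length (w.map Prod.fst) (w.map Prod.snd)

/-- The congruence of elements that `haar` does not distinguish. The magic relations hold modulo
this congruence. -/
def haarCon (N : ℕ) : RingCon (FreeAlgebra ℂ (Fin N × Fin N)) where
  r x y := ∀ a b, haar N (a * x * b) = haar N (a * y * b)
  iseqv := ⟨fun _ _ _ => rfl, fun h a b => (h a b).symm, fun h h' a b => (h a b).trans (h' a b)⟩
  mul' {w x y z} h h' a b := by
    have h1 := h a (y * b)
    have h2 := h' (a * x) b
    simp only [mul_assoc] at h1 h2 ⊢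
    rw [h1, h2]
  add' {w x y z} h h' a b := by
    simp only [mul_add, add_mul, map_add, h a b, h' a b]

theorem haarCon_of_monomial {N : ℕ} {x y : FreeAlgebra ℂ (Fin N × Fin N)}
    (h : ∀ a b, haar N (monomial a * x * monomial b) = haar N (monomial a * y * monomial b)) :
    haarCon N x y := by
  intro a b
  have ha : a ∈ Submodule.span ℂ (Set.range monomial) := span_monomial ▸ Submodule.mem_top
  have hb : b ∈ Submodule.span ℂ (Set.range monomial) := span_monomial ▸ Submodule.mem_top
  induction ha using Submodule.span_induction with
  | zero => simp
  | add a a' _ _ h1 h2 => simp only [add_mul, map_add, h1, h2]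
  | smul c a _ h1 => simp only [smul_mul_assoc, map_smul, h1]
  | mem a ha =>
    obtain ⟨a, rfl⟩ := ha
    induction hb using Submodule.span_induction with
    | zero => simp
    | add b b' _ _ h1 h2 => simp only [mul_add, map_add, h1, h2]
    | smul c b _ h1 => simp only [mul_smul_comm, map_smul, h1]
    | mem b hb =>
      obtain ⟨b, rfl⟩ := hb
      exact h a b

theorem haar_monomial {N : ℕ} (w : List (Fin N × Fin N)) :
    haar N (monomial w) = ncKer (Fin N) w.length (w.map Prod.fst) (w.map Prod.snd) :=
  monomialFunctional_monomial _ w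

theorem haar_mul {N : ℕ} (a b : List (Fin N × Fin N)) (x y : Fin N × Fin N) :
    haar N (monomial a * (FreeAlgebra.ι ℂ x * FreeAlgebra.ι ℂ y) * monomial b) =
      ncKer (Fin N) (a.length + 1 + b.length + 1) (a.map Prod.fst ++ x.1 :: y.1 :: b.map Prod.fst)
        (a.map Prod.snd ++ x.2 :: y.2 :: b.map Prod.snd) := by
  have := haar_monomial (a ++ x :: y :: b)
  rw [monomial_append, monomial_cons, monomial_cons] at this
  simp only [mul_assoc] at this ⊢
  rw [this]
  simp only [List.map_append, List.map_cons, List.length_append, List.length_cons]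
  congr 1; omega

theorem haar_mul_one {N : ℕ} (a b : List (Fin N × Fin N)) (x : Fin N × Fin N) :
    haar N (monomial a * FreeAlgebra.ι ℂ x * monomial b) =
      ncKer (Fin N) (a.length + 1 + b.length) (a.map Prod.fst ++ x.1 :: b.map Prod.fst)
        (a.map Prod.snd ++ x.2 :: b.map Prod.snd) := by
  have := haar_monomial (a ++ x :: b)
  rw [monomial_append, monomial_cons] at this
  simp only [mul_assoc] at this ⊢
  rw [this]
  simp only [List.map_append, List.map_cons, List.length_append, List.length_cons]
  congr 1; omega

theorem haarCon_isMagic (N : ℕ) : IsMagic fun i j : Fin N =>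
    ((FreeAlgebra.ι ℂ (i, j) : FreeAlgebra ℂ (Fin N × Fin N)) : (haarCon N).Quotient) where
  row_mul i j k := by
    have : haarCon N (FreeAlgebra.ι ℂ (i, j) * FreeAlgebra.ι ℂ (i, k))
        (if j = k then FreeAlgebra.ι ℂ (i, j) else 0) := by
      refine haarCon_of_monomial fun a b => ?_
      have h := ncKer_merge (a := a.map Prod.fst) (b := b.map Prod.fst) (a' := a.map Prod.snd)
        (b' := b.map Prod.snd) (by simp) (by simp) i j k
      simp only [List.length_map] at h
      rw [haar_mul, h]
      split_ifs with hjk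
      · subst hjk; rw [haar_mul_one]
      · simp
    rw [← RingCon.coe_mul, (RingCon.eq _).2 this]
    split_ifs <;> rfl
  col_mul i j k := by
    have : haarCon N (FreeAlgebra.ι ℂ (i, k) * FreeAlgebra.ι ℂ (j, k))
        (if i = j then FreeAlgebra.ι ℂ (i, k) else 0) := by
      refine haarCon_of_monomial fun a b => ?_
      have h := ncKer_merge (a := a.map Prod.snd) (b := b.map Prod.snd) (a' := a.map Prod.fst)
        (b' := b.map Prod.fst) (by simp) (by simp) k i j
      simp only [List.length_map] at h
      rw [haar_mul, ncKer_symm, h]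
      split_ifs with hjk
      · subst hjk; rw [haar_mul_one, ncKer_symm]
      · simp
    rw [← RingCon.coe_mul, (RingCon.eq _).2 this]
    split_ifs <;> rfl
  row_sum i := by
    have : haarCon N (∑ j, FreeAlgebra.ι ℂ (i, j)) 1 := by
      refine haarCon_of_monomial fun a b => ?_
      have h := ncKer_sum (a := a.map Prod.fst) (b := b.map Prod.fst) (a' := a.map Prod.snd)
        (b' := b.map Prod.snd) (by simp) (by simp) i
      simp only [List.length_map] at h
      simp only [Finset.mul_sum, Finset.sum_mul, map_sum, haar_mul_one, h]
      rw [mul_one, ← monomial_append, haar_monomial]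
      simp
    have h2 := (RingCon.eq _).2 this
    rw [RingCon.coe_one] at h2
    rw [← h2]
    exact (map_sum (haarCon N).mk' _ _).symm
  col_sum j := by
    have : haarCon N (∑ i, FreeAlgebra.ι ℂ (i, j)) 1 := by
      refine haarCon_of_monomial fun a b => ?_
      have h := ncKer_sum (a := a.map Prod.snd) (b := b.map Prod.snd) (a' := a.map Prod.fst)
        (b' := b.map Prod.fst) (by simp) (by simp) j
      simp only [List.length_map] at h
      simp only [Finset.mul_sum, Finset.sum_mul, map_sum, haar_mul_one, ncKer_symm _ _ (_ ++ j :: _),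
        h]
      rw [mul_one, ← monomial_append, haar_monomial, ncKer_symm]
      simp
    have h2 := (RingCon.eq _).2 this
    rw [RingCon.coe_one] at h2
    rw [← h2]
    exact (map_sum (haarCon N).mk' _ _).symm

theorem wordMat_replicate_mk {N : ℕ} {Z B : Type*} [Ring B] [Algebra ℂ B]
    (φ : FreeAlgebra ℂ (Fin N × Fin N) →ₐ[ℂ] B) (Y : Z → B) {k : ℕ} {l m : List (Fin N)}
    (hl : l.length = k) (hm : m.length = k) :
    wordMat (fun i j => φ (FreeAlgebra.ι ℂ (i, j))) Y (List.replicate k none) l m =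
      φ (monomial (l.zip m)) := by
  induction k generalizing l m with
  | zero =>
    rw [List.length_eq_zero_iff] at hl hm
    simp [hl, hm, monomial]
  | succ k ih =>
    obtain _ | ⟨i, l⟩ := l
    · simp at hl
    obtain _ | ⟨j, m⟩ := m
    · simp at hm
    rw [List.replicate_succ, wordMat_none, ih (by simpa using hl) (by simpa using hm),
      List.zip_cons_cons, monomial_cons, map_mul]

/-- A vector that is fixed by the fundamental corepresentation of the quantum permutation group is
noncrossing. -/
theorem mem_NC_of_isFixed_u {N k : ℕ} {Z : Type*} {Y : Z → Alg N} {f : List (Fin N) → ℂ}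
    (h : IsFixed Alg.u Y (List.replicate k none) f) : f ∈ NC (Fin N) k := by
  let q : FreeAlgebra ℂ (Fin N × Fin N) →ₐ[ℂ] (haarCon N).Quotient :=
    { (haarCon N).mk' with commutes' := fun _ => rfl }
  let ψ : Alg N →ₐ[ℂ] (haarCon N).Quotient := Alg.lift _ (haarCon_isMagic N)
  have h1 : IsFixed (fun i j => q (FreeAlgebra.ι ℂ (i, j))) (fun z => ψ (Y z))
      (List.replicate k none) f := by
    have := Intertwines.map ψ h
    simp only [ψ, Alg.lift_u] at this
    exact this
  rw [isFixed_iff] at h1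
  refine NC.congr ((Submodule.sum_mem _ fun m (_ : m ∈ words (Fin N) k) =>
    Submodule.smul_mem _ (f m) ((ncKer_spec (Fin N) k).col_mem m))) fun l hl => ?_
  have h2 := h1 l (by simpa using hl)
  rw [legs_replicate, Finset.sum_congr rfl fun m hm => by
    rw [wordMat_replicate_mk q _ hl (by simpa using hm), ← map_smul]] at h2
  rw [← map_sum, ← map_one q, ← map_smul] at h2
  have h3 : haarCon N (∑ m ∈ words (Fin N) k, f m • monomial (l.zip m)) (f l • 1) :=
    (RingCon.eq _).1 h2
  have h4 := h3 1 1
  simp only [one_mul, mul_one, map_sum, map_smul, smul_eq_mul] at h4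
  have h5 : haar N 1 = 1 := by
    have := haar_monomial (N := N) []
    rw [show (monomial [] : FreeAlgebra ℂ (Fin N × Fin N)) = 1 by simp [monomial]] at this
    rw [this]
    have h6 := (ncKer_spec (Fin N) 0).repr (fun _ => 1) (NC.of_zero _) [] rfl
    simpa using h6
  rw [h5, mul_one] at h4
  rw [← h4, Finset.sum_apply]
  refine Finset.sum_congr rfl fun m hm => ?_
  rw [mem_words] at hm
  rw [haar_monomial, List.map_fst_zip (by omega), List.map_snd_zip (by omega)]
  simp [hl, hm]


/-! ### Inner faithfulness and fixed vectors of the flat model -/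

section Words

variable {N : ℕ} {Z : Type*} (Y : Z → Alg N)

theorem isUnitaryTest_u : IsUnitaryTest (Alg.u : Fin N → Fin N → Alg N) (Empty.elim : Empty → _)
    where
  toMagic := Alg.isMagic_u.magic
  star_p := Alg.star_u
  Y_mul_star z := z.elim
  star_mul_Y z := z.elim

/-- The matrix coefficients of the `k`-th power of a matrix. -/
abbrev powMat {ι B : Type*} [Semiring B] (p : ι → ι → B) (k : ℕ) : List ι → List ι → B :=
  wordMat p (Empty.elim : Empty → B) (List.replicate k none)

/-- The vector `f` is fixed by the `k`-th power of `p`. -/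
abbrev IsFixedPow {ι B : Type*} [Fintype ι] [Semiring B] [Algebra ℂ B] (p : ι → ι → B) (k : ℕ)
    (f : List ι → ℂ) : Prop :=
  IsFixed p (Empty.elim : Empty → B) (List.replicate k none) f

theorem wordMat_replicate {ι Z B : Type*} [Semiring B] (p : ι → ι → B) (Y : Z → B) (k : ℕ)
    (l m : List ι) : wordMat p Y (List.replicate k none) l m = powMat p k l m := by
  induction k generalizing l m with
  | zero => cases l <;> cases m <;> rfl
  | succ k ih => cases l <;> cases m <;> simp [List.replicate_succ, powMat, wordMat, ih]

theorem isFixed_replicate {ι Z B : Type*} [Fintype ι] [Semiring B] [Algebra ℂ B] {p : ι → ι → B}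
    {Y : Z → B} {k : ℕ} {f : List ι → ℂ} :
    IsFixed p Y (List.replicate k none) f ↔ IsFixedPow p k f := by
  simp only [IsFixedPow, isFixed_iff, legs_replicate, wordMat_replicate]

theorem isFixedPow_iff {ι B : Type*} [Fintype ι] [Semiring B] [Algebra ℂ B] {p : ι → ι → B}
    {k : ℕ} {f : List ι → ℂ} : IsFixedPow p k f ↔ ∀ l : List ι, l.length = k →
      ∑ x ∈ words ι k, f x • powMat p k l x = f l • (1 : B) := by
  simp only [IsFixedPow, isFixed_iff, legs_replicate]

theorem powMat_reverse {ι B : Type*} [Semiring B] [StarRing B] {p : ι → ι → B}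
    (hp : ∀ i j, star (p i j) = p i j) (k : ℕ) {l m : List ι} (hl : l.length = k)
    (hm : m.length = k) : star (powMat p k l m) = powMat p k l.reverse m.reverse := by
  induction k generalizing l m with
  | zero =>
    rw [List.length_eq_zero_iff] at hl hm
    simp [hl, hm, powMat]
  | succ k ih =>
    obtain _ | ⟨i, l⟩ := l
    · simp at hl
    obtain _ | ⟨j, m⟩ := m
    · simp at hm
    have hl' : l.length = k := by simpa using hl
    have hm' : m.length = k := by simpa using hm
    have h1 : powMat p (k + 1) (i :: l) (j :: m) = p i j * powMat p k l m := by
      simp [powMat, List.replicate_succ]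
    have h2 := wordMat_insert p (Empty.elim : Empty → B) (w := List.replicate k none) (w' := [])
      (l := l.reverse) (m := m.reverse) (l' := []) (m' := []) (by simp [hl']) (by simp [hm']) i j
    rw [h1, star_mul, hp, ih hl' hm', List.reverse_cons, List.reverse_cons]
    conv_rhs => rw [powMat, List.replicate_succ', h2, wordMat_nil, mul_one]

theorem antipodeLin_powMat (k : ℕ) {l m : List (Fin N)} (hl : l.length = k) (hm : m.length = k) :
    Alg.antipodeLin N (powMat Alg.u k l m) = star (powMat Alg.u k m l) := by
  induction k generalizing l m with
  | zero =>
    rw [List.length_eq_zero_iff] at hl hm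
    have := Alg.antipodeLin_scalar (N := N) 1
    rw [map_one] at this
    simp [hl, hm, powMat, this]
  | succ k ih =>
    obtain _ | ⟨i, l⟩ := l
    · simp at hl
    obtain _ | ⟨j, m⟩ := m
    · simp at hm
    simp only [powMat, List.replicate_succ, wordMat_none] at ih ⊢
    rw [Alg.antipodeLin_mul, Alg.antipodeLin_u, star_mul, Alg.star_u,
      ih (by simpa using hl) (by simpa using hm)]

theorem comulHom_powMat (k : ℕ) {l m : List (Fin N)} (hl : l.length = k) (hm : m.length = k) :
    Alg.comulHom N (powMat Alg.u k l m) =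
      ∑ x ∈ words (Fin N) k, powMat Alg.u k l x ⊗ₜ[ℂ] powMat Alg.u k x m := by
  induction k generalizing l m with
  | zero =>
    rw [List.length_eq_zero_iff] at hl hm
    simp [hl, hm, powMat]; rfl
  | succ k ih =>
    obtain _ | ⟨i, l⟩ := l
    · simp at hl
    obtain _ | ⟨j, m⟩ := m
    · simp at hm
    have h1 : ∀ i j l m, powMat (B := Alg N) Alg.u (k + 1) (i :: l) (j :: m) =
        Alg.u i j * powMat Alg.u k l m := fun i j l m => by simp [powMat, List.replicate_succ]
    rw [h1, map_mul, Alg.comulHom_u, ih (by simpa using hl) (by simpa using hm), sum_words_succ,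
      Finset.sum_mul_sum]
    simp only [h1, Algebra.TensorProduct.tmul_mul_tmul]

theorem counitHom_powMat (k : ℕ) {l m : List (Fin N)} (hl : l.length = k) (hm : m.length = k) :
    Alg.counitHom N (powMat Alg.u k l m) = if l = m then 1 else 0 := by
  induction k generalizing l m with
  | zero =>
    rw [List.length_eq_zero_iff] at hl hm
    simp [hl, hm, powMat]
  | succ k ih =>
    obtain _ | ⟨i, l⟩ := l
    · simp at hl
    obtain _ | ⟨j, m⟩ := m
    · simp at hm
    simp only [powMat, List.replicate_succ, wordMat_none] at ih ⊢
    rw [map_mul, Alg.counitHom_u, ih (by simpa using hl) (by simpa using hm)]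
    by_cases h : i = j <;> simp [h]

end Words

section HopfIdeal

variable (N : ℕ) (F : ℕ → Set (List (Fin N) → ℂ))

/-- The element of `𝒜(S_N⁺)` that measures the failure of `f` to be fixed, at the index `l`. -/
def defect {N : ℕ} (k : ℕ) (f : List (Fin N) → ℂ) (l : List (Fin N)) : Alg N :=
  ∑ x ∈ words (Fin N) k, f x • powMat Alg.u k l x - f l • 1

/-- The relations that make all the vectors `f ∈ F k` fixed. -/
inductive FixRel : Alg N → Alg N → Prop
  | intro (k : ℕ) (f : List (Fin N) → ℂ) (l : List (Fin N)) (hf : f ∈ F k) (hl : l.length = k) :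
    FixRel (defect k f l) 0

/-- The two-sided ideal generated by the relations `FixRel`. -/
def fixIdeal : Ideal (Alg N) := RingHom.ker (RingQuot.mkRingHom (FixRel N F))

instance : (fixIdeal N F).IsTwoSided := by unfold fixIdeal; infer_instance

variable {N F}

/-- The universal property of the quotient by `fixIdeal`. -/
theorem map_eq_zero_of_mem_fixIdeal {T : Type*} [Ring T] (Φ : Alg N →+* T)
    (h : ∀ k f l, f ∈ F k → l.length = k → Φ (defect k f l) = 0) {x : Alg N}
    (hx : x ∈ fixIdeal N F) : Φ x = 0 := by
  have key : ∀ ⦃x y⦄, FixRel N F x y → Φ x = Φ y := by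
    rintro _ _ ⟨k, f, l, hf, hl⟩
    rw [h k f l hf hl, map_zero]
  have h1 : RingQuot.mkRingHom (FixRel N F) x = 0 := hx
  have h2 := RingQuot.lift_mkRingHom_apply Φ key x
  rw [← h2, h1, map_zero]

theorem defect_mem_fixIdeal {k : ℕ} {f : List (Fin N) → ℂ} {l : List (Fin N)} (hf : f ∈ F k)
    (hl : l.length = k) : defect k f l ∈ fixIdeal N F := by
  have := RingQuot.mkRingHom_rel (FixRel.intro k f l hf hl)
  rw [map_zero] at this
  exact this

/-- If the vectors in `F` are stable under the involution of tensors, the ideal `fixIdeal` is a Hopf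
star-ideal. -/
theorem isHopfStarIdeal_fixIdeal
    (hF : ∀ k, ∀ f ∈ F k, (fun l : List (Fin N) => starRingEnd ℂ (f l.reverse)) ∈ F k) :
    IsHopfStarIdeal (fixIdeal N F) where
  isTwoSided := inferInstance
  star_mem := by
    intro x hx
    let Φ : Alg N →+* (RingQuot (FixRel N F))ᵐᵒᵖ :=
      (RingHom.op (RingQuot.mkRingHom (FixRel N F))).comp (starRingEquiv (R := Alg N) : Alg N →+* _)
    have : Φ x = 0 := by
      refine map_eq_zero_of_mem_fixIdeal Φ (fun k f l hf hl => ?_) hx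
      change MulOpposite.op (RingQuot.mkRingHom (FixRel N F) (star (defect k f l))) = 0
      rw [MulOpposite.op_eq_zero_iff]
      have h1 := defect_mem_fixIdeal (hF k f hf) (l := l.reverse) (by simpa using hl)
      have h2 : star (defect k f l) =
          defect k (fun l => starRingEnd ℂ (f l.reverse)) l.reverse := by
        simp only [defect, star_sub, star_sum, star_smul, star_one, List.reverse_reverse]
        congr 1
        rw [← sum_words_reverse k]
        refine Finset.sum_congr rfl fun m hm => ?_
        rw [powMat_reverse Alg.star_u k hl (by simpa using hm), List.reverse_reverse]
        rfl
      rw [h2]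
      exact h1
    exact MulOpposite.op_eq_zero_iff _ |>.1 this
  isHopfIdeal :=
    { counit_eq_zero := by
        intro x hx
        refine map_eq_zero_of_mem_fixIdeal (Alg.counitHom N : Alg N →+* ℂ)
          (fun k f l hf hl => ?_) hx
        simp only [RingHom.coe_coe, defect, map_sub, map_sum, map_smul, map_one]
        rw [Finset.sum_congr rfl fun x hx => by rw [counitHom_powMat k hl (by simpa using hx)]]
        simp [hl]
      map_mkQ_comul_eq_zero := by
        intro x hx
        refine map_eq_zero_of_mem_fixIdeal ((Algebra.TensorProduct.map
          (Ideal.Quotient.mkₐ ℂ (fixIdeal N F)) (Ideal.Quotient.mkₐ ℂ (fixIdeal N F))).comp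
            (Alg.comulHom N)).toRingHom (fun k f l hf hl => ?_) hx
        have h1 : ∀ l : List (Fin N), l.length = k →
            Ideal.Quotient.mkₐ ℂ (fixIdeal N F) (defect k f l) = 0 := fun l hl =>
          Ideal.Quotient.eq_zero_iff_mem.2 (defect_mem_fixIdeal hf hl)
        have h2 : Alg.comulHom N (defect k f l) =
            ∑ x ∈ words (Fin N) k, powMat Alg.u k l x ⊗ₜ[ℂ] defect k f x +
              defect k f l ⊗ₜ[ℂ] 1 := by
          simp only [defect, map_sub, map_sum, map_smul, map_one, TensorProduct.tmul_sub,
            TensorProduct.sub_tmul, Finset.sum_sub_distrib, TensorProduct.tmul_sum,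
            TensorProduct.sum_tmul, TensorProduct.tmul_smul, TensorProduct.smul_tmul']
          rw [Finset.sum_congr rfl fun x hx => by
            rw [comulHom_powMat k hl (by simpa using hx), Finset.smul_sum], Finset.sum_comm]
          simp only [TensorProduct.smul_tmul', Algebra.TensorProduct.one_def]
          abel
        change Algebra.TensorProduct.map _ _ (Alg.comulHom N (defect k f l)) = 0
        rw [h2, map_add, map_sum]
        simp only [Algebra.TensorProduct.map_tmul, h1 l hl, TensorProduct.zero_tmul, add_zero]
        exact Finset.sum_eq_zero fun x hx => by
          rw [h1 x (by simpa using hx), TensorProduct.tmul_zero]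
      antipode_mem := by
        intro x hx
        let Φ : Alg N →+* (RingQuot (FixRel N F))ᵐᵒᵖ :=
          (RingHom.op (RingQuot.mkRingHom (FixRel N F))).comp
            (Alg.antipodeHom N : Alg N →+* (Alg N)ᵐᵒᵖ)
        have : Φ x = 0 := by
          refine map_eq_zero_of_mem_fixIdeal Φ (fun k f l hf hl => ?_) hx
          change MulOpposite.op
            (RingQuot.mkRingHom (FixRel N F) (Alg.antipodeLin N (defect k f l))) = 0
          rw [MulOpposite.op_eq_zero_iff]
          -- The antipode of the matrix is its inverse, so `S(U) f - f = -S(U) (U f - f)`.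
          have h1 : Alg.antipodeLin N (defect k f l) =
              -∑ x ∈ words (Fin N) k, star (powMat Alg.u k x l) * defect k f x := by
            have hu := isUnitaryTest_u (N := N)
            have e1 : ∀ y ∈ words (Fin N) k, ∑ x ∈ words (Fin N) k,
                star (powMat Alg.u k x l) * powMat Alg.u k x y =
                if l = y then (1 : Alg N) else 0 := by
              intro y hy
              have := hu.star_mul_wordMat (List.replicate k none) (m := l) (m' := y)
                (by simpa using hl) (by simpa using hy)
              rwa [legs_replicate] at this
            have e2 : Alg.antipodeLin N 1 = 1 := by
              have := Alg.antipodeLin_scalar (N := N) 1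
              rwa [map_one] at this
            simp only [defect, mul_sub, map_sub, map_sum, map_smul, e2, Finset.sum_sub_distrib,
              Finset.mul_sum, mul_smul_comm, mul_one]
            rw [Finset.sum_comm, Finset.sum_congr rfl fun y hy => by
              rw [antipodeLin_powMat k hl (by simpa using hy)]]
            simp only [← Finset.smul_sum]
            rw [Finset.sum_congr (g := fun y => f y • if l = y then (1 : Alg N) else 0)
              (f := fun y => f y • ∑ x ∈ words (Fin N) k,
                star (powMat Alg.u k x l) * powMat Alg.u k x y) rfl fun y hy => by rw [e1 y hy]]
            simp [hl]
          rw [h1, map_neg, map_sum, neg_eq_zero]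
          refine Finset.sum_eq_zero fun x hx => ?_
          have : RingQuot.mkRingHom (FixRel N F) (defect k f x) = 0 :=
            defect_mem_fixIdeal hf (by simpa using hx)
          rw [map_mul, this, mul_zero]
        exact MulOpposite.op_eq_zero_iff _ |>.1 this }

end HopfIdeal

/-- A vector is fixed by the universal flat model if it is fixed at all its points. -/
def IsFlatFixed (N k : ℕ) (f : List (Fin N) → ℂ) : Prop :=
  ∀ P : FlatSpace N, IsFixedPow (fun i j => P.1 i j) k f

theorem universalFlatModel_powMat {N k : ℕ} (P : FlatSpace N) (l m : List (Fin N)) :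
    universalFlatModel N (powMat Alg.u k l m) P = powMat (fun i j => P.1 i j) k l m := by
  let φ : Alg N →+* Matrix (Fin N) (Fin N) ℂ :=
    { toFun := fun a => universalFlatModel N a P
      map_zero' := by rw [map_zero]; rfl
      map_one' := by rw [map_one]; rfl
      map_add' := fun a b => by rw [map_add]; rfl
      map_mul' := fun a b => by rw [map_mul]; rfl }
  have h := map_wordMat (B := Alg N) Alg.u (Empty.elim : Empty → _) φ (List.replicate k none) l m
  have h1 : ∀ i j, φ (Alg.u i j) = P.1 i j := fun i j => universalFlatModel_u i j P
  simp only [h1] at h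
  exact h.trans (wordMat_replicate _ _ _ _ _)

theorem universalFlatModel_defect {N k : ℕ} (P : FlatSpace N) (f : List (Fin N) → ℂ)
    (l : List (Fin N)) : universalFlatModel N (defect k f l) P =
      ∑ x ∈ words (Fin N) k, f x • powMat (fun i j => P.1 i j) k l x - f l • 1 := by
  rw [defect, map_sub, map_sum, map_smul, map_one, ContinuousMap.sub_apply,
    ContinuousMap.sum_apply]
  congr 1
  refine Finset.sum_congr rfl fun x _ => ?_
  rw [map_smul, ContinuousMap.smul_apply, universalFlatModel_powMat]

/-- If the universal flat model is inner faithful, its fixed vectors are noncrossing. -/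
theorem mem_NC_of_isFlatFixed {N : ℕ} (h : InnerFaithful (universalFlatModel N)) {k : ℕ}
    {f : List (Fin N) → ℂ} (hf : IsFlatFixed N k f) : f ∈ NC (Fin N) k := by
  have hI := h (fixIdeal N fun k => {f | IsFlatFixed N k f}) (isHopfStarIdeal_fixIdeal ?_) ?_
  · refine mem_NC_of_isFixed_u (Y := (Empty.elim : Empty → _)) ?_
    refine isFixedPow_iff.2 fun l hl => ?_
    have := defect_mem_fixIdeal (F := fun k => {f | IsFlatFixed N k f}) (l := l) hf hl
    rw [hI, Ideal.mem_bot] at this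
    exact sub_eq_zero.1 this
  · intro k f hf P
    refine isFixedPow_iff.2 fun l hl => ?_
    have h1 := congrArg star (isFixedPow_iff.1 (hf P) l.reverse (by simpa using hl))
    simp only [star_sum, star_smul, star_one] at h1
    refine Eq.trans ?_ h1
    rw [← sum_words_reverse k]
    refine Finset.sum_congr rfl fun m hm => ?_
    have h2 := powMat_reverse (p := fun i j => P.1 i j)
      (fun i j => (P.2.1 i j).1.isSelfAdjoint.star_eq) k (l := l.reverse) (m := m)
      (by simpa using hl) (by simpa using hm)
    rw [h2, List.reverse_reverse, List.reverse_reverse]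
    rfl
  · intro x hx
    refine map_eq_zero_of_mem_fixIdeal (universalFlatModel N).toAlgHom.toRingHom
      (fun k f l hf hl => ?_) hx
    ext1 P
    change universalFlatModel N (defect k f l) P = 0
    rw [universalFlatModel_defect, sub_eq_zero]
    exact isFixedPow_iff.1 (hf P) l hl

/-! ### Noncrossing vectors are determined by their values on four letters -/

namespace Diagram

/-- A diagram whose moves refer to existing positions. The other diagrams have vector `0`. -/
def WF : Diagram → Prop
  | nil => True
  | ins p d => p ≤ d.size ∧ d.WF
  | dup p d => p < d.size ∧ d.WF

theorem ev_of_not_WF {ι : Type*} [DecidableEq ι] {d : Diagram} (h : ¬ d.WF) (l : List ι) :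
    d.ev l = 0 := by
  by_cases hl : l.length = d.size
  swap
  · exact d.ev_of_length_ne hl
  induction d generalizing l with
  | nil => exact absurd trivial h
  | ins p d ih =>
    rw [size] at hl
    rw [ev]
    rcases le_or_gt l.length p with h' | h'
    · exact Ins_of_le h' _
    · obtain ⟨a, i, b, rfl, ha⟩ := exists_split h'
      rw [Ins_append ha]
      refine ih (fun hd => h ⟨by omega, hd⟩) _ ?_
      simp at hl ⊢; omega
  | dup p d ih =>
    rw [size] at hl
    rw [ev]
    rcases le_or_gt l.length (p + 1) with h' | h'
    · exact Dup_of_le h' _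
    · obtain ⟨a, i, b, rfl, ha⟩ := exists_split (show p < l.length by omega)
      obtain _ | ⟨j, b⟩ := b
      · simp at h'; omega
      rw [Dup_append ha, ih (fun hd => h ⟨by omega, hd⟩), ite_self]
      simp at hl ⊢; omega

/-- The Dyck word of a diagram: the boundary of the planar picture of its blocks, with two strands
for each point. A singleton at position `p` is a cap at the strand `2 * p`, and the doubling of the
point `p` is a cap at the strand `2 * p + 1`. -/
def code : Diagram → List Bool
  | nil => []
  | ins p d => d.code.take (2 * p) ++ true :: false :: d.code.drop (2 * p)
  | dup p d => d.code.take (2 * p + 1) ++ true :: false :: d.code.drop (2 * p + 1)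

theorem WF.length_code {d : Diagram} (h : d.WF) : d.code.length = 2 * d.size := by
  induction d with
  | nil => rfl
  | ins p d ih => have := ih h.2; have := h.1; simp [code, size]; omega
  | dup p d ih => have := ih h.2; have := h.1; simp [code, size]; omega

/-- The number of singletons inserted in a diagram. -/
def numIns : Diagram → ℕ
  | nil => 0
  | ins _ d => d.numIns + 1
  | dup _ d => d.numIns

end Diagram

section Run

variable {α : Type*} (R : α → α → Prop) [DecidableRel R]

/-- The pushdown automaton of a Dyck word `κ`: it reads a word `s`, pushes a letter on the stack
where `κ` is `true`, and pops a letter where `κ` is `false`, with value `1` if every pair of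
letters matched in this way is related by `R`, and `0` otherwise. -/
def run : List Bool → List α → List α → ℂ
  | [], [], [] => 1
  | true :: κ, b :: s, st => run κ s (b :: st)
  | false :: κ, b :: s, t :: st => if R t b then run κ s st else 0
  | [], [], _ :: _ => 0
  | [], _ :: _, _ => 0
  | true :: _, [], _ => 0
  | false :: _, [], _ => 0
  | false :: _, _ :: _, [] => 0

/-- A cap in a Dyck word only tests the two letters that it joins. -/
theorem run_cap {κ : List Bool} {s : List α} (h : κ.length = s.length) (κ' : List Bool)
    (s' st : List α) (b b' : α) : run R (κ ++ true :: false :: κ') (s ++ b :: b' :: s') st =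
      if R b b' then run R (κ ++ κ') (s ++ s') st else 0 := by
  induction κ generalizing s st with
  | nil =>
    obtain rfl : s = [] := List.length_eq_zero_iff.1 h.symm
    simp [run]
  | cons a κ ih =>
    obtain _ | ⟨c, s⟩ := s
    · simp at h
    cases a with
    | true => simpa [run] using ih (by simpa using h) _
    | false =>
      obtain _ | ⟨t, st⟩ := st
      · simp [run]
      · simp only [List.cons_append, run, ih (s := s) (by simpa using h) st]
        split_ifs <;> rfl

end Run

/-- The vector of a diagram is computed by the automaton of its Dyck word, with both strands of a
point labelled by the letter of that point. -/
theorem Diagram.ev_eq_run {ι : Type*} [DecidableEq ι] {d : Diagram} (h : d.WF) {l : List ι}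
    (hl : l.length = d.size) : d.ev l = run (· = ·) d.code (l.flatMap fun i => [i, i]) [] := by
  have hlen : ∀ a : List ι, (a.flatMap fun i => [i, i]).length = 2 * a.length := by
    intro a; induction a with
    | nil => rfl
    | cons i a ih => simp [ih]; omega
  induction d generalizing l with
  | nil =>
    obtain rfl : l = [] := List.length_eq_zero_iff.1 hl
    simp [ev, run, code]
  | ins p d ih =>
    obtain ⟨a, i, b, rfl, ha⟩ := exists_split (l := l) (p := p) (by
      rw [hl, size]; have := h.1; omega)
    have hd := h.2.length_code
    have hp := h.1
    rw [ev, Ins_append ha, code, List.flatMap_append, List.flatMap_cons]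
    simp only [List.cons_append, List.nil_append]
    rw [run_cap _ (by rw [hlen, List.length_take, hd, ha]; omega), if_pos rfl,
      List.take_append_drop, ih h.2 (by simp [size] at hl ⊢; omega), List.flatMap_append]
  | dup p d ih =>
    have hd := h.2.length_code
    have hp := h.1
    obtain ⟨a, i, b, rfl, ha⟩ := exists_split (l := l) (p := p) (by rw [hl, size]; omega)
    obtain _ | ⟨j, b⟩ := b
    · simp [size] at hl; omega
    rw [ev, Dup_append ha, code, List.flatMap_append, List.flatMap_cons, List.flatMap_cons]
    simp only [List.cons_append, List.nil_append]
    have := run_cap (· = ·) (κ := d.code.take (2 * p + 1))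
      (s := (a.flatMap fun i => [i, i]) ++ [i]) (by
        rw [List.length_append, hlen, List.length_take, hd, ha]; simp; omega)
      (d.code.drop (2 * p + 1)) (j :: b.flatMap fun i => [i, i]) [] i j
    simp only [List.append_assoc, List.cons_append, List.nil_append] at this
    rw [this, List.take_append_drop]
    split_ifs with hij
    · subst hij
      rw [ih h.2 (by simp [size] at hl ⊢; omega), List.flatMap_append, List.flatMap_cons]
      rfl
    · rfl

section Twist

/-- The parity that a list of pairs of strands contributes to the points on its left. -/
def parity : List (Bool × Bool) → Bool
  | [] => false
  | (r, c) :: s => xor (xor r !c) (parity s)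

/-- A twisted Fourier transform from functions on words in four letters to functions on words of
pairs of strands. It is the passage from the algebra `ℂ⁴`, i.e. the group algebra of the Klein
four-group, to its twisted group algebra `M₂(ℂ)`, evaluated at matrix units. Under it, a diagram
becomes a noncrossing pairing of strands with two colours. -/
def twist : (List (Bool × Bool) → ℂ) → List (Bool × Bool) → ℂ
  | f, [] => f []
  | f, (r, c) :: s => ∑ x : Bool, (if (xor r !c) && x then -1 else 1) *
      twist (fun l => f ((x, xor (!c) (parity s)) :: l)) s

theorem twist_sum {κ : Type*} (S : Finset κ) (c : κ → ℂ) (f : κ → List (Bool × Bool) → ℂ)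
    (s : List (Bool × Bool)) :
    twist (fun l => ∑ i ∈ S, c i * f i l) s = ∑ i ∈ S, c i * twist (f i) s := by
  induction s generalizing f with
  | nil => simp [twist]
  | cons a s ih =>
    simp only [twist, ih fun i l => f i (_ :: l)]
    simp only [Finset.mul_sum]
    rw [Finset.sum_comm]
    refine Finset.sum_congr rfl fun i _ => Finset.sum_congr rfl fun x _ => ?_
    ring

theorem twist_congr {f g : List (Bool × Bool) → ℂ} {s : List (Bool × Bool)}
    (h : ∀ l, l.length = s.length → f l = g l) : twist f s = twist g s := by
  induction s generalizing f g with
  | nil => exact h [] rfl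
  | cons a s ih =>
    simp only [twist]
    refine Finset.sum_congr rfl fun x _ => ?_
    rw [ih fun l hl => h _ (by simpa using hl)]

theorem twist_zero (s : List (Bool × Bool)) : twist (fun _ => 0) s = 0 := by
  have := twist_sum (∅ : Finset ℕ) (fun _ => 0) (fun _ _ => 0) s
  simpa using this

theorem twist_Ins {p : ℕ} {a : List (Bool × Bool)} (ha : a.length = p)
    (f : List (Bool × Bool) → ℂ) (r c : Bool) (b : List (Bool × Bool)) :
    twist (Ins p f) (a ++ (r, c) :: b) = if r ≠ c then 2 * twist f (a ++ b) else 0 := by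
  induction a generalizing f p with
  | nil =>
    subst ha
    have : ∀ h : Bool × Bool, (fun l => Ins 0 f (h :: l)) = f := fun h =>
      funext fun l => Ins_append (a := []) rfl f h l
    simp only [List.length_nil, List.nil_append, twist, this, Fintype.sum_bool]
    cases r <;> cases c <;> simp <;> ring
  | cons x a ih =>
    obtain ⟨r', c'⟩ := x
    subst ha
    have h1 : ∀ h : Bool × Bool, (fun l => Ins (a.length + 1) f (h :: l)) =
        Ins a.length fun l => f (h :: l) := by
      intro h
      funext l
      simp [Ins]
    have h2 : r ≠ c → parity (a ++ (r, c) :: b) = parity (a ++ b) := by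
      intro hrc
      clear ih h1
      induction a with
      | nil => cases r <;> cases c <;> simp_all [parity]
      | cons y a ih => obtain ⟨y, z⟩ := y; simp [parity, ih]
    simp only [List.length_cons, List.cons_append, twist, h1, ih rfl]
    split_ifs with h
    · rw [h2 h, Finset.mul_sum]
      exact Finset.sum_congr rfl fun _ _ => by ring
    · simp

theorem twist_Dup {p : ℕ} {a : List (Bool × Bool)} (ha : a.length = p)
    (f : List (Bool × Bool) → ℂ) (r c r' c' : Bool) (b : List (Bool × Bool)) :
    twist (Dup p f) (a ++ (r, c) :: (r', c') :: b) =
      if c ≠ r' then twist f (a ++ (r, c') :: b) else 0 := by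
  induction a generalizing f p with
  | nil =>
    subst ha
    have : ∀ h h' : Bool × Bool, (fun l => Dup 0 f (h :: h' :: l)) =
        if h = h' then (fun l => f (h' :: l)) else fun _ => 0 := by
      intro h h'
      funext l
      have := Dup_append (a := []) rfl f h h' l
      simp only [List.nil_append, List.length_nil] at this
      rw [this]
      split_ifs <;> rfl
    simp only [List.length_nil, List.nil_append, twist, this, Fintype.sum_bool, parity]
    cases r <;> cases c <;> cases r' <;> cases c' <;> cases parity b <;> simp [twist_zero]
  | cons x a ih =>
    obtain ⟨r1, c1⟩ := x
    subst ha
    have h1 : ∀ h : Bool × Bool, (fun l => Dup (a.length + 1) f (h :: l)) =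
        Dup a.length fun l => f (h :: l) := by
      intro h
      funext l
      simp [Dup]
    have h2 : c ≠ r' → parity (a ++ (r, c) :: (r', c') :: b) = parity (a ++ (r, c') :: b) := by
      intro hrc
      clear ih h1
      induction a with
      | nil => cases r <;> cases c <;> cases r' <;> cases c' <;> simp_all [parity]
      | cons y a ih => obtain ⟨y, z⟩ := y; simp [parity, ih]
    simp only [List.length_cons, List.cons_append, twist, h1, ih rfl]
    split_ifs with h
    · rw [h2 h]
    · simp

theorem length_flatMap_pair (a : List (Bool × Bool)) :
    (a.flatMap fun x => [x.1, x.2]).length = 2 * a.length := by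
  induction a with
  | nil => rfl
  | cons i a ih => simp [ih]; omega

theorem Diagram.twist_ev {d : Diagram} (h : d.WF) {s : List (Bool × Bool)}
    (hs : s.length = d.size) :
    twist d.ev s = 2 ^ d.numIns * run (· ≠ ·) d.code (s.flatMap fun x => [x.1, x.2]) [] := by
  induction d generalizing s with
  | nil =>
    obtain rfl : s = [] := List.length_eq_zero_iff.1 hs
    simp [twist, ev, run, code, numIns]
  | ins p d ih =>
    obtain ⟨a, ⟨r, c⟩, b, rfl, ha⟩ := exists_split (l := s) (p := p) (by
      rw [hs, size]; have := h.1; omega)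
    have hd := h.2.length_code
    have hp := h.1
    rw [ev, twist_Ins ha, code, List.flatMap_append, List.flatMap_cons]
    simp only [List.cons_append, List.nil_append]
    rw [run_cap _ (by rw [length_flatMap_pair, List.length_take, hd, ha]; omega),
      List.take_append_drop, ih h.2 (by simp [size] at hs ⊢; omega), List.flatMap_append, numIns]
    split_ifs <;> ring
  | dup p d ih =>
    have hd := h.2.length_code
    have hp := h.1
    obtain ⟨a, ⟨r, c⟩, b, rfl, ha⟩ := exists_split (l := s) (p := p) (by rw [hs, size]; omega)
    obtain _ | ⟨⟨r', c'⟩, b⟩ := b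
    · simp [size] at hs; omega
    rw [ev, twist_Dup ha, code, List.flatMap_append, List.flatMap_cons, List.flatMap_cons]
    simp only [List.cons_append, List.nil_append]
    have := run_cap (· ≠ ·) (κ := d.code.take (2 * p + 1))
      (s := (a.flatMap fun x => [x.1, x.2]) ++ [r]) (by
        rw [List.length_append, length_flatMap_pair, List.length_take, hd, ha]; simp; omega)
      (d.code.drop (2 * p + 1)) (c' :: b.flatMap fun x => [x.1, x.2]) [] c r'
    simp only [List.append_assoc, List.cons_append, List.nil_append] at this
    rw [this, List.take_append_drop, numIns]
    split_ifs with hij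
    · rw [ih h.2 (by simp [size] at hs ⊢; omega), List.flatMap_append, List.flatMap_cons]
      rfl
    · simp

end Twist

section Triangular

/-- The step `± 1` of a lattice path. -/
def step (b : Bool) : ℤ := if b then 1 else -1

/-- The area under a lattice path that starts at height `h`. -/
def area : List Bool → ℤ → ℤ
  | [], _ => 0
  | b :: κ, h => h + step b + area κ (h + step b)

/-- The height of the path of letters that are still on the stack. -/
def stackHeight (st : List Bool) : ℤ := (st.map step).sum

theorem stackHeight_le (st : List Bool) : stackHeight st ≤ st.length := by
  induction st with
  | nil => simp [stackHeight]
  | cons b st ih => cases b <;> simp [stackHeight, step] at ih ⊢ <;> omega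

/-- If the automaton of `κ` accepts `s`, the path of `s` is below the path of `κ`, so that the
matrix of the values of the automata is triangular. -/
theorem area_le_of_run_ne_zero {κ s st : List Bool} (h : run (· ≠ ·) κ s st ≠ 0) :
    area s (stackHeight st) ≤ area κ st.length ∧
      (stackHeight st = st.length → area s (stackHeight st) = area κ st.length → s = κ) := by
  induction κ generalizing s st with
  | nil =>
    obtain _ | ⟨b, s⟩ := s
    · simp [area]
    · simp [run] at h
  | cons a κ ih =>
    obtain _ | ⟨b, s⟩ := s
    · cases a <;> simp [run] at h
    cases a with
    | true =>
      rw [run] at h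
      obtain ⟨h1, h2⟩ := ih h
      have e1 : stackHeight (b :: st) = stackHeight st + step b := by simp [stackHeight, add_comm]
      have e2 : ((b :: st).length : ℤ) = st.length + step true := by simp [step]
      have h3 := stackHeight_le (b :: st)
      rw [e1, e2] at h1 h2 h3
      simp only [area]
      refine ⟨by omega, fun h4 h5 => ?_⟩
      have h6 : stackHeight st + step b = st.length + step true := by omega
      have h7 := h2 h6 (by omega)
      have h8 : b = true := by cases b <;> simp [step] at h6 ⊢; omega
      rw [h7, h8]
    | false =>
      obtain _ | ⟨t, st⟩ := st
      · simp [run] at h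
      rw [run] at h
      split_ifs at h with htb
      · obtain ⟨h1, h2⟩ := ih h
        have e1 : stackHeight (t :: st) + step b = stackHeight st := by
          cases t <;> cases b <;> simp_all [stackHeight, step]
        have e2 : ((t :: st).length : ℤ) + step false = st.length := by simp [step]
        have h3 := stackHeight_le st
        simp only [area]
        rw [e1, e2]
        refine ⟨by omega, fun h4 h5 => ?_⟩
        have h6 : stackHeight st = st.length := by omega
        have h7 := h2 h6 (by omega)
        have h8 : t = true := by
          cases t
          · simp [stackHeight, step] at h4 h6; omega
          · rfl
        have h9 : b = false := by cases b <;> simp_all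
        rw [h7, h9]
      · exact absurd rfl h

/-- A Dyck word, as far as the automaton is concerned: it never pops the empty stack, and ends with
the empty stack. -/
theorem run_self {d : Diagram} (h : d.WF) : run (· ≠ ·) d.code d.code [] = 1 := by
  induction d with
  | nil => simp [Diagram.code, run]
  | ins p d ih =>
    rw [Diagram.code, run_cap _ rfl, if_pos (by simp), List.take_append_drop, ih h.2]
  | dup p d ih =>
    rw [Diagram.code, run_cap _ rfl, if_pos (by simp), List.take_append_drop, ih h.2]

end Triangular

theorem exists_pairs (k : ℕ) (κ : List Bool) (h : κ.length = 2 * k) :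
    ∃ s : List (Bool × Bool), s.length = k ∧ (s.flatMap fun x => [x.1, x.2]) = κ := by
  induction k generalizing κ with
  | zero => exact ⟨[], rfl, (List.length_eq_zero_iff.1 h).symm⟩
  | succ k ih =>
    obtain _ | ⟨a, _ | ⟨b, κ⟩⟩ := κ
    · simp at h
    · simp at h; omega
    · obtain ⟨s, hs, hs'⟩ := ih κ (by simp at h; omega)
      exact ⟨(a, b) :: s, by simp [hs], by simp [hs']⟩

/-- A noncrossing vector is a combination of diagrams with distinct Dyck words. -/
theorem exists_combination_of_mem_NC {ι : Type*} [DecidableEq ι] {k : ℕ} {f : List ι → ℂ}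
    (hf : f ∈ NC ι k) : ∃ (c : List Bool →₀ ℂ) (δ : List Bool → Diagram),
      (∀ κ ∈ c.support, (δ κ).WF ∧ (δ κ).size = k ∧ (δ κ).code = κ) ∧
      ∀ l : List ι, l.length = k → f l = ∑ κ ∈ c.support, c κ * (δ κ).ev l := by
  classical
  let good : Diagram → Prop := fun d => d.WF ∧ d.size = k
  let δ : List Bool → Diagram := fun κ =>
    if h : ∃ d, good d ∧ d.code = κ then h.choose else .nil
  have hδ : ∀ d, good d → good (δ d.code) ∧ (δ d.code).code = d.code := by
    intro d hd
    have h : ∃ d', good d' ∧ d'.code = d.code := ⟨d, hd, rfl⟩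
    simp only [δ, dif_pos h]
    exact h.choose_spec
  suffices H : ∃ c : List Bool →₀ ℂ, (∀ κ ∈ c.support, ∃ d, good d ∧ d.code = κ) ∧
      ∀ l : List ι, l.length = k → f l = c.sum fun κ z => z * (δ κ).ev l by
    obtain ⟨c, hc, hfc⟩ := H
    refine ⟨c, δ, fun κ hκ => ?_, hfc⟩
    obtain ⟨d, hd, rfl⟩ := hc κ hκ
    exact ⟨(hδ d hd).1.1, (hδ d hd).1.2, (hδ d hd).2⟩
  induction hf using NC.induction with
  | diagram d hd =>
    by_cases hw : d.WF
    · refine ⟨Finsupp.single d.code 1, fun κ hκ => ⟨d, ⟨hw, hd⟩, ?_⟩, fun l hl => ?_⟩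
      · have := Finsupp.support_single_subset hκ
        exact (Finset.mem_singleton.1 this).symm
      · rw [Finsupp.sum_single_index (by simp), one_mul]
        obtain ⟨h1, h2⟩ := hδ d ⟨hw, hd⟩
        rw [Diagram.ev_eq_run hw (hl.trans hd.symm), Diagram.ev_eq_run h1.1 (hl.trans h1.2.symm),
          h2]
    · exact ⟨0, by simp, fun l _ => by simp [d.ev_of_not_WF hw]⟩
  | zero => exact ⟨0, by simp, fun l _ => by simp⟩
  | add f g _ _ hf hg =>
    obtain ⟨c, hc, hfc⟩ := hf
    obtain ⟨c', hc', hfc'⟩ := hg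
    refine ⟨c + c', fun κ hκ => ?_, fun l hl => ?_⟩
    · rcases Finset.mem_union.1 (Finsupp.support_add hκ) with h | h
      · exact hc κ h
      · exact hc' κ h
    · rw [Finsupp.sum_add_index' (by simp) (by intros; ring), Pi.add_apply, hfc l hl, hfc' l hl]
  | smul z f _ hf =>
    obtain ⟨c, hc, hfc⟩ := hf
    refine ⟨z • c, fun κ hκ => hc κ (Finsupp.support_smul hκ), fun l hl => ?_⟩
    rw [Finsupp.sum_smul_index (by simp), Pi.smul_apply, hfc l hl, smul_eq_mul, Finsupp.mul_sum]
    exact Finsupp.sum_congr fun _ _ => by ring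
  | congr f g _ h hf =>
    obtain ⟨c, hc, hfc⟩ := hf
    exact ⟨c, hc, fun l hl => (h l hl).trans (hfc l hl)⟩

/-- A noncrossing vector that vanishes on the words in four letters vanishes. -/
theorem NC.eq_zero_of_four_letters {ι : Type*} [DecidableEq ι] {k : ℕ} {f : List ι → ℂ}
    (hf : f ∈ NC ι k) {e : Bool × Bool → ι} (he : Function.Injective e)
    (h : ∀ l : List (Bool × Bool), l.length = k → f (l.map e) = 0) {l : List ι}
    (hl : l.length = k) : f l = 0 := by
  obtain ⟨c, δ, hδ, hfc⟩ := exists_combination_of_mem_NC hf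
  have h1 : ∀ s : List (Bool × Bool), s.length = k →
      ∑ κ ∈ c.support, c κ * (2 ^ (δ κ).numIns *
        run (· ≠ ·) κ (s.flatMap fun x => [x.1, x.2]) []) = 0 := by
    intro s hs
    have h2 := twist_sum c.support c (fun κ => (δ κ).ev) s
    rw [twist_congr (g := fun _ => 0), twist_zero] at h2
    · rw [h2]
      refine Finset.sum_congr rfl fun κ hκ => ?_
      obtain ⟨hw, hsz, hcode⟩ := hδ κ hκ
      rw [Diagram.twist_ev hw (hs.trans hsz.symm), hcode]
    · intro l hl
      have := hfc (l.map e) (by simp [hl, hs])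
      rw [h l (hl.trans hs)] at this
      rw [this]
      exact Finset.sum_congr rfl fun κ _ => by rw [Diagram.ev_map e he]
  have h2 : c.support = ∅ := by
    by_contra hne
    -- A Dyck word of maximal area cannot be accepted by the automaton of another one.
    obtain ⟨κ, hκ, hmax⟩ := Finset.exists_max_image c.support (fun κ => area κ 0)
      (Finset.nonempty_iff_ne_empty.2 hne)
    obtain ⟨hw, hsz, hcode⟩ := hδ κ hκ
    obtain ⟨s, hs, hs'⟩ := exists_pairs k κ (by rw [← hcode, hw.length_code, hsz])
    have h3 := h1 s hs
    rw [hs', Finset.sum_eq_single κ] at h3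
    · have h4 := run_self hw
      rw [hcode] at h4
      rw [h4, mul_one] at h3
      exact Finsupp.mem_support_iff.1 hκ
        ((mul_eq_zero.1 h3).resolve_right (pow_ne_zero _ two_ne_zero))
    · intro κ' hκ' hne'
      by_contra hrun
      have h5 : run (· ≠ ·) κ' κ [] ≠ 0 := fun h => hrun (by rw [h]; ring)
      obtain ⟨h6, h7⟩ := area_le_of_run_ne_zero h5
      exact hne' (h7 rfl (le_antisymm h6 (hmax κ' hκ'))).symm
    · intro h; exact absurd hκ h
  rw [hfc l hl, h2, Finset.sum_empty]

/-! ### Primitive vectors -/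

section Primitive

variable {ι : Type*} [Fintype ι]

/-- A vector of length `a` is primitive if all its leg sums and all its merges of adjacent legs
vanish. -/
structure IsPrimitive (a : ℕ) (f : List ι → ℂ) : Prop where
  sum_eq_zero : ∀ l r : List ι, l.length + r.length + 1 = a → ∑ j, f (l ++ j :: r) = 0
  merge_eq_zero : ∀ (l : List ι) (j : ι) (r : List ι), l.length + r.length + 2 = a →
    f (l ++ j :: j :: r) = 0

theorem IsPrimitive.append_right {a b : ℕ} {f : List ι → ℂ} (h : IsPrimitive (a + b) f)
    {z : List ι} (hz : z.length = b) : IsPrimitive a fun x => f (x ++ z) where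
  sum_eq_zero l r hl := by
    have := h.sum_eq_zero l (r ++ z) (by simp; omega)
    simpa using this
  merge_eq_zero l j r hl := by
    have := h.merge_eq_zero l j (r ++ z) (by simp; omega)
    simpa using this

theorem IsPrimitive.append_left {a b : ℕ} {f : List ι → ℂ} (h : IsPrimitive (a + b) f)
    {x : List ι} (hx : x.length = a) : IsPrimitive b fun z => f (x ++ z) where
  sum_eq_zero l r hl := by
    have := h.sum_eq_zero (x ++ l) r (by simp; omega)
    simpa using this
  merge_eq_zero l j r hl := by
    have := h.merge_eq_zero (x ++ l) j r (by simp; omega)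
    simpa using this

theorem IsPrimitive.reverse {a : ℕ} {f : List ι → ℂ} (h : IsPrimitive a f) :
    IsPrimitive a fun x => f x.reverse where
  sum_eq_zero l r hl := by
    have := h.sum_eq_zero r.reverse l.reverse (by simp; omega)
    simpa using this
  merge_eq_zero l j r hl := by
    have := h.merge_eq_zero r.reverse j l.reverse (by simp; omega)
    simpa using this

theorem IsPrimitive.congr {a : ℕ} {f g : List ι → ℂ} (h : IsPrimitive a f)
    (e : ∀ x : List ι, x.length = a → g x = f x) : IsPrimitive a g where
  sum_eq_zero l r hl := by
    rw [← h.sum_eq_zero l r hl]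
    exact Finset.sum_congr rfl fun j _ => e _ (by simp; omega)
  merge_eq_zero l j r hl := by rw [e _ (by simp; omega), h.merge_eq_zero l j r hl]

theorem IsPrimitive.linear {a : ℕ} {κ : Type*} (S : Finset κ) (c : κ → ℂ)
    {f : κ → List ι → ℂ} (h : ∀ i ∈ S, IsPrimitive a (f i)) :
    IsPrimitive a fun x => ∑ i ∈ S, c i * f i x where
  sum_eq_zero l r hl := by
    rw [Finset.sum_comm]
    exact Finset.sum_eq_zero fun i hi => by
      rw [← Finset.mul_sum, (h i hi).sum_eq_zero l r hl, mul_zero]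
  merge_eq_zero l j r hl := Finset.sum_eq_zero fun i hi => by
    rw [(h i hi).merge_eq_zero l j r hl, mul_zero]

theorem IsPrimitive.conj {a : ℕ} {f : List ι → ℂ} (h : IsPrimitive a f) :
    IsPrimitive a fun x => starRingEnd ℂ (f x) where
  sum_eq_zero l r hl := by rw [← map_sum, h.sum_eq_zero l r hl, map_zero]
  merge_eq_zero l j r hl := by rw [h.merge_eq_zero l j r hl, map_zero]

theorem IsPrimitive.sum_Ins {a : ℕ} {f : List ι → ℂ} (h : IsPrimitive a f) (p : ℕ)
    (t : List ι → ℂ) : ∑ x ∈ words ι a, f x * Ins p t x = 0 := by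
  rcases lt_or_ge p a with hp | hp
  · obtain ⟨b, rfl⟩ := Nat.exists_eq_add_of_lt hp
    rw [add_right_comm, sum_mul_Ins]
    refine Finset.sum_eq_zero fun x hx => Finset.sum_eq_zero fun y hy => ?_
    rw [mem_words] at hx hy
    rw [h.sum_eq_zero x y (by omega), zero_mul]
  · exact Finset.sum_eq_zero fun x hx => by
      rw [Ins_of_le (by rw [mem_words] at hx; omega), mul_zero]

variable [DecidableEq ι]

theorem IsPrimitive.sum_Dup {a : ℕ} {f : List ι → ℂ} (h : IsPrimitive a f) (p : ℕ)
    (t : List ι → ℂ) : ∑ x ∈ words ι a, f x * Dup p t x = 0 := by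
  rcases lt_or_ge (p + 1) a with hp | hp
  · obtain ⟨b, rfl⟩ := Nat.exists_eq_add_of_lt hp
    rw [sum_mul_Dup]
    refine Finset.sum_eq_zero fun x hx => Finset.sum_eq_zero fun y hy =>
      Finset.sum_eq_zero fun j _ => ?_
    rw [mem_words] at hx hy
    rw [h.merge_eq_zero x j y (by omega), zero_mul]
  · exact Finset.sum_eq_zero fun x hx => by
      rw [Dup_of_le (by rw [mem_words] at hx; omega), mul_zero]

end Primitive

section Split

variable {ι : Type*}

theorem Ins_append_left {p : ℕ} {x : List ι} (h : p < x.length) (t : List ι → ℂ) (y : List ι) :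
    Ins p t (x ++ y) = Ins p (fun z => t (z ++ y)) x := by
  obtain ⟨a, i, b, rfl, ha⟩ := exists_split h
  rw [Ins_append ha, List.append_assoc, List.cons_append, Ins_append ha, List.append_assoc]

theorem Ins_append_right {p : ℕ} (x : List ι) (t : List ι → ℂ) (y : List ι) :
    Ins (x.length + p) t (x ++ y) = Ins p (fun z => t (x ++ z)) y := by
  rcases lt_or_ge p y.length with h | h
  · obtain ⟨a, i, b, rfl, ha⟩ := exists_split h
    rw [Ins_append ha, ← List.append_assoc, Ins_append (by simp [ha]), List.append_assoc]
  · rw [Ins_of_le h, Ins_of_le (by simp; omega)]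

variable [DecidableEq ι]

theorem Dup_append_left {p : ℕ} {x : List ι} (h : p + 1 < x.length) (t : List ι → ℂ)
    (y : List ι) : Dup p t (x ++ y) = Dup p (fun z => t (z ++ y)) x := by
  obtain ⟨a, i, b, rfl, ha⟩ := exists_split (show p < x.length by omega)
  obtain _ | ⟨j, b⟩ := b
  · simp at h; omega
  simp only [Dup_append ha, List.append_assoc, List.cons_append]

theorem Dup_append_right {p : ℕ} (x : List ι) (t : List ι → ℂ) (y : List ι) :
    Dup (x.length + p) t (x ++ y) = Dup p (fun z => t (x ++ z)) y := by
  rcases lt_or_ge (p + 1) y.length with h | h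
  · obtain ⟨a, i, b, rfl, ha⟩ := exists_split (show p < y.length by omega)
    obtain _ | ⟨j, b⟩ := b
    · simp at h; omega
    rw [Dup_append ha, ← List.append_assoc, Dup_append (by simp [ha]), List.append_assoc]
  · rw [Dup_of_le h, Dup_of_le (by simp; omega)]

end Split

section Schur

variable {ι : Type*} [Fintype ι] [DecidableEq ι]

/-- Between primitive vectors, a diagram on `2 * a` points acts as a scalar: only the rainbow
diagram contributes. The second part concerns diagrams with a marked middle point. -/
theorem Diagram.exists_scalar (d : Diagram) :
    (∀ a, ∃ c : ℂ, ∀ f g : List ι → ℂ, IsPrimitive a f → IsPrimitive a g →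
      ∑ x ∈ words ι a, ∑ y ∈ words ι a, f x * (g y * d.ev (x ++ y)) =
        c * ∑ y ∈ words ι a, f y.reverse * g y) ∧
    (∀ a, ∃ c : ℂ, ∀ f g : List ι → ℂ, IsPrimitive (a + 1) f → IsPrimitive (a + 1) g →
      ∑ j, ∑ x ∈ words ι a, ∑ y ∈ words ι a, f (x ++ [j]) * (g (j :: y) * d.ev (x ++ j :: y)) =
        c * ∑ y ∈ words ι (a + 1), f y.reverse * g y) := by
  have sub : ∀ {a : ℕ} {f : List ι → ℂ}, IsPrimitive (a + 1) f → ∀ j,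
      IsPrimitive a (fun x => f (x ++ [j])) ∧ IsPrimitive a (fun x => f (j :: x)) := by
    intro a f hf j
    refine ⟨hf.append_right (z := [j]) rfl, ?_⟩
    rw [add_comm] at hf
    exact hf.append_left (x := [j]) rfl
  induction d with
  | nil =>
    constructor
    · intro a
      obtain _ | a := a
      · exact ⟨1, fun f g _ _ => by simp [ev]⟩
      · refine ⟨0, fun f g _ _ => ?_⟩
        rw [zero_mul]
        refine Finset.sum_eq_zero fun x hx => Finset.sum_eq_zero fun y _ => ?_
        rw [mem_words] at hx
        rw [ev_of_length_ne _ (by simp only [size, List.length_append]; omega), mul_zero, mul_zero]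
    · exact fun a => ⟨0, fun f g _ _ => by simp [ev]⟩
  | ins p d ih =>
    constructor
    · refine fun a => ⟨0, fun f g hf hg => ?_⟩
      rw [zero_mul]
      rcases lt_or_ge p a with hp | hp
      · rw [Finset.sum_comm]
        refine Finset.sum_eq_zero fun y _ => ?_
        have := hf.sum_Ins p fun z => g y * d.ev (z ++ y)
        refine (Finset.sum_congr rfl fun x hx => ?_).trans this
        rw [ev, Ins_append_left (by rw [mem_words] at hx; omega)]
        simp only [Ins, LinearMap.coe_mk, AddHom.coe_mk]
        split_ifs <;> simp
      · obtain ⟨q, rfl⟩ := Nat.exists_eq_add_of_le hp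
        refine Finset.sum_eq_zero fun x hx => ?_
        rw [mem_words] at hx
        subst hx
        simp only [ev, Ins_append_right]
        rw [← Finset.mul_sum, hg.sum_Ins, mul_zero]
    · intro a
      rcases lt_trichotomy p a with hp | rfl | hp
      · refine ⟨0, fun f g hf hg => ?_⟩
        rw [zero_mul]
        refine Finset.sum_eq_zero fun j _ => ?_
        rw [Finset.sum_comm]
        refine Finset.sum_eq_zero fun y _ => ?_
        have := (sub hf j).1.sum_Ins p fun z => g (j :: y) * d.ev (z ++ j :: y)
        refine (Finset.sum_congr rfl fun x hx => ?_).trans this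
        rw [ev, Ins_append_left (by rw [mem_words] at hx; omega)]
        simp only [Ins, LinearMap.coe_mk, AddHom.coe_mk]
        split_ifs <;> simp
      · obtain ⟨c, hc⟩ := ih.1 p
        refine ⟨c, fun f g hf hg => ?_⟩
        rw [sum_words_succ, Finset.mul_sum]
        refine Finset.sum_congr rfl fun j _ => ?_
        have := hc _ _ (sub hf j).1 (sub hg j).2
        simp only [List.reverse_cons]
        rw [← this]
        refine Finset.sum_congr rfl fun x hx => ?_
        rw [mem_words] at hx
        simp only [ev, Ins_append hx]
      · obtain ⟨q, rfl⟩ := Nat.exists_eq_add_of_lt hp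
        refine ⟨0, fun f g hf hg => ?_⟩
        rw [zero_mul]
        refine Finset.sum_eq_zero fun j _ => Finset.sum_eq_zero fun x hx => ?_
        rw [mem_words] at hx
        have e : ∀ y, Ins (a + q + 1) d.ev (x ++ j :: y) =
            Ins q (fun z => d.ev (x ++ j :: z)) y := by
          intro y
          have := Ins_append_right (p := q) (x ++ [j]) d.ev y
          simp only [List.length_append, hx, List.length_singleton, List.append_assoc,
            List.singleton_append] at this
          rw [← this, add_right_comm]
        simp only [ev, e]
        rw [← Finset.mul_sum, (sub hg j).2.sum_Ins, mul_zero]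
  | dup p d ih =>
    constructor
    · intro a
      rcases lt_trichotomy (p + 1) a with hp | rfl | hp
      · refine ⟨0, fun f g hf hg => ?_⟩
        rw [zero_mul, Finset.sum_comm]
        refine Finset.sum_eq_zero fun y _ => ?_
        have := hf.sum_Dup p fun z => g y * d.ev (z ++ y)
        refine (Finset.sum_congr rfl fun x hx => ?_).trans this
        rw [ev, Dup_append_left (by rw [mem_words] at hx; omega)]
        simp only [Dup, LinearMap.coe_mk, AddHom.coe_mk]
        split_ifs <;> simp
      · obtain ⟨c, hc⟩ := ih.2 p
        refine ⟨c, fun f g hf hg => ?_⟩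
        rw [← hc f g hf hg, sum_words_append]
        conv_rhs => rw [Finset.sum_comm]
        refine Finset.sum_congr rfl fun x hx => ?_
        rw [mem_words] at hx
        rw [sum_words_one]
        refine Finset.sum_congr rfl fun i _ => ?_
        rw [sum_words_succ, Finset.sum_eq_single i]
        · refine Finset.sum_congr rfl fun y _ => ?_
          rw [ev, List.append_assoc, List.singleton_append, Dup_append hx, if_pos rfl]
        · intro j _ hj
          refine Finset.sum_eq_zero fun y _ => ?_
          rw [ev, List.append_assoc, List.singleton_append, Dup_append hx, if_neg hj.symm,
            mul_zero, mul_zero]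
        · simp
      · obtain ⟨q, rfl⟩ := Nat.exists_eq_add_of_le (Nat.lt_succ_iff.1 hp)
        refine ⟨0, fun f g hf hg => ?_⟩
        rw [zero_mul]
        refine Finset.sum_eq_zero fun x hx => ?_
        rw [mem_words] at hx
        subst hx
        simp only [ev, Dup_append_right]
        rw [← Finset.mul_sum, hg.sum_Dup, mul_zero]
    · refine fun a => ⟨0, fun f g hf hg => ?_⟩
      rw [zero_mul]
      refine Finset.sum_eq_zero fun j _ => ?_
      rcases lt_trichotomy (p + 1) a with hp | rfl | hp
      · rw [Finset.sum_comm]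
        refine Finset.sum_eq_zero fun y _ => ?_
        have := (sub hf j).1.sum_Dup p fun z => g (j :: y) * d.ev (z ++ j :: y)
        refine (Finset.sum_congr rfl fun x hx => ?_).trans this
        rw [ev, Dup_append_left (by rw [mem_words] at hx; omega)]
        simp only [Dup, LinearMap.coe_mk, AddHom.coe_mk]
        split_ifs <;> simp
      · refine Finset.sum_eq_zero fun x hx => Finset.sum_eq_zero fun y _ => ?_
        rw [mem_words] at hx
        obtain ⟨x, i, x', rfl, hx'⟩ := exists_split (show p < x.length by omega)
        obtain rfl : x' = [] := List.length_eq_zero_iff.1 (by simp at hx; omega)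
        simp only [List.append_assoc, List.cons_append, List.nil_append, ev, Dup_append hx']
        split_ifs with hij
        · subst hij
          rw [hf.merge_eq_zero x i [] (by simp; omega), zero_mul]
        · simp
      · rcases eq_or_lt_of_le (Nat.lt_succ_iff.1 hp) with rfl | hp
        · refine Finset.sum_eq_zero fun x hx => Finset.sum_eq_zero fun y hy => ?_
          rw [mem_words] at hx hy
          obtain _ | ⟨i, y⟩ := y
          · rw [ev, Dup_of_le (by simp; omega), mul_zero, mul_zero]
          · rw [ev, Dup_append hx]
            split_ifs with hij
            · subst hij
              have := hg.merge_eq_zero [] j y (by simp at hy ⊢; omega)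
              rw [List.nil_append] at this
              rw [this]; simp
            · simp
        · obtain ⟨q, rfl⟩ := Nat.exists_eq_add_of_lt hp
          refine Finset.sum_eq_zero fun x hx => ?_
          rw [mem_words] at hx
          have e : ∀ y, Dup (a + q + 1) d.ev (x ++ j :: y) =
              Dup q (fun z => d.ev (x ++ j :: z)) y := by
            intro y
            have := Dup_append_right (p := q) (x ++ [j]) d.ev y
            simp only [List.length_append, hx, List.length_singleton, List.append_assoc,
              List.singleton_append] at this
            rw [← this, add_right_comm]
          simp only [ev, e]
          rw [← Finset.mul_sum, (sub hg j).2.sum_Dup, mul_zero]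

/-- Schur's lemma for words without letters: noncrossing endomorphisms act as scalars on primitive
vectors. -/
theorem exists_scalar_of_mem_NC {a : ℕ} {t : List ι → ℂ} (ht : t ∈ NC ι (a + a)) :
    ∃ c : ℂ, ∀ f g : List ι → ℂ, IsPrimitive a f → IsPrimitive a g →
      ∑ x ∈ words ι a, ∑ y ∈ words ι a, f x * (g y * t (x.reverse ++ y)) =
        c * ∑ y ∈ words ι a, f y * g y := by
  suffices H : ∃ c : ℂ, ∀ f g : List ι → ℂ, IsPrimitive a f → IsPrimitive a g →
      ∑ x ∈ words ι a, ∑ y ∈ words ι a, f x * (g y * t (x ++ y)) =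
        c * ∑ y ∈ words ι a, f y.reverse * g y by
    obtain ⟨c, hc⟩ := H
    refine ⟨c, fun f g hf hg => ?_⟩
    have := hc _ g hf.reverse hg
    rw [← sum_words_reverse] at this
    simpa using this
  induction ht using NC.induction with
  | diagram d _ => exact d.exists_scalar.1 a
  | zero => exact ⟨0, fun f g _ _ => by simp⟩
  | add s t _ _ hs ht =>
    obtain ⟨c, hc⟩ := hs
    obtain ⟨c', hc'⟩ := ht
    refine ⟨c + c', fun f g hf hg => ?_⟩
    rw [add_mul, ← hc f g hf hg, ← hc' f g hf hg]
    simp only [Pi.add_apply, mul_add, Finset.sum_add_distrib]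
  | smul z t _ ht =>
    obtain ⟨c, hc⟩ := ht
    refine ⟨z * c, fun f g hf hg => ?_⟩
    rw [mul_assoc, ← hc f g hf hg]
    simp only [Pi.smul_apply, smul_eq_mul, Finset.mul_sum]
    exact Finset.sum_congr rfl fun _ _ => Finset.sum_congr rfl fun _ _ => by ring
  | congr s t _ h hs =>
    obtain ⟨c, hc⟩ := hs
    refine ⟨c, fun f g hf hg => ?_⟩
    rw [← hc f g hf hg]
    refine Finset.sum_congr rfl fun x hx => Finset.sum_congr rfl fun y hy => ?_
    rw [mem_words] at hx hy
    rw [h _ (by simp; omega)]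

end Schur

section BlockPrimitive

variable {ι : Type*} [Fintype ι]

/-- A vector whose legs are grouped in blocks of lengths `as` is primitive if it is primitive in
the legs of each block. -/
def IsBlockPrimitive : List ℕ → (List ι → ℂ) → Prop
  | [], _ => True
  | a :: as, f => (∀ r : List ι, r.length = as.sum → IsPrimitive a fun x => f (x ++ r)) ∧
      ∀ x : List ι, x.length = a → IsBlockPrimitive as fun r => f (x ++ r)

theorem IsBlockPrimitive.congr {as : List ℕ} {f g : List ι → ℂ} (h : IsBlockPrimitive as f)
    (e : ∀ l : List ι, l.length = as.sum → g l = f l) : IsBlockPrimitive as g := by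
  induction as generalizing f g with
  | nil => trivial
  | cons a as ih =>
    rw [List.sum_cons] at e
    exact ⟨fun r hr => (h.1 r hr).congr fun x hx => e _ (by simp; omega),
      fun x hx => ih (h.2 x hx) fun r hr => e _ (by simp; omega)⟩

theorem IsBlockPrimitive.linear {as : List ℕ} {κ : Type*} (S : Finset κ) (c : κ → ℂ)
    {f : κ → List ι → ℂ} (h : ∀ i ∈ S, IsBlockPrimitive as (f i)) :
    IsBlockPrimitive as fun x => ∑ i ∈ S, c i * f i x := by
  induction as generalizing f with
  | nil => trivial
  | cons a as ih =>
    exact ⟨fun r hr => IsPrimitive.linear S c fun i hi => (h i hi).1 r hr,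
      fun x hx => ih fun i hi => (h i hi).2 x hx⟩

theorem IsBlockPrimitive.conj {as : List ℕ} {f : List ι → ℂ} (h : IsBlockPrimitive as f) :
    IsBlockPrimitive as fun x => starRingEnd ℂ (f x) := by
  induction as generalizing f with
  | nil => trivial
  | cons a as ih => exact ⟨fun r hr => (h.1 r hr).conj, fun x hx => ih (h.2 x hx)⟩

theorem IsBlockPrimitive.sub {as : List ℕ} {f g : List ι → ℂ} (hf : IsBlockPrimitive as f)
    (hg : IsBlockPrimitive as g) (c : ℂ) : IsBlockPrimitive as fun x => f x - c * g x := by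
  have := IsBlockPrimitive.linear (as := as) (Finset.univ : Finset Bool)
    (fun b => cond b 1 (-c)) (f := fun b => cond b f g) (by rintro (_ | _) _ <;> assumption)
  refine this.congr fun l _ => ?_
  simp [sub_eq_add_neg]

theorem IsBlockPrimitive.snoc {as : List ℕ} {d : ℕ} {f : List ι → ℂ}
    (h : IsBlockPrimitive (as ++ [d]) f) {z : List ι} (hz : z.length = d) :
    IsBlockPrimitive as fun x => f (x ++ z) := by
  induction as generalizing f with
  | nil => trivial
  | cons a as ih =>
    refine ⟨fun r hr => ?_, fun x hx => ?_⟩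
    · have := h.1 (r ++ z) (by simp [hr, hz])
      simpa using this
    · have := ih (h.2 x hx)
      simpa using this

end BlockPrimitive

/-! ### Test points of the flat model -/

section Tests

variable {M : ℕ}

/-- The unitary matrix with spectral projections `U e_k U⋆` for the eigenvalues `ζ ^ k`. -/
def letterMat (U : Matrix.unitaryGroup (Fin M) ℂ) (ζ : Circle) : Matrix (Fin M) (Fin M) ℂ :=
  U.1 * Matrix.diagonal (fun i : Fin M => (ζ : ℂ) ^ (i : ℕ)) * star U.1

theorem letterMat_mul (U : Matrix.unitaryGroup (Fin M) ℂ) (ζ ζ' : Circle) :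
    letterMat U ζ * letterMat U ζ' = letterMat U (ζ * ζ') := by
  have h : star U.1 * U.1 = 1 := Unitary.coe_star_mul_self U
  simp only [letterMat]
  calc _ = U.1 * Matrix.diagonal (fun i : Fin M => (ζ : ℂ) ^ (i : ℕ)) * (star U.1 * U.1) *
        (Matrix.diagonal (fun i : Fin M => (ζ' : ℂ) ^ (i : ℕ)) * star U.1) := by noncomm_ring
    _ = _ := by
      rw [h, mul_one, ← mul_assoc, mul_assoc U.1, Matrix.diagonal_mul_diagonal]
      simp [mul_pow]

theorem letterMat_one (U : Matrix.unitaryGroup (Fin M) ℂ) : letterMat U 1 = 1 := by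
  have h : U.1 * star U.1 = 1 := Unitary.coe_mul_star_self U
  simp [letterMat, h]

theorem star_letterMat (U : Matrix.unitaryGroup (Fin M) ℂ) (ζ : Circle) :
    star (letterMat U ζ) = letterMat U ζ⁻¹ := by
  simp only [letterMat, star_mul, star_star, mul_assoc]
  congr 2
  rw [Matrix.star_eq_conjTranspose, Matrix.diagonal_conjTranspose]
  congr 1
  funext i
  rw [Circle.coe_inv_eq_conj]
  simp

theorem FlatSpace.magic (P : FlatSpace M) : Magic fun i j => P.1 i j where
  row_mul i j k := congrArg (fun f => f P) (FlatSpace.isMagic_entry.row_mul i j k) |>.trans (by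
    split_ifs <;> rfl)
  col_mul i j k := congrArg (fun f => f P) (FlatSpace.isMagic_entry.col_mul i j k) |>.trans (by
    split_ifs <;> rfl)
  row_sum := P.2.2.1
  col_sum := P.2.2.2

theorem isUnitaryTest (P : FlatSpace M) (U : Matrix.unitaryGroup (Fin M) ℂ) :
    IsUnitaryTest (fun i j => P.1 i j) (letterMat U) where
  toMagic := P.magic
  star_p i j := (P.2.1 i j).1.isSelfAdjoint
  Y_mul_star ζ := by rw [star_letterMat, letterMat_mul, mul_inv_cancel, letterMat_one]
  star_mul_Y ζ := by rw [star_letterMat, letterMat_mul, inv_mul_cancel, letterMat_one]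

variable (M) in
/-- A matrix of scalars that intertwines two words for all points of the flat model and all unitary
matrices with prescribed spectrum. -/
def ModelHom (v w : List (Option Circle)) (ξ : List (Fin M) → List (Fin M) → ℂ) : Prop :=
  ∀ (P : FlatSpace M) (U : Matrix.unitaryGroup (Fin M) ℂ),
    Intertwines (fun i j => P.1 i j) (letterMat U) v w ξ

/-- The point of the flat model defined by a Latin square, with entries the coordinate
projections. -/
def latinPoint (c : Fin M → Fin M → Fin M) (hr : ∀ i, Function.Bijective (c i))
    (hc : ∀ j, Function.Bijective fun i => c i j) : FlatSpace M :=
  ⟨Matrix.of fun i j => Matrix.diagonal (Pi.single (c i j) 1), by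
    have hsum : ∑ k : Fin M, Matrix.diagonal (Pi.single k (1 : ℂ)) = 1 := by
      ext a b
      rw [Matrix.sum_apply]
      by_cases hab : a = b
      · subst hab; simp [Pi.single_apply]
      · simp [hab]
    refine ⟨fun i j => ⟨⟨?_, ?_⟩, ?_⟩, fun i => ?_, fun j => ?_⟩
    · rw [Matrix.of_apply, IsIdempotentElem, Matrix.diagonal_mul_diagonal]
      congr 1; funext k; by_cases h : k = c i j <;> simp [h]
    · rw [Matrix.of_apply, IsSelfAdjoint, Matrix.star_eq_conjTranspose,
        Matrix.diagonal_conjTranspose]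
      congr 1; funext k; by_cases h : k = c i j <;> simp [h]
    · rw [Matrix.of_apply, Matrix.rank_diagonal]
      simp [Pi.single_apply]
    · exact ((hr i).sum_comp fun k => Matrix.diagonal (Pi.single k (1 : ℂ))).trans hsum
    · exact ((hc j).sum_comp fun k => Matrix.diagonal (Pi.single k (1 : ℂ))).trans hsum⟩

theorem latinPoint_apply (c : Fin M → Fin M → Fin M) (hr hc) (i j : Fin M) :
    (latinPoint c hr hc).1 i j = Matrix.diagonal (Pi.single (c i j) 1) := rfl

/-- At the point of a Latin square, the legs act on tensors by diagonal matrices of values of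
the tensor. -/
theorem sum_wordMat_latinPoint {Z : Type*} (Y : Z → Matrix (Fin M) (Fin M) ℂ)
    {c d : Fin M → Fin M → Fin M} (hr hc) (hd : ∀ i j k, c i j = k ↔ j = d i k)
    (f : List (Fin M) → ℂ) (l : List (Fin M)) :
    ∑ x ∈ words (Fin M) l.length, f x •
      wordMat (fun i j => (latinPoint c hr hc).1 i j) Y (List.replicate l.length none) l x =
      Matrix.diagonal fun k => f (l.map fun i => d i k) := by
  induction l generalizing f with
  | nil =>
    ext a b
    by_cases hab : a = b <;> simp [hab]
  | cons i l ih =>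
    have ih' := fun j => ih fun x => f (j :: x)
    simp only [List.length_cons, sum_words_succ, List.replicate_succ, wordMat_none]
    simp only [← mul_smul_comm, ← Finset.mul_sum, ih']
    simp only [latinPoint_apply, Matrix.diagonal_mul_diagonal]
    ext a b
    rw [Matrix.sum_apply]
    by_cases hab : a = b
    · subst hab
      simp only [Matrix.diagonal_apply_eq, List.map_cons]
      rw [Finset.sum_eq_single (d i a)]
      · rw [(hd i (d i a) a).2 rfl, Pi.single_eq_same, one_mul]
      · intro j _ hj
        rw [Pi.single_eq_of_ne, zero_mul]
        exact fun h => hj ((hd i j a).1 h.symm)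
      · simp
    · simp [hab]

end Tests

/-! ### Degeneration of the scalar letters -/

section Degeneration

variable {M : ℕ}

/-- The number of scalar letters of a word. -/
def numLetters {Z : Type*} : List (Option Z) → ℕ
  | [] => 0
  | none :: w => numLetters w
  | some _ :: w => numLetters w + 1

@[simp] theorem numLetters_append {Z : Type*} (w w' : List (Option Z)) :
    numLetters (w ++ w') = numLetters w + numLetters w' := by
  induction w with
  | nil => simp [numLetters]
  | cons a w ih => cases a <;> simp [numLetters, ih]; omega

@[simp] theorem numLetters_replicate {Z : Type*} (k : ℕ) :
    numLetters (List.replicate k (none : Option Z)) = 0 := by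
  induction k with
  | zero => rfl
  | succ k ih => simp [List.replicate_succ, numLetters, ih]

theorem wordMat_smul {ι Z B : Type*} [Semiring B] [Algebra ℂ B] (p : ι → ι → B) (Y : Z → B)
    (t : ℂ) (w : List (Option Z)) (l m : List ι) :
    wordMat p (fun z => t • Y z) w l m = t ^ numLetters w • wordMat p Y w l m := by
  induction w generalizing l m with
  | nil => cases l <;> cases m <;> simp [wordMat, numLetters]
  | cons a w ih =>
    cases a with
    | none => cases l <;> cases m <;> simp [wordMat, numLetters, ih]
    | some z => simp [numLetters, ih, smul_smul, pow_succ, mul_comm]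

open Polynomial in
/-- The entries of the matrix `A` of polynomials have degree at most `n`, and `T` is the matrix of
the coefficients of degree `n`. -/
def HasTop (n : ℕ) (A : Matrix (Fin M) (Fin M) ℂ[X]) (T : Matrix (Fin M) (Fin M) ℂ) : Prop :=
  ∀ i j, (A i j).natDegree ≤ n ∧ (A i j).coeff n = T i j

open Polynomial in
theorem HasTop.mul {m n : ℕ} {A B : Matrix (Fin M) (Fin M) ℂ[X]}
    {S T : Matrix (Fin M) (Fin M) ℂ} (hA : HasTop m A S) (hB : HasTop n B T) :
    HasTop (m + n) (A * B) (S * T) := by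
  intro i j
  rw [Matrix.mul_apply, Matrix.mul_apply, finsetSum_coeff]
  refine ⟨natDegree_sum_le_of_forall_le _ _ fun k _ =>
    natDegree_mul_le_of_le (hA i k).1 (hB k j).1, Finset.sum_congr rfl fun k _ => ?_⟩
  rw [coeff_mul_add_eq_of_natDegree_le (hA i k).1 (hB k j).1, (hA i k).2, (hB k j).2]

open Polynomial in
theorem HasTop.sum_smul {κ : Type*} {n : ℕ} (S : Finset κ) (c : κ → ℂ)
    {A : κ → Matrix (Fin M) (Fin M) ℂ[X]} {T : κ → Matrix (Fin M) (Fin M) ℂ}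
    (h : ∀ x ∈ S, HasTop n (A x) (T x)) :
    HasTop n (∑ x ∈ S, c x • A x) (∑ x ∈ S, c x • T x) := by
  intro i j
  simp only [Matrix.sum_apply, Matrix.smul_apply, finsetSum_coeff, coeff_smul]
  exact ⟨natDegree_sum_le_of_forall_le _ _ fun x hx =>
    (natDegree_smul_le _ _).trans (h x hx i j).1,
    Finset.sum_congr rfl fun x hx => by rw [(h x hx i j).2]⟩

open Polynomial in
theorem hasTop_C (A : Matrix (Fin M) (Fin M) ℂ) : HasTop 0 (A.map C) A := by
  intro i j
  simp

/-- The unitary matrix `1 - p + t p`, for a projection `p` and a complex number `t` of modulus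
one. -/
def rotation {p : Matrix (Fin M) (Fin M) ℂ} (hp : IsStarProjection p) (t : Circle) :
    Matrix.unitaryGroup (Fin M) ℂ :=
  ⟨1 - p + (t : ℂ) • p, by
    have h1 : p * p = p := hp.isIdempotentElem
    have h2 : star p = p := hp.isSelfAdjoint
    have h3 : (t : ℂ) * starRingEnd ℂ t = 1 := by
      rw [Complex.mul_conj, Circle.normSq_coe]; simp
    rw [Matrix.mem_unitaryGroup_iff, star_add, star_sub, star_one, star_smul, h2]
    simp only [add_mul, mul_add, sub_mul, mul_sub, smul_mul_assoc, mul_smul_comm, h1, one_mul,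
      mul_one]
    have h4 : (starRingEnd ℂ) (t : ℂ) • (t : ℂ) • p = p := by
      rw [smul_smul, mul_comm, h3, one_smul]
    simp [h4]⟩

open Polynomial in
/-- Scalar letters may be replaced by the leading terms `p Z (1 - p)` of their conjugates by
`1 - p + t p`. -/
theorem Intertwines.degenerate {p : Matrix (Fin M) (Fin M) ℂ} (hp : IsStarProjection p)
    {P : Fin M → Fin M → Matrix (Fin M) (Fin M) ℂ} {v w : List (Option Circle)}
    {ξ : List (Fin M) → List (Fin M) → ℂ} (hvw : numLetters v = numLetters w)
    (h : ∀ U, Intertwines P (letterMat U) v w ξ) :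
    Intertwines P (fun ζ : Circle =>
      p * Matrix.diagonal (fun i : Fin M => (ζ : ℂ) ^ (i : ℕ)) * (1 - p)) v w ξ := by
  let Z : Circle → Matrix (Fin M) (Fin M) ℂ := fun ζ =>
    Matrix.diagonal (fun i : Fin M => (ζ : ℂ) ^ (i : ℕ))
  let c0 : Circle → Matrix (Fin M) (Fin M) ℂ := fun ζ => (1 - p) * Z ζ * p
  let c1 : Circle → Matrix (Fin M) (Fin M) ℂ := fun ζ => (1 - p) * Z ζ * (1 - p) + p * Z ζ * p
  let c2 : Circle → Matrix (Fin M) (Fin M) ℂ := fun ζ => p * Z ζ * (1 - p)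
  let Y' : Circle → Matrix (Fin M) (Fin M) ℂ[X] := fun ζ =>
    Matrix.of fun i j => C (c0 ζ i j) + C (c1 ζ i j) * X + C (c2 ζ i j) * X ^ 2
  let P' : Fin M → Fin M → Matrix (Fin M) (Fin M) ℂ[X] := fun i j => (P i j).map C
  have hY' : ∀ ζ, HasTop 2 (Y' ζ) (c2 ζ) := by
    intro ζ i j
    simp only [Y', Matrix.of_apply]
    refine ⟨by compute_degree, ?_⟩
    simp
  have htop : ∀ (w : List (Option Circle)) (l m : List (Fin M)),
      HasTop (2 * numLetters w) (wordMat P' Y' w l m) (wordMat P c2 w l m) := by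
    intro w
    have hz : ∀ n, HasTop n (0 : Matrix (Fin M) (Fin M) ℂ[X]) 0 := fun n i j => by simp
    induction w with
    | nil =>
      intro l m
      cases l <;> cases m <;> first | exact hz _ | skip
      have := hasTop_C (1 : Matrix (Fin M) (Fin M) ℂ)
      rw [Matrix.map_one _ (map_zero C) (map_one C)] at this
      exact this
    | cons a w ih =>
      intro l m
      cases a with
      | none =>
        obtain _ | ⟨i, l⟩ := l <;> obtain _ | ⟨j, m⟩ := m <;> first | exact hz _ | skip
        rw [wordMat_none, wordMat_none, numLetters]
        have := (hasTop_C (P i j)).mul (ih l m)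
        rwa [zero_add] at this
      | some z =>
        rw [wordMat_some, wordMat_some, numLetters, mul_add, mul_one, add_comm]
        exact (hY' z).mul (ih l m)
  have heval : ∀ (t : Circle) (w : List (Option Circle)) (l m : List (Fin M)),
      (wordMat P' Y' w l m).map (eval (t : ℂ)) =
        (t : ℂ) ^ numLetters w • wordMat P (letterMat (rotation hp t)) w l m := by
    intro t w l m
    have h1 := map_wordMat P' Y' ((evalRingHom (t : ℂ)).mapMatrix) w l m
    have h2 : (fun i j => (evalRingHom (t : ℂ)).mapMatrix (P' i j)) = P := by
      funext i j
      ext a b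
      simp [P']
    have h3 : (fun ζ => (evalRingHom (t : ℂ)).mapMatrix (Y' ζ)) =
        fun ζ => (t : ℂ) • letterMat (rotation hp t) ζ := by
      funext ζ
      have e1 : star p = p := hp.isSelfAdjoint
      have e2 : (t : ℂ) * starRingEnd ℂ t = 1 := by
        rw [Complex.mul_conj, Circle.normSq_coe]; simp
      have e3 : (t : ℂ) • letterMat (rotation hp t) ζ =
          c0 ζ + (t : ℂ) • c1 ζ + (t : ℂ) ^ 2 • c2 ζ := by
        have e4 : (t : ℂ) • star (rotation hp t).1 = (t : ℂ) • (1 - p) + p := by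
          simp only [rotation, star_add, star_sub, star_one, star_smul, e1, smul_add, smul_smul]
          simp [e2]
        rw [letterMat, ← mul_smul_comm, e4]
        simp only [rotation, c0, c1, c2, Z, add_mul, mul_add, smul_mul_assoc, mul_smul_comm,
          smul_add, smul_smul, pow_two]
        abel
      rw [e3]
      ext i j
      simp [Y']
      ring
    rw [h2, h3, wordMat_smul] at h1
    exact h1
  intro l m hl hm
  -- The relation holds for polynomials in `t`, since it holds at the points `t` of the circle.
  have h1 : ∑ x ∈ words (Fin M) (legs w), ξ x m • wordMat P' Y' w l x =
      ∑ y ∈ words (Fin M) (legs v), ξ l y • wordMat P' Y' v y m := by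
    ext1 i j
    have hinf : Set.Infinite (Set.range fun t : Circle => (t : ℂ)) := by
      have h0 : (Set.Ioo (0 : ℝ) 1).Infinite := Set.Ioo_infinite one_pos
      refine (h0.image (f := fun x => ((Circle.exp x : Circle) : ℂ)) fun x hx y hy hxy => ?_).mono
        (by rintro _ ⟨x, -, rfl⟩; exact ⟨_, rfl⟩)
      have h1 := congrArg Complex.arg hxy
      have := Real.pi_gt_three
      simp only at h1
      rwa [Circle.arg_exp (by linarith [hx.1]) (by linarith [hx.2]),
        Circle.arg_exp (by linarith [hy.1]) (by linarith [hy.2])] at h1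
    refine eq_of_infinite_eval_eq _ _ (hinf.mono ?_)
    rintro _ ⟨t, rfl⟩
    have h2 := h (rotation hp t) l m hl hm
    have h3 := congrArg (fun A => ((t : ℂ) ^ numLetters w • A) i j) h2
    simp only [Finset.smul_sum, smul_comm _ (ξ _ _)] at h3
    have e1 := fun x => heval t w l x
    have e2 := fun y => heval t v y m
    rw [hvw] at e2
    simp only [← e1, ← e2, Matrix.sum_apply, Matrix.smul_apply, Matrix.map_apply] at h3
    simp only [Set.mem_ofPred_eq, Matrix.sum_apply, Matrix.smul_apply, eval_finsetSum, eval_smul]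
    exact h3
  have h2 := HasTop.sum_smul (words (Fin M) (legs w)) (fun x => ξ x m) fun x _ => htop w l x
  have h3 := HasTop.sum_smul (words (Fin M) (legs v)) (fun y => ξ l y) fun y _ => htop v y m
  rw [hvw, ← h1] at h3
  ext1 i j
  exact ((h2 i j).2.symm.trans (h3 i j).2 :)

end Degeneration

/-! ### Explicit primitive vectors -/

section Alternating

variable {m : ℕ}

/-- The differences `e₀ - e₁` and `e₂ - e₃` of unit vectors. They have disjoint supports. -/
def diffVec (b : Bool) (i : Fin (m + 5)) : ℂ :=
  if b then (if i = 2 then 1 else 0) - (if i = 3 then 1 else 0)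
  else (if i = 0 then 1 else 0) - (if i = 1 then 1 else 0)

/-- The product of alternating differences, such as `(e₀ - e₁) ⊗ (e₂ - e₃) ⊗ (e₀ - e₁) ⊗ ⋯`. -/
def altVec : Bool → List (Fin (m + 5)) → ℂ
  | _, [] => 1
  | b, i :: l => diffVec b i * altVec (!b) l

theorem sum_diffVec (b : Bool) : ∑ i : Fin (m + 5), diffVec b i = 0 := by
  cases b <;> simp [diffVec]

theorem fin_ofNat_ne {a b : ℕ} (ha : a < 5) (hb : b < 5) (h : a ≠ b) :
    (Fin.ofNat (m + 5) a) ≠ Fin.ofNat (m + 5) b := by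
  rw [Ne, Fin.ext_iff, Fin.val_ofNat, Fin.val_ofNat, Nat.mod_eq_of_lt (by omega),
    Nat.mod_eq_of_lt (by omega)]
  exact h

theorem diffVec_mul_not (b : Bool) (i : Fin (m + 5)) : diffVec b i * diffVec (!b) i = 0 := by
  have h1 : (0 : Fin (m + 5)) ≠ 2 := fin_ofNat_ne (by decide) (by decide) (by decide)
  have h2 : (0 : Fin (m + 5)) ≠ 3 := fin_ofNat_ne (by decide) (by decide) (by decide)
  have h3 : (1 : Fin (m + 5)) ≠ 2 := fin_ofNat_ne (by decide) (by decide) (by decide)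
  have h4 : (1 : Fin (m + 5)) ≠ 3 := fin_ofNat_ne (by decide) (by decide) (by decide)
  by_cases e0 : i = 0
  · subst e0; cases b <;> simp [diffVec, h1, h2]
  by_cases e1 : i = 1
  · subst e1; cases b <;> simp [diffVec, h3, h4]
  cases b <;> simp [diffVec, e0, e1]

theorem isPrimitive_altVec (b : Bool) (a : ℕ) : IsPrimitive a (altVec (m := m) b) where
  sum_eq_zero l r _ := by
    clear * -
    induction l generalizing b with
    | nil => simp [altVec, ← Finset.sum_mul, sum_diffVec]
    | cons i l ih => simp only [altVec, List.cons_append, ← Finset.mul_sum]; rw [ih, mul_zero]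
  merge_eq_zero l j r _ := by
    clear * -
    induction l generalizing b with
    | nil => simp [altVec, ← mul_assoc, diffVec_mul_not]
    | cons i l ih => simp only [altVec, List.cons_append]; rw [ih, mul_zero]

/-- The vector that is a product of alternating differences in each block. The flag chooses the
first difference of the first block. -/
def blockAltVec : Bool → List ℕ → List (Fin (m + 5)) → ℂ
  | _, [], _ => 1
  | b, a :: as, l => altVec b (l.take a) * blockAltVec false as (l.drop a)

theorem isBlockPrimitive_cons {ι : Type*} [Fintype ι] {a : ℕ} {as : List ℕ} {f g : List ι → ℂ}
    (hf : IsPrimitive a f) (hg : IsBlockPrimitive as g) :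
    IsBlockPrimitive (a :: as) fun l => f (l.take a) * g (l.drop a) := by
  refine ⟨fun r _ => ?_, fun x hx => ?_⟩
  · have := IsPrimitive.linear (Finset.univ : Finset Unit) (fun _ => g r) (fun _ _ => hf)
    refine this.congr fun x hx => ?_
    simp [← hx, mul_comm]
  · have := IsBlockPrimitive.linear (Finset.univ : Finset Unit) (fun _ => f x) (fun _ _ => hg)
    refine this.congr fun l _ => ?_
    simp [← hx]

theorem isBlockPrimitive_blockAltVec (b : Bool) (as : List ℕ) :
    IsBlockPrimitive as (blockAltVec (m := m) b as) := by
  induction as generalizing b with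
  | nil => trivial
  | cons a as ih => exact isBlockPrimitive_cons (isPrimitive_altVec b a) (ih false)

/-- The word `0303⋯` or `3030⋯`, at which the alternating product of differences does not
vanish. -/
def zigzag : Bool → ℕ → List (Fin (m + 5))
  | _, 0 => []
  | b, a + 1 => (if b then 3 else 0) :: zigzag (!b) a

@[simp] theorem length_zigzag (b : Bool) (a : ℕ) : (zigzag (m := m) b a).length = a := by
  induction a generalizing b with
  | zero => rfl
  | succ a ih => simp [zigzag, ih]

theorem altVec_zigzag (b : Bool) (a : ℕ) : altVec b (zigzag (m := m) b a) ≠ 0 := by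
  induction a generalizing b with
  | zero => simp [zigzag, altVec]
  | succ a ih =>
    have h2 : (3 : Fin (m + 5)) ≠ 2 := fin_ofNat_ne (by decide) (by decide) (by decide)
    have h3 : (0 : Fin (m + 5)) ≠ 1 := by simp
    rw [zigzag, altVec]
    refine mul_ne_zero ?_ (ih _)
    cases b <;> simp [diffVec, h2]

/-- Every functional on vectors of length `m + 5` whose first two coefficients differ is nonzero on
some function `k ↦ f (l - k)`, for `f` primitive. -/
theorem exists_isPrimitive_probe {a : ℕ} (ha : 1 ≤ a) {β : Fin (m + 5) → ℂ} (hβ : β 0 ≠ β 1) :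
    ∃ (f : List (Fin (m + 5)) → ℂ) (l : List (Fin (m + 5))), IsPrimitive a f ∧ l.length = a ∧
      ∑ k, β k * f (l.map (· - k)) ≠ 0 := by
  obtain ⟨a, rfl⟩ := Nat.exists_eq_add_of_le' ha
  let g : Fin (m + 5) → ℂ := fun s => altVec false ((zigzag (m := m) false (a + 1)).map (· + s))
  have hg0 : g 0 ≠ 0 := by simpa [g] using altVec_zigzag (m := m) false (a + 1)
  have hg1 : ∀ k0 k : Fin (m + 5), altVec false
      (((zigzag (m := m) false (a + 1)).map (· + k0)).map (· - k)) = g (k0 - k) := by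
    intro k0 k
    simp only [g, List.map_map]
    congr 2
    funext i
    simp only [Function.comp_apply]
    abel
  have hg2 : ∀ s, s ≠ 0 → s ≠ 1 → g s = 0 := by
    intro s h0 h1
    simp [g, zigzag, altVec, diffVec, h0, h1]
  suffices H : ∃ k0, ∑ k, β k * g (k0 - k) ≠ 0 by
    obtain ⟨k0, hk0⟩ := H
    exact ⟨altVec false, (zigzag false (a + 1)).map (· + k0), isPrimitive_altVec _ _, by simp,
      by simpa only [hg1] using hk0⟩
  have h01 : (0 : Fin (m + 5)) ≠ 1 := by simp
  rcases Nat.eq_zero_or_pos a with rfl | ha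
  · refine ⟨1, ?_⟩
    rw [← Finset.sum_subset (Finset.subset_univ {0, 1}), Finset.sum_pair h01]
    · have e0 : g 0 = 1 := by simp [g, zigzag, altVec, diffVec]
      have e1 : g 1 = -1 := by simp [g, zigzag, altVec, diffVec]
      rw [sub_self, sub_zero, e0, e1]
      intro h
      exact hβ (by linear_combination -h)
    · intro k _ hk
      simp only [Finset.mem_insert, Finset.mem_singleton, not_or] at hk
      rw [hg2 _ (fun h => hk.2 (sub_eq_zero.1 h).symm) (fun h => hk.1 (by simpa using h)), mul_zero]
  · obtain ⟨a, rfl⟩ := Nat.exists_eq_add_of_le' ha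
    have hg3 : ∀ s, s ≠ 0 → g s = 0 := by
      intro s h0
      by_cases h1 : s = 1
      · subst h1
        have e1 : (3 : Fin (m + 5)) + 1 ≠ 2 := by
          rw [Ne, Fin.ext_iff, Fin.val_add]
          simp [Nat.mod_eq_of_lt (show 2 < m + 5 by omega),
            Nat.mod_eq_of_lt (show 4 < m + 5 by omega)]
        simp [g, zigzag, altVec, diffVec, e1]
      · exact hg2 s h0 h1
    obtain ⟨k0, hk0⟩ : ∃ k0, β k0 ≠ 0 := by
      by_contra! h
      exact hβ ((h 0).trans (h 1).symm)
    refine ⟨k0, ?_⟩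
    rw [Finset.sum_eq_single k0 (fun k _ hk => by
      rw [hg3 _ (sub_ne_zero.2 hk.symm), mul_zero]) (by simp), sub_self]
    exact mul_ne_zero hk0 hg0

end Alternating

/-! ### Blocks of letters and legs -/

section Blocks

/-- The word in which every block `(ζ, a)` is a scalar letter `ζ` followed by `a` legs. -/
def flat (L : List (Circle × ℕ)) : List (Option Circle) :=
  L.flatMap fun b => some b.1 :: List.replicate b.2 none

@[simp] theorem flat_nil : flat [] = [] := rfl

@[simp] theorem flat_cons (b : Circle × ℕ) (L : List (Circle × ℕ)) :
    flat (b :: L) = some b.1 :: (List.replicate b.2 none ++ flat L) := rfl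

theorem flat_append (L L' : List (Circle × ℕ)) : flat (L ++ L') = flat L ++ flat L' :=
  List.flatMap_append

@[simp] theorem legs_flat (L : List (Circle × ℕ)) : legs (flat L) = (L.map Prod.snd).sum := by
  induction L with
  | nil => rfl
  | cons b L ih => simp [ih]

/-- All the letters of the blocks differ from `1`, and all blocks have a leg. -/
def IsReduced (L : List (Circle × ℕ)) : Prop := ∀ b ∈ L, b.1 ≠ 1 ∧ 1 ≤ b.2

end Blocks

/-! ### A probe for blocks of letters -/

section Probe

variable {m : ℕ}

/-- The point of the flat model given by the circulant Latin square. -/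
def cyclicPoint (m : ℕ) : FlatSpace (m + 5) :=
  latinPoint (fun i j => i - j) (fun i => (Equiv.subLeft i).bijective)
    fun j => (Equiv.subRight j).bijective

theorem sum_wordMat_cyclicPoint {Z : Type*} (Y : Z → Matrix (Fin (m + 5)) (Fin (m + 5)) ℂ)
    (f : List (Fin (m + 5)) → ℂ) (l : List (Fin (m + 5))) :
    ∑ x ∈ words (Fin (m + 5)) l.length, f x •
      wordMat (fun i j => (cyclicPoint m).1 i j) Y (List.replicate l.length none) l x =
      Matrix.diagonal fun k => f (l.map (· - k)) := by
  refine sum_wordMat_latinPoint Y _ _ (d := fun i k => i - k) (fun i j k => ?_) f l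
  rw [sub_eq_iff_eq_add, eq_sub_iff_add_eq', eq_comm]

variable (m) in
/-- The projection onto the constant vectors. -/
def meanProj : Matrix (Fin (m + 5)) (Fin (m + 5)) ℂ := Matrix.of fun _ _ => ((m + 5 : ℕ) : ℂ)⁻¹

theorem isStarProjection_meanProj : IsStarProjection (meanProj m) where
  isIdempotentElem := by
    ext i j
    have : ((m + 5 : ℕ) : ℂ) ≠ 0 := by norm_cast
    rw [Matrix.mul_apply]
    simp only [meanProj, Matrix.of_apply, Finset.sum_const, Finset.card_univ, Fintype.card_fin,
      nsmul_eq_mul]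
    field_simp
  isSelfAdjoint := by
    ext i j
    simp [meanProj, Matrix.star_apply]

variable (m) in
/-- The leading term of a scalar letter. -/
def leadLetter (ζ : Circle) : Matrix (Fin (m + 5)) (Fin (m + 5)) ℂ :=
  meanProj m * Matrix.diagonal (fun i : Fin (m + 5) => (ζ : ℂ) ^ (i : ℕ)) * (1 - meanProj m)

variable (m) in
/-- The entries, constant along columns, of the leading term of a scalar letter. -/
def leadCoeff (ζ : Circle) (j : Fin (m + 5)) : ℂ :=
  ((m + 5 : ℕ) : ℂ)⁻¹ * ((ζ : ℂ) ^ (j : ℕ) - ((m + 5 : ℕ) : ℂ)⁻¹ * ∑ i : Fin (m + 5), (ζ : ℂ) ^ (i : ℕ))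

theorem leadLetter_apply (ζ : Circle) (i j : Fin (m + 5)) :
    leadLetter m ζ i j = leadCoeff m ζ j := by
  rw [leadLetter, mul_sub, mul_one, Matrix.sub_apply, Matrix.mul_diagonal, Matrix.mul_apply]
  simp only [Matrix.mul_diagonal, meanProj, Matrix.of_apply, leadCoeff, ← Finset.sum_mul,
    ← Finset.mul_sum]
  ring

theorem leadCoeff_zero_ne_one {ζ : Circle} (hζ : ζ ≠ 1) :
    leadCoeff m ζ 0 ≠ leadCoeff m ζ 1 := by
  have : ((m + 5 : ℕ) : ℂ)⁻¹ ≠ 0 := inv_ne_zero (by norm_cast)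
  intro h
  have h1 := mul_left_cancel₀ this h
  have h2 : (ζ : ℂ) = 1 := by
    have := sub_left_injective h1
    simpa [Fin.val_one'] using this.symm
  exact hζ (Circle.ext (by simpa using h2))

theorem meanProj_mul_leadLetter (ζ : Circle) : meanProj m * leadLetter m ζ = leadLetter m ζ := by
  rw [leadLetter, ← mul_assoc, ← mul_assoc, isStarProjection_meanProj.isIdempotentElem.eq]

theorem leadLetter_mul_diagonal (ζ : Circle) (κ : Fin (m + 5) → ℂ) :
    leadLetter m ζ * Matrix.diagonal κ * meanProj m = (∑ k, leadCoeff m ζ k * κ k) • meanProj m := by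
  ext i j
  rw [Matrix.mul_apply]
  simp only [Matrix.mul_diagonal, leadLetter_apply, Matrix.smul_apply, smul_eq_mul, meanProj,
    Matrix.of_apply, Finset.sum_mul]

theorem leadLetter_entry (ζ : Circle) (κ : Fin (m + 5) → ℂ) (i j : Fin (m + 5)) :
    ((1 - meanProj m) * Matrix.diagonal κ * leadLetter m ζ) i j =
      (∑ k, ((if i = k then 1 else 0) - ((m + 5 : ℕ) : ℂ)⁻¹) * κ k) * leadCoeff m ζ j := by
  rw [Matrix.mul_apply]
  simp only [Matrix.mul_diagonal, leadLetter_apply, Finset.sum_mul, Matrix.sub_apply,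
    Matrix.one_apply, meanProj, Matrix.of_apply]

/-- For the leading terms of the letters, some block primitive vector survives multiplication with
the projection onto the constant vectors. -/
theorem exists_blockPrimitive_probe {L : List (Circle × ℕ)} (hL : IsReduced L) :
    ∃ (f : List (Fin (m + 5)) → ℂ) (r : List (Fin (m + 5))) (c : ℂ),
      IsBlockPrimitive (L.map Prod.snd) f ∧ r.length = (L.map Prod.snd).sum ∧ c ≠ 0 ∧
      (∑ x ∈ words (Fin (m + 5)) (L.map Prod.snd).sum, f x •
        wordMat (fun i j => (cyclicPoint m).1 i j) (leadLetter m) (flat L) r x) * meanProj m =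
        c • meanProj m := by
  induction L with
  | nil => exact ⟨fun _ => 1, [], 1, trivial, rfl, one_ne_zero, by simp⟩
  | cons b L ih =>
    obtain ⟨ζ, a⟩ := b
    have hb := hL (ζ, a) (by simp)
    obtain ⟨f, r, c, hf, hr, hc, h⟩ := ih fun b hb => hL b (by simp [hb])
    obtain ⟨g, l, hg, hl, h'⟩ := exists_isPrimitive_probe hb.2 (leadCoeff_zero_ne_one (m := m) hb.1)
    refine ⟨_, l ++ r, _, isBlockPrimitive_cons hg hf, by simp [hl, hr], mul_ne_zero h' hc, ?_⟩
    simp only [List.map_cons, List.sum_cons, sum_words_append, flat_cons]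
    have e1 : ∀ x ∈ words (Fin (m + 5)) a, ∀ y ∈ words (Fin (m + 5)) (L.map Prod.snd).sum,
        (g ((x ++ y).take a) * f ((x ++ y).drop a)) •
          wordMat (fun i j => (cyclicPoint m).1 i j) (leadLetter m)
            (some ζ :: (List.replicate a none ++ flat L)) (l ++ r) (x ++ y) =
        leadLetter m ζ * (g x • wordMat (fun i j => (cyclicPoint m).1 i j) (leadLetter m)
          (List.replicate a none) l x) * (f y • wordMat (fun i j => (cyclicPoint m).1 i j)
          (leadLetter m) (flat L) r y) := by
      intro x hx y hy
      rw [mem_words] at hx hy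
      rw [wordMat_some, wordMat_append _ _ (by simpa using hl) (by simpa using hx)]
      simp [← hx, mul_smul, mul_assoc, smul_comm (f y)]
    rw [Finset.sum_congr rfl fun x hx => Finset.sum_congr rfl fun y hy => e1 x hx y hy]
    simp only [← Finset.mul_sum, ← Finset.sum_mul]
    subst hl
    rw [sum_wordMat_cyclicPoint, mul_assoc, h, mul_smul_comm, leadLetter_mul_diagonal, smul_smul,
      mul_comm c]

/-- The probe: a functional on the legs outside the last block that annihilates all intertwiners
which insert `c` legs in front of the blocks, but not all block primitive vectors. -/
theorem exists_probe {L : List (Circle × ℕ)} {ζ : Circle} {d c : ℕ}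
    (hL : IsReduced (L ++ [(ζ, d)])) (hc : 1 ≤ c) :
    ∃ ω : List (Fin (m + 5)) → ℂ,
      (∃ f : List (Fin (m + 5)) → ℂ, IsBlockPrimitive (c :: L.map Prod.snd) f ∧
        ∑ l ∈ words (Fin (m + 5)) (c + (L.map Prod.snd).sum), ω l * f l ≠ 0) ∧
      ∀ ξ, ModelHom (m + 5) (flat (L ++ [(ζ, d)]))
        (List.replicate c none ++ flat (L ++ [(ζ, d)])) ξ →
        ∀ z n : List (Fin (m + 5)), z.length = d → n.length = legs (flat (L ++ [(ζ, d)])) →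
        ∑ l ∈ words (Fin (m + 5)) (c + (L.map Prod.snd).sum), ω l * ξ (l ++ z) n = 0 := by
  have hζ : ζ ≠ 1 := (hL (ζ, d) (by simp)).1
  obtain ⟨j, hj⟩ : ∃ j, leadCoeff m ζ j ≠ 0 := by
    by_contra! h
    exact leadCoeff_zero_ne_one (m := m) hζ ((h 0).trans (h 1).symm)
  obtain ⟨f, r, k, hf, hr, hk, h⟩ := exists_blockPrimitive_probe (m := m) (L := L)
    fun b hb => hL b (by simp [hb])
  obtain ⟨g, l0, hg, hl0, h'⟩ := exists_isPrimitive_probe (m := m) hc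
    (β := fun k => (if 0 = k then 1 else 0) - ((m + 5 : ℕ) : ℂ)⁻¹) (by simp)
  set A : List (Fin (m + 5)) → Matrix (Fin (m + 5)) (Fin (m + 5)) ℂ := fun x =>
    (1 - meanProj m) * wordMat (fun i j => (cyclicPoint m).1 i j) (leadLetter m)
      (List.replicate c none ++ flat L) (l0 ++ r) x * leadLetter m ζ with hA
  refine ⟨fun x => A x 0 j, ⟨_, isBlockPrimitive_cons hg hf, ?_⟩, fun ξ hξ z n hz hn => ?_⟩
  · have e1 : ∑ l ∈ words (Fin (m + 5)) (c + (L.map Prod.snd).sum),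
        (g (l.take c) * f (l.drop c)) • A l =
        k • ((1 - meanProj m) * Matrix.diagonal (fun k => g (l0.map (· - k))) * leadLetter m ζ) := by
      have e2 : ∀ x ∈ words (Fin (m + 5)) c, ∀ y ∈ words (Fin (m + 5)) (L.map Prod.snd).sum,
          (g ((x ++ y).take c) * f ((x ++ y).drop c)) • A (x ++ y) =
          (1 - meanProj m) * (g x • wordMat (fun i j => (cyclicPoint m).1 i j) (leadLetter m)
            (List.replicate c none) l0 x) * (f y • wordMat (fun i j => (cyclicPoint m).1 i j)
            (leadLetter m) (flat L) r y) * leadLetter m ζ := by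
        intro x hx y hy
        rw [mem_words] at hx hy
        rw [hA]
        simp only
        rw [wordMat_append _ _ (by simpa using hl0) (by simpa using hx)]
        simp [← hx, mul_smul, mul_assoc, smul_comm (f y)]
      rw [sum_words_append, Finset.sum_congr rfl fun x hx => Finset.sum_congr rfl fun y hy =>
        e2 x hx y hy]
      simp only [← Finset.mul_sum, ← Finset.sum_mul]
      subst hl0
      rw [sum_wordMat_cyclicPoint, ← meanProj_mul_leadLetter, ← mul_assoc, mul_assoc _ _ (meanProj m),
        h, mul_smul_comm, smul_mul_assoc, mul_assoc _ (meanProj m), meanProj_mul_leadLetter]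
    have e3 := congrFun (congrFun e1 0) j
    rw [Matrix.sum_apply, Matrix.smul_apply, leadLetter_entry] at e3
    simp only [Matrix.smul_apply, smul_eq_mul] at e3
    simp only [mul_comm (A _ _ _)]
    rw [e3]
    exact mul_ne_zero hk (mul_ne_zero h' hj)
  · have h1 := Intertwines.degenerate (P := fun i j => (cyclicPoint m).1 i j)
      isStarProjection_meanProj (by simp) (hξ (cyclicPoint m))
    change Intertwines _ (leadLetter m) _ _ _ at h1
    set Q : List (Fin (m + 5)) → List (Fin (m + 5)) → Matrix (Fin (m + 5)) (Fin (m + 5)) ℂ :=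
      wordMat (fun i j => (cyclicPoint m).1 i j) (leadLetter m) (List.replicate d none) with hQ
    have hlr : (l0 ++ r).length = legs (List.replicate c (none : Option Circle) ++ flat L) := by
      simp [hl0, hr]
    have hw : List.replicate c none ++ flat (L ++ [(ζ, d)]) =
        (List.replicate c none ++ flat L) ++ (some ζ :: List.replicate d none) := by
      simp [flat_append]
    -- The words on the right hand side start with a letter, which `1 - p` kills from the left.
    have h2 : ∀ y, (1 - meanProj m) * wordMat (fun i j => (cyclicPoint m).1 i j) (leadLetter m)
        (flat (L ++ [(ζ, d)])) y n = 0 := by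
      intro y
      have : ∀ ζ, (1 - meanProj m) * leadLetter m ζ = 0 := fun ζ => by
        rw [sub_mul, one_mul, meanProj_mul_leadLetter, sub_self]
      cases L with
      | nil => rw [List.nil_append, flat_cons, wordMat_some, ← mul_assoc, this, zero_mul]
      | cons b L => rw [List.cons_append, flat_cons, wordMat_some, ← mul_assoc, this, zero_mul]
    have h3 : ∀ z', z'.length = d → ∑ y ∈ words (Fin (m + 5)) d,
        (∑ x ∈ words (Fin (m + 5)) (c + (L.map Prod.snd).sum), ξ (x ++ y) n • A x) * Q z' y = 0 := by
      intro z' hz'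
      have h4 := congrArg ((1 - meanProj m) * ·) (h1 (l0 ++ r ++ z') n
        (by rw [hw, legs_append, List.length_append, hlr]; simp [hz']) hn)
      simp only [Finset.mul_sum, mul_smul_comm, h2, smul_zero, Finset.sum_const_zero] at h4
      rw [hw, legs_append, sum_words_append, Finset.sum_comm] at h4
      simp only [legs_append, legs_replicate, legs_flat, legs_some] at h4
      rw [← h4]
      refine Finset.sum_congr rfl fun y hy => ?_
      rw [Finset.sum_mul]
      refine Finset.sum_congr rfl fun x hx => ?_
      rw [mem_words] at hx
      rw [wordMat_append _ _ hlr (by simpa using hx), wordMat_some, smul_mul_assoc, hA]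
      simp only [mul_assoc, hQ]
    -- The matrix of the last legs is invertible in the appropriate sense.
    have h5 : ∀ y ∈ words (Fin (m + 5)) d,
        ∑ z' ∈ words (Fin (m + 5)) d, Q z' y * star (Q z' z) = if y = z then 1 else 0 := by
      intro y hy
      rw [mem_words] at hy
      have h6 := (isUnitaryTest (cyclicPoint m) 1).wordMat_mul_star' (List.replicate d none)
        (m := y) (m' := z) (by simpa using hy) (by simpa using hz)
      simpa only [legs_replicate, hQ, wordMat_replicate] using h6
    have h7 : ∑ x ∈ words (Fin (m + 5)) (c + (L.map Prod.snd).sum), ξ (x ++ z) n • A x = 0 := by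
      have h8 : ∑ z' ∈ words (Fin (m + 5)) d, (∑ y ∈ words (Fin (m + 5)) d,
          (∑ x ∈ words (Fin (m + 5)) (c + (L.map Prod.snd).sum), ξ (x ++ y) n • A x) * Q z' y) *
            star (Q z' z) = 0 :=
        Finset.sum_eq_zero fun z' hz' => by rw [h3 z' (by simpa using hz'), zero_mul]
      simp only [Finset.sum_mul _ _ (star _), mul_assoc _ (Q _ _)] at h8
      rw [Finset.sum_comm] at h8
      simp only [← Finset.mul_sum] at h8
      rw [Finset.sum_congr rfl fun y hy => by rw [h5 y hy]] at h8
      simpa [hz] using h8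
    have h9 := congrFun (congrFun h7 0) j
    rw [Matrix.sum_apply] at h9
    simp only [Matrix.smul_apply, smul_eq_mul, Matrix.zero_apply] at h9
    simp only [mul_comm (A _ _ _)]
    exact h9

end Probe

/-! ### Moving several legs at once -/

section ManyLegs

variable {ι Z B : Type*} [Fintype ι] [DecidableEq ι] [Semiring B] [Algebra ℂ B]
  {p : ι → ι → B} {Y : Z → B}

/-- Frobenius reciprocity for several legs, whose order is reversed. -/
theorem Intertwines.bend_in_replicate (hp : Magic p) (a : ℕ) {v w : List (Option Z)}
    {ξ η : List ι → List ι → ℂ} (h : Intertwines p Y (List.replicate a none ++ v) w ξ)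
    (e : ∀ k l m, k.length = a → l.length = legs w → m.length = legs v →
      η (k.reverse ++ l) m = ξ l (k ++ m)) :
    Intertwines p Y v (List.replicate a none ++ w) η := by
  induction a generalizing w ξ with
  | zero => exact h.congr fun l m hl hm => e [] l m rfl (by simpa using hl) hm
  | succ a ih =>
    rw [List.replicate_succ, List.cons_append] at h
    have h1 := h.bend_in hp (η := fun l m => ξ l.tail (l.head?.toList ++ m))
      fun j l m _ _ => by simp
    have h2 := ih h1 fun k l m hk hl hm => ?_
    · rwa [List.replicate_succ', List.append_assoc]
    · obtain _ | ⟨j, l⟩ := l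
      · simp at hl
      have := e (j :: k) l m (by simp [hk]) (by simpa using hl) hm
      simpa using this

theorem Intertwines.trace_replicate (hp : Magic p) (d : ℕ) {v w : List (Option Z)}
    {ξ : List ι → List ι → ℂ}
    (h : Intertwines p Y (v ++ List.replicate d none) (w ++ List.replicate d none) ξ) :
    Intertwines p Y v w fun l m => ∑ z ∈ words ι d, ξ (l ++ z) (m ++ z) := by
  induction d generalizing ξ with
  | zero => simpa using h
  | succ d ih =>
    rw [List.replicate_succ', ← List.append_assoc, ← List.append_assoc] at h
    have h1 := ih (h.trace_last hp (η := fun l m => ∑ j, ξ (l ++ [j]) (m ++ [j]))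
      fun _ _ _ _ => rfl)
    refine h1.congr fun l m _ _ => ?_
    rw [sum_words_append]
    simp only [sum_words_one, List.append_assoc]

end ManyLegs

/-! ### Noncrossing slices of intertwiners -/

section Slices

variable {ι Z B : Type*} [Fintype ι] [DecidableEq ι] [Semiring B] [StarRing B] [Algebra ℂ B]
  [StarModule ℂ B] {p : ι → ι → B} {Y : Z → B}

/-- Noncrossing vectors are also fixed by the transposed matrices of words. -/
theorem sum_mul_wordMat_of_mem_NC (hp : IsUnitaryTest p Y) {c : ℕ} {t : List ι → ℂ}
    (ht : t ∈ NC ι c) {m : List ι} (hm : m.length = c) :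
    ∑ x ∈ words ι c, t x • wordMat p Y (List.replicate c none) x m = t m • 1 := by
  have h := (isFixed_of_mem_NC (Y := Y) hp.toMagic (conj_mem_NC ht)).adjoint hp [] m rfl
    (by simpa using hm)
  simpa using h.symm

/-- Pairing the first legs with a noncrossing vector. -/
theorem Intertwines.slice (hp : IsUnitaryTest p Y) {c : ℕ} {v w : List (Option Z)}
    {ξ : List ι → List ι → ℂ} (h : Intertwines p Y v (List.replicate c none ++ w) ξ)
    {t : List ι → ℂ} (ht : t ∈ NC ι c) :
    Intertwines p Y v w fun z m => ∑ x ∈ words ι c, t x * ξ (x ++ z) m := by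
  intro l m hl hm
  calc _ = ∑ z ∈ words ι (legs w), ∑ y ∈ words ι c, ξ (y ++ z) m •
          ((t y • (1 : B)) * wordMat p Y w l z) := by
        refine Finset.sum_congr rfl fun z _ => ?_
        rw [Finset.sum_smul]
        refine Finset.sum_congr rfl fun y _ => ?_
        rw [smul_mul_assoc, one_mul, smul_smul, mul_comm]
    _ = ∑ z ∈ words ι (legs w), ∑ y ∈ words ι c, ∑ x ∈ words ι c, t x • ξ (y ++ z) m •
          (wordMat p Y (List.replicate c none) x y * wordMat p Y w l z) := by
        refine Finset.sum_congr rfl fun z _ => Finset.sum_congr rfl fun y hy => ?_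
        rw [← sum_mul_wordMat_of_mem_NC hp ht (by simpa using hy), Finset.sum_mul,
          Finset.smul_sum]
        refine Finset.sum_congr rfl fun x _ => ?_
        rw [smul_mul_assoc, smul_comm]
    _ = ∑ x ∈ words ι c, t x • ∑ y ∈ words ι c, ∑ z ∈ words ι (legs w), ξ (y ++ z) m •
          (wordMat p Y (List.replicate c none) x y * wordMat p Y w l z) := by
        simp only [Finset.smul_sum]
        exact Finset.sum_comm.trans
          ((Finset.sum_congr rfl fun y _ => Finset.sum_comm).trans Finset.sum_comm)
    _ = ∑ x ∈ words ι c, t x • ∑ y ∈ words ι (legs v), ξ (x ++ l) y • wordMat p Y v y m := by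
        refine Finset.sum_congr rfl fun x hx => ?_
        rw [mem_words] at hx
        rw [← h (x ++ l) m (by simp [hx, hl]) hm, legs_append, legs_replicate, sum_words_append]
        congr 1
        refine Finset.sum_congr rfl fun y hy => Finset.sum_congr rfl fun z _ => ?_
        rw [wordMat_append p Y (by simpa using hx) (by simpa using hy)]
    _ = _ := by
        simp only [Finset.smul_sum, Finset.sum_smul, smul_smul]
        rw [Finset.sum_comm]

/-- The projection of the first legs onto the noncrossing vectors. -/
theorem Intertwines.project (hp : IsUnitaryTest p Y) {c : ℕ} {v w : List (Option Z)}
    {ξ η : List ι → List ι → ℂ} {R : List ι → List ι → ℂ} (hR : IsNCKernel ι c R)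
    (h : Intertwines p Y v (List.replicate c none ++ w) ξ)
    (e : ∀ x z m, x.length = c → z.length = legs w → m.length = legs v →
      η (x ++ z) m = ∑ y ∈ words ι c, R x y * ξ (y ++ z) m) :
    Intertwines p Y v (List.replicate c none ++ w) η := by
  intro L m hL hm
  obtain ⟨l, r, rfl, hl, hr⟩ : ∃ a b, L = a ++ b ∧ a.length = c ∧ b.length = legs w :=
    ⟨L.take c, L.drop c, by simp, by simp at hL ⊢; omega, by simp at hL ⊢; omega⟩
  have h1 := h.slice hp (hR.row_mem l) r m hr hm
  rw [legs_append, legs_replicate, sum_words_append]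
  calc _ = ∑ z ∈ words ι (legs w), ∑ y ∈ words ι c, ξ (y ++ z) m •
        ((∑ x ∈ words ι c, R x y • wordMat p Y (List.replicate c none) l x) *
          wordMat p Y w r z) := by
        rw [Finset.sum_comm]
        refine Finset.sum_congr rfl fun z hz => ?_
        simp only [Finset.sum_mul, Finset.smul_sum]
        rw [Finset.sum_comm]
        refine Finset.sum_congr rfl fun x hx => ?_
        rw [mem_words] at hx hz
        rw [wordMat_append p Y (by simpa using hl) (by simpa using hx), e x z m hx hz hm,
          Finset.sum_smul]
        refine Finset.sum_congr rfl fun y _ => ?_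
        rw [smul_mul_assoc, smul_smul, mul_comm]
    _ = _ := by
        simp only [Finset.sum_smul] at h1
        rw [Finset.sum_congr rfl fun y (hy : y ∈ words ι (legs v)) => by
          rw [e l r y hl hr (by simpa using hy), Finset.sum_smul], ← h1]
        refine Finset.sum_congr rfl fun z _ => Finset.sum_congr rfl fun y _ => ?_
        have h2 := isFixed_iff.1 (isFixed_of_mem_NC (Y := Y) hp.toMagic (hR.col_mem y)) l
          (by simpa using hl)
        rw [legs_replicate] at h2
        rw [h2, smul_mul_assoc, one_mul, smul_smul, mul_comm]

end Slices

theorem exists_blockPrimitive_ne_zero {m : ℕ} (b : Bool) (as : List ℕ) :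
    ∃ l : List (Fin (m + 5)), l.length = as.sum ∧ blockAltVec b as l ≠ 0 := by
  induction as generalizing b with
  | nil => exact ⟨[], rfl, one_ne_zero⟩
  | cons a as ih =>
    obtain ⟨l, hl, h⟩ := ih false
    refine ⟨zigzag b a ++ l, by simp [hl], ?_⟩
    simp only [blockAltVec]
    rw [List.take_left' (by simp), List.drop_left' (by simp)]
    exact mul_ne_zero (altVec_zigzag b a) h

theorem eq_zero_of_sum_mul_conj {ι : Type*} [Fintype ι] {k : ℕ} {f : List ι → ℂ}
    (h : ∑ l ∈ words ι k, f l * starRingEnd ℂ (f l) = 0) {l : List ι} (hl : l.length = k) :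
    f l = 0 := by
  simp only [Complex.mul_conj] at h
  norm_cast at h
  rw [Finset.sum_eq_zero_iff_of_nonneg fun _ _ => Complex.normSq_nonneg _] at h
  exact Complex.normSq_eq_zero.1 (h l (by simpa using hl))

/-! ### Irreducibility of blocks -/

section Irreducible

variable {m : ℕ}

variable (m) in
/-- Schur's lemma for the primitive vectors of the blocks `L`: endomorphisms act as scalars. -/
def SchurProperty (L : List (Circle × ℕ)) : Prop :=
  ∀ T, ModelHom (m + 5) (flat L) (flat L) T →
    (∀ n : List (Fin (m + 5)), n.length = (L.map Prod.snd).sum →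
      IsBlockPrimitive (L.map Prod.snd) fun l => T l n) →
    ∃ c : ℂ, ∀ f, IsBlockPrimitive (L.map Prod.snd) f →
      ∀ l : List (Fin (m + 5)), l.length = (L.map Prod.snd).sum →
        ∑ n ∈ words (Fin (m + 5)) (L.map Prod.snd).sum, T l n * f n = c * f l

/-- The first legs of an intertwiner are primitive if they are orthogonal to the noncrossing vectors
and there are no such intertwiners with one leg less. -/
theorem isPrimitive_of_centred {c : ℕ} {L : List (Circle × ℕ)}
    {ξ : List (Fin (m + 5)) → List (Fin (m + 5)) → ℂ}
    (ih : ∀ ξ, ModelHom (m + 5) (flat L) (List.replicate c none ++ flat L) ξ →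
      (∀ t ∈ NC (Fin (m + 5)) c, ∀ z n, z.length = (L.map Prod.snd).sum →
        n.length = (L.map Prod.snd).sum → ∑ x ∈ words (Fin (m + 5)) c, ξ (x ++ z) n * t x = 0) →
      (∀ x n, x.length = c → n.length = (L.map Prod.snd).sum →
        IsBlockPrimitive (L.map Prod.snd) fun z => ξ (x ++ z) n) →
      ∀ x z n, x.length = c → z.length = (L.map Prod.snd).sum →
        n.length = (L.map Prod.snd).sum → ξ (x ++ z) n = 0)
    (hξ : ModelHom (m + 5) (flat L) (List.replicate (c + 1) none ++ flat L) ξ)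
    (hcen : ∀ t ∈ NC (Fin (m + 5)) (c + 1), ∀ z n, z.length = (L.map Prod.snd).sum →
      n.length = (L.map Prod.snd).sum →
      ∑ x ∈ words (Fin (m + 5)) (c + 1), ξ (x ++ z) n * t x = 0)
    (hprim : ∀ x n, x.length = c + 1 → n.length = (L.map Prod.snd).sum →
      IsBlockPrimitive (L.map Prod.snd) fun z => ξ (x ++ z) n)
    {z n : List (Fin (m + 5))} (hz : z.length = (L.map Prod.snd).sum)
    (hn : n.length = (L.map Prod.snd).sum) : IsPrimitive (c + 1) fun x => ξ (x ++ z) n where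
  sum_eq_zero l r hlr := by
    obtain ⟨q, b, hc, hq, hb⟩ : ∃ q b, c = q + b ∧ l.length = q ∧ r.length = b :=
      ⟨_, _, by omega, rfl, rfl⟩
    subst hc
    have key := ih (fun y n => ∑ j, ξ (y.take q ++ j :: y.drop q) n) ?_ ?_ ?_ (l ++ r) z n
      (by simp [hq, hb]) hz hn
    · simpa [← hq] using key
    · intro P U
      have h1 : Intertwines (fun i j => P.1 i j) (letterMat U) (flat L)
          (List.replicate q none ++ none :: (List.replicate b none ++ flat L)) ξ := by
        have := hξ P U
        rwa [show q + b + 1 = q + (b + 1) by ring, List.replicate_add, List.append_assoc,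
          List.replicate_succ, List.cons_append] at this
      rw [List.replicate_add, List.append_assoc]
      refine h1.sum P.magic fun l r m hl _ _ => ?_
      rw [legs_replicate] at hl
      simp [← hl]
    · intro t ht z n hz hn
      have := hcen _ (NC.ins q (by omega) ht) z n hz hn
      rw [show q + b + 1 = q + 1 + b by ring, sum_mul_Ins q b (fun x => ξ (x ++ z) n)] at this
      rw [sum_words_append, ← this]
      refine Finset.sum_congr rfl fun x hx => Finset.sum_congr rfl fun y _ => ?_
      rw [mem_words] at hx
      simp [← hx]
    · intro x n hx hn
      have := IsBlockPrimitive.linear (as := L.map Prod.snd) Finset.univ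
        (fun _ : Fin (m + 5) => (1 : ℂ))
        (f := fun j z => ξ ((x.take q ++ j :: x.drop q) ++ z) n)
        fun j _ => hprim _ n (by simp [hx]; omega) hn
      refine this.congr fun z _ => Finset.sum_congr rfl fun j _ => ?_
      rw [one_mul, List.take_append_of_le_length (by omega), List.drop_append_of_le_length (by omega)]
      simp
  merge_eq_zero l j r hlr := by
    obtain ⟨q, b, hc, hq, hb⟩ : ∃ q b, c = q + 1 + b ∧ l.length = q ∧ r.length = b :=
      ⟨_, _, by omega, rfl, rfl⟩
    subst hc
    have key := ih (fun y n => ξ (y.take (q + 1) ++ y.drop q) n) ?_ ?_ ?_ (l ++ j :: r) z n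
      (by simp [hq, hb]; omega) hz hn
    · simpa [← hq, List.take_append, List.drop_append,
        List.take_of_length_le (Nat.le_succ l.length)] using key
    · intro P U
      have h1 : Intertwines (fun i j => P.1 i j) (letterMat U) (flat L)
          (List.replicate q none ++ none :: none :: (List.replicate b none ++ flat L)) ξ := by
        have := hξ P U
        rwa [show q + 1 + b + 1 = q + (b + 1 + 1) by ring, List.replicate_add, List.append_assoc,
          List.replicate_succ, List.replicate_succ, List.cons_append, List.cons_append] at this
      rw [show q + 1 + b = q + (b + 1) by ring, List.replicate_add, List.append_assoc,
        List.replicate_succ, List.cons_append]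
      refine h1.merge P.magic fun l j r m hl _ _ => ?_
      rw [legs_replicate] at hl
      simp [← hl, List.take_append, List.take_of_length_le (Nat.le_succ l.length)]
    · intro t ht z n hz hn
      have := hcen _ (NC.dup q (by omega) ht) z n hz hn
      rw [sum_mul_Dup q b (fun x => ξ (x ++ z) n)] at this
      rw [sum_words_insert, ← this]
      refine Finset.sum_congr rfl fun x hx => Finset.sum_congr rfl fun y _ =>
        Finset.sum_congr rfl fun j _ => ?_
      rw [mem_words] at hx
      simp [← hx, List.take_append, List.take_of_length_le (Nat.le_succ x.length)]
    · intro x n hx hn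
      have := hprim (x.take (q + 1) ++ x.drop q) n (by simp [hx]; omega) hn
      refine this.congr fun z _ => ?_
      rw [List.take_append_of_le_length (by omega), List.drop_append_of_le_length (by omega)]
      simp

end Irreducible

/-- The kernel of a Gram matrix is the orthogonal complement of the vectors it is built from. -/
theorem sum_conj_mul_eq_zero {α κ : Type*} (W : Finset α) (S : Finset κ) (v : κ → α → ℂ)
    (g : α → ℂ)
    (h : ∀ l ∈ W, ∑ l' ∈ W, (∑ q ∈ S, v q l * starRingEnd ℂ (v q l')) * g l' = 0) :
    ∀ q ∈ S, ∑ l ∈ W, starRingEnd ℂ (g l) * v q l = 0 := by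
  have h1 : ∑ q ∈ S, Complex.normSq (∑ l ∈ W, starRingEnd ℂ (g l) * v q l) = 0 := by
    have h2 : ((∑ q ∈ S, Complex.normSq (∑ l ∈ W, starRingEnd ℂ (g l) * v q l) : ℝ) : ℂ) = 0 := by
      calc _ = ∑ q ∈ S, ∑ l ∈ W, ∑ l' ∈ W,
            starRingEnd ℂ (g l) * (v q l * starRingEnd ℂ (v q l') * g l') := by
              push_cast
              refine Finset.sum_congr rfl fun q _ => ?_
              simp only [← Complex.mul_conj, map_sum, map_mul, Complex.conj_conj,
                Finset.sum_mul_sum]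
              exact Finset.sum_congr rfl fun l _ => Finset.sum_congr rfl fun l' _ => by ring
        _ = ∑ l ∈ W, starRingEnd ℂ (g l) *
              ∑ l' ∈ W, (∑ q ∈ S, v q l * starRingEnd ℂ (v q l')) * g l' := by
              simp only [Finset.mul_sum, Finset.sum_mul]
              exact Finset.sum_comm.trans (Finset.sum_congr rfl fun l _ => Finset.sum_comm)
        _ = 0 := Finset.sum_eq_zero fun l hl => by rw [h l hl, mul_zero]
    exact_mod_cast h2
  rw [Finset.sum_eq_zero_iff_of_nonneg fun _ _ => Complex.normSq_nonneg _] at h1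
  exact fun q hq => Complex.normSq_eq_zero.1 (h1 q hq)

section Irreducible

variable {m : ℕ}

/-- Intertwiners that insert `c` legs in front of the blocks `L`, in the orthogonal complement of the
noncrossing vectors, vanish on primitive vectors. Without blocks, this is the hypothesis that the
fixed vectors of the flat model are noncrossing. -/
theorem eq_zero_of_centred (hH : ∀ k f, IsFlatFixed (m + 5) k f → f ∈ NC (Fin (m + 5)) k)
    {L : List (Circle × ℕ)} (hL : IsReduced L)
    (hS : ∀ L', IsReduced L' → L'.length = L.length → SchurProperty m L') (c : ℕ) :
    ∀ ξ, ModelHom (m + 5) (flat L) (List.replicate c none ++ flat L) ξ →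
      (∀ t ∈ NC (Fin (m + 5)) c, ∀ z n, z.length = (L.map Prod.snd).sum →
        n.length = (L.map Prod.snd).sum → ∑ x ∈ words (Fin (m + 5)) c, ξ (x ++ z) n * t x = 0) →
      (∀ x n, x.length = c → n.length = (L.map Prod.snd).sum →
        IsBlockPrimitive (L.map Prod.snd) fun z => ξ (x ++ z) n) →
      ∀ x z n, x.length = c → z.length = (L.map Prod.snd).sum →
        n.length = (L.map Prod.snd).sum → ξ (x ++ z) n = 0 := by
  induction c with
  | zero =>
    intro ξ _ hcen _ x z n hx hz hn
    rw [List.length_eq_zero_iff] at hx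
    simpa [hx] using hcen _ (NC.of_zero fun _ => 1) z n hz hn
  | succ c ih =>
    intro ξ hξ hcen hprim x z n hx hz hn
    have hp : ∀ z n, z.length = (L.map Prod.snd).sum → n.length = (L.map Prod.snd).sum →
        IsPrimitive (c + 1) fun x => ξ (x ++ z) n := fun z n hz hn =>
      isPrimitive_of_centred ih hξ hcen hprim hz hn
    rcases List.eq_nil_or_concat L with rfl | ⟨L, ⟨ζ, d⟩, rfl⟩
    · -- Without letters, `ξ` is a fixed vector, which is noncrossing by hypothesis.
      simp only [List.map_nil, List.sum_nil, List.length_eq_zero_iff] at hz hn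
      subst hz hn
      rw [List.append_nil]
      have h1 : IsFlatFixed (m + 5) (c + 1) fun x => ξ x [] := by
        intro P
        have := hξ P 1
        rw [flat_nil, List.append_nil] at this
        refine (isFixed_replicate (Y := letterMat (M := m + 5) 1)).1 (this.congr fun l n _ hn => ?_)
        rw [List.length_eq_zero_iff.1 hn]
      refine NC.eq_zero_of_orthogonal (hH _ _ h1) (fun t ht => ?_) hx
      simpa using hcen t ht [] [] rfl rfl
    · simp only [List.concat_eq_append] at hL hS hξ hcen hprim hz hn hp
      obtain ⟨ω, ⟨f, hf, hωf⟩, hω⟩ := exists_probe (m := m) hL (Nat.le_add_left 1 c)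
      have hω := hω ξ hξ
      have hsum : ((L ++ [(ζ, d)]).map Prod.snd).sum = (L.map Prod.snd).sum + d := by simp
      set s := ((L ++ [(ζ, d)]).map Prod.snd).sum with hs
      set s' := (L.map Prod.snd).sum with hs'
      rw [legs_flat, ← hs] at hω
      -- The partial trace of `ξ ξ⋆` over the last block is an endomorphism of fewer blocks, with the
      -- first legs as a block of their own.
      let ρ : List (Fin (m + 5)) → List (Fin (m + 5)) → ℂ := fun l l' =>
        ∑ z ∈ words (Fin (m + 5)) d, ∑ n ∈ words (Fin (m + 5)) s,
          ξ (l ++ z) n * starRingEnd ℂ (ξ (l' ++ z) n)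
      have hbp : ∀ z n, z.length = d → n.length = s →
          IsBlockPrimitive ((c + 1) :: L.map Prod.snd) fun l => ξ (l ++ z) n := by
        intro z n hz hn
        refine ⟨fun r hr => ?_, fun x hx => ?_⟩
        · have := hp (r ++ z) n (by rw [hsum, List.length_append, hr, hz]) hn
          simpa using this
        · have := hprim x n hx hn
          rw [List.map_append] at this
          have := this.snoc hz
          simpa using this
      have hρ : ModelHom (m + 5) (flat ((-1, c + 1) :: L)) (flat ((-1, c + 1) :: L)) ρ := by
        intro P U
        have hPU := isUnitaryTest P U
        have h1 := hξ P U
        have hw : List.replicate (c + 1) none ++ flat (L ++ [(ζ, d)]) =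
            ((List.replicate (c + 1) none ++ flat L) ++ [some ζ]) ++ List.replicate d none := by
          simp [flat_append]
        have h2 := h1.comp (h1.adjoint hPU)
        rw [hw, legs_flat, ← hs] at h2
        have h3 := (h2.trace_replicate hPU.toMagic).strip_right ⟨_, hPU.Y_mul_star ζ⟩
        exact h3.add_left (-1)
      have hred : IsReduced ((-1, c + 1) :: L) := by
        intro b hb
        rcases List.mem_cons.1 hb with rfl | hb
        · refine ⟨fun h => ?_, by simp⟩
          have h1 : ((-1 : Circle) : ℂ) = ((1 : Circle) : ℂ) := congrArg _ h
          norm_num at h1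
        · exact hL b (by simp [hb])
      obtain ⟨k, hk⟩ := hS _ hred (by simp) ρ hρ (by
        intro l' hl'
        have := IsBlockPrimitive.linear (as := (c + 1) :: L.map Prod.snd)
          (words (Fin (m + 5)) d ×ˢ words (Fin (m + 5)) s)
          (fun q => starRingEnd ℂ (ξ (l' ++ q.1) q.2)) (f := fun q l => ξ (l ++ q.1) q.2)
          fun q hq => by
            rw [Finset.mem_product, mem_words, mem_words] at hq
            exact hbp _ _ hq.1 hq.2
        refine this.congr fun l _ => ?_
        rw [Finset.sum_product]
        simp only [ρ, mul_comm])
      simp only [List.map_cons, List.sum_cons, ← hs'] at hk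
      have hk0 : k = 0 := by
        have h1 : ∑ l ∈ words (Fin (m + 5)) (c + 1 + s'), ω l *
            ∑ l' ∈ words (Fin (m + 5)) (c + 1 + s'), ρ l l' * f l' = 0 := by
          simp only [ρ, Finset.mul_sum, Finset.sum_mul]
          rw [Finset.sum_comm]
          refine Finset.sum_eq_zero fun l' _ => ?_
          rw [Finset.sum_comm]
          refine Finset.sum_eq_zero fun z hz => ?_
          rw [Finset.sum_comm]
          refine Finset.sum_eq_zero fun n hn => ?_
          rw [mem_words] at hz hn
          have := hω z n hz hn
          calc _ = (∑ l ∈ words (Fin (m + 5)) (c + 1 + s'), ω l * ξ (l ++ z) n) *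
                (starRingEnd ℂ (ξ (l' ++ z) n) * f l') := by
                rw [Finset.sum_mul]
                exact Finset.sum_congr rfl fun l _ => by ring
            _ = 0 := by rw [this, zero_mul]
        rw [Finset.sum_congr rfl fun l hl => by rw [hk f hf l (by simpa using hl)]] at h1
        simp only [mul_left_comm _ k, ← Finset.mul_sum] at h1
        exact (mul_eq_zero.1 h1).resolve_right hωf
      obtain ⟨r, y, rfl, hr, hy⟩ : ∃ a b, z = a ++ b ∧ a.length = s' ∧ b.length = d :=
        ⟨z.take s', z.drop s', by simp, by simp; omega, by simp; omega⟩
      -- The vector `g = ξ (· ++ y) n` satisfies `ρ g = 0`, hence `⟪g, ρ g⟫ = 0` and `‖g‖ ^ 4 = 0`.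
      set g : List (Fin (m + 5)) → ℂ := fun l => ξ (l ++ y) n with hg
      have h3 := sum_conj_mul_eq_zero (words (Fin (m + 5)) (c + 1 + s'))
        (words (Fin (m + 5)) d ×ˢ words (Fin (m + 5)) s) (fun q l => ξ (l ++ q.1) q.2) g
        (fun l hl => by
          simp only [Finset.sum_product]
          exact (hk g (hbp y n hy hn) l (by simpa using hl)).trans (by rw [hk0, zero_mul]))
        (y, n) (by simp [hy, hn])
      have h4 := eq_zero_of_sum_mul_conj (f := g) (by simpa only [mul_comm] using h3)
        (l := x ++ r) (by simp [hx, hr])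
      simpa [hg] using h4

/-- Schur's lemma for the primitive vectors of reduced blocks. -/
theorem schurProperty (hH : ∀ k f, IsFlatFixed (m + 5) k f → f ∈ NC (Fin (m + 5)) k)
    {L : List (Circle × ℕ)} (hL : IsReduced L) : SchurProperty m L := by
  induction hlen : L.length generalizing L with
  | zero =>
    rw [List.length_eq_zero_iff] at hlen
    subst hlen
    intro T _ _
    refine ⟨T [] [], fun f _ l hl => ?_⟩
    rw [List.map_nil, List.sum_nil, List.length_eq_zero_iff] at hl
    simp [hl]
  | succ k ih =>
    obtain _ | ⟨⟨ζ, a⟩, L⟩ := L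
    · simp at hlen
    have hL' : IsReduced L := fun b hb => hL b (by simp [hb])
    have hlen' : L.length = k := by simpa using hlen
    have hE := eq_zero_of_centred hH hL'
      (fun L' h h' => ih h (h'.trans hlen')) (a + a)
    intro T hT hprim
    simp only [List.map_cons, List.sum_cons] at hprim ⊢
    set s := (L.map Prod.snd).sum with hs
    have hR := ncKer_spec (Fin (m + 5)) (a + a)
    set R := ncKer (Fin (m + 5)) (a + a)
    -- All legs of the first block are moved to one side.
    let ξ : List (Fin (m + 5)) → List (Fin (m + 5)) → ℂ := fun y n =>
      T (y.drop a) ((y.take a).reverse ++ n)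
    have hξ_apply : ∀ k' k r n : List (Fin (m + 5)), k'.length = a →
        ξ (k'.reverse ++ k ++ r) n = T (k ++ r) (k' ++ n) := by
      intro k' k r n hk'
      simp [ξ, ← hk']
    have hξ : ModelHom (m + 5) (flat L) (List.replicate (a + a) none ++ flat L) ξ := by
      intro P U
      have hPU := isUnitaryTest P U
      have h1 : Intertwines (fun i j => P.1 i j) (letterMat U) _ _ T :=
        (hT P U).strip_left ⟨_, hPU.star_mul_Y ζ⟩
      rw [List.replicate_add, List.append_assoc]
      refine h1.bend_in_replicate hPU.toMagic a fun k l n hk _ _ => ?_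
      simp [ξ, ← hk]
    have hξp : ∀ x n, x.length = a + a → n.length = s →
        IsBlockPrimitive (L.map Prod.snd) fun z => ξ (x ++ z) n := by
      intro x n hx hn
      obtain ⟨k', k, rfl, hk', hk⟩ : ∃ k' k, x = k'.reverse ++ k ∧ k'.length = a ∧ k.length = a :=
        ⟨(x.take a).reverse, x.drop a, by simp, by simp; omega, by simp; omega⟩
      refine ((hprim (k' ++ n) (by simp [hk', hn])).2 k hk).congr fun l _ => ?_
      exact hξ_apply k' k l n hk'
    have hξR : ∀ x z n, x.length = a + a → z.length = s → n.length = s →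
        ξ (x ++ z) n = ∑ y ∈ words (Fin (m + 5)) (a + a), R x y * ξ (y ++ z) n := by
      intro x z n hx hz hn
      let η : List (Fin (m + 5)) → List (Fin (m + 5)) → ℂ := fun l n =>
        ∑ y ∈ words (Fin (m + 5)) (a + a), R (l.take (a + a)) y * ξ (y ++ l.drop (a + a)) n
      have hη_apply : ∀ x z n, x.length = a + a → η (x ++ z) n =
          ∑ y ∈ words (Fin (m + 5)) (a + a), R x y * ξ (y ++ z) n := fun x z n hx => by
        simp only [η]
        rw [List.take_left' hx, List.drop_left' hx]
      have hη : ModelHom (m + 5) (flat L) (List.replicate (a + a) none ++ flat L) η :=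
        fun P U => (hξ P U).project (isUnitaryTest P U) hR fun x z n hx _ _ => hη_apply x z n hx
      have := hE (fun l n => ξ l n - 1 * η l n) ?_ ?_ ?_ x z n hx hz hn
      · rw [one_mul, sub_eq_zero] at this
        rw [this, hη_apply x z n hx]
      · intro P U
        refine ((hξ P U).add ((hη P U).smul (-1))).congr fun l n _ _ => ?_
        simp [sub_eq_add_neg]
      · intro t ht z n _ _
        simp only [one_mul, sub_mul, Finset.sum_sub_distrib]
        rw [sub_eq_zero, Finset.sum_congr (f := fun x => η (x ++ z) n * t x) rfl fun x hx => by
          rw [hη_apply x z n (by simpa using hx), Finset.sum_mul], Finset.sum_comm]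
        refine Finset.sum_congr rfl fun y hy => ?_
        rw [← hR.repr' ht (by simpa using hy), Finset.mul_sum]
        exact Finset.sum_congr rfl fun x _ => by ring
      · intro x n hx hn
        refine (hξp x n hx hn).sub ?_ 1
        have := IsBlockPrimitive.linear (as := L.map Prod.snd) (words (Fin (m + 5)) (a + a))
          (fun y => R x y) (f := fun y z => ξ (y ++ z) n) fun y hy => hξp y n (by simpa using hy) hn
        exact this.congr fun l _ => hη_apply x l n hx
    -- By induction, the slices of `ξ` act as scalars on the remaining blocks.
    have hμ : ∀ x : List (Fin (m + 5)), ∃ c : ℂ, x.length = a + a → ∀ f,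
        IsBlockPrimitive (L.map Prod.snd) f → ∀ r : List (Fin (m + 5)), r.length = s →
          ∑ n ∈ words (Fin (m + 5)) s, ξ (x ++ r) n * f n = c * f r := by
      intro x
      by_cases hx : x.length = a + a
      · obtain ⟨c, hc⟩ := ih hL' hlen' (fun r n => ξ (x ++ r) n)
          (fun P U => ((hξ P U).slice (isUnitaryTest P U) (hR.row_mem x)).congr fun r n hr hn => by
            rw [legs_flat] at hr hn
            exact hξR x r n hx hr hn)
          (fun n hn => hξp x n hx hn)
        exact ⟨c, fun _ => hc⟩
      · exact ⟨0, fun h => absurd h hx⟩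
    choose μ hμ using hμ
    have hμNC : μ ∈ NC (Fin (m + 5)) (a + a) := by
      obtain ⟨r, hr, hr0⟩ := exists_blockPrimitive_ne_zero (m := m) false (L.map Prod.snd)
      set f := blockAltVec (m := m) false (L.map Prod.snd) with hf
      have hfp : IsBlockPrimitive (L.map Prod.snd) f := isBlockPrimitive_blockAltVec _ _
      have h1 : (∑ y ∈ words (Fin (m + 5)) (a + a), ((f r)⁻¹ *
          ∑ n ∈ words (Fin (m + 5)) s, ξ (y ++ r) n * f n) • fun x => R x y) ∈
          NC (Fin (m + 5)) (a + a) :=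
        Submodule.sum_mem _ fun y _ => Submodule.smul_mem _ _ (hR.col_mem y)
      refine NC.congr h1 fun x hx => ?_
      have h2 := hμ x hx f hfp r hr
      rw [← div_eq_iff hr0] at h2
      rw [← h2, Finset.sum_apply, div_eq_inv_mul,
        Finset.sum_congr rfl fun n hn => by rw [hξR x r n hx hr (by simpa using hn), Finset.sum_mul],
        Finset.sum_comm, Finset.mul_sum]
      refine Finset.sum_congr rfl fun y _ => ?_
      rw [Pi.smul_apply, smul_eq_mul, mul_assoc, Finset.sum_mul]
      congr 1
      exact Finset.sum_congr rfl fun n _ => by ring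
    obtain ⟨c, hc⟩ := exists_scalar_of_mem_NC hμNC
    refine ⟨c, fun f hf => ?_⟩
    -- The difference of `T f` and `c • f` is primitive and orthogonal to all primitive vectors.
    set h : List (Fin (m + 5)) → ℂ := fun l =>
      (∑ n ∈ words (Fin (m + 5)) (a + s), T l n * f n) - c * f l with hh
    have hTf : ∀ k r : List (Fin (m + 5)), k.length = a → r.length = s →
        ∑ n ∈ words (Fin (m + 5)) (a + s), T (k ++ r) n * f n =
          ∑ k' ∈ words (Fin (m + 5)) a, μ (k'.reverse ++ k) * f (k' ++ r) := by
      intro k r hk hr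
      rw [sum_words_append]
      refine Finset.sum_congr rfl fun k' hk' => ?_
      rw [mem_words] at hk'
      rw [← hμ (k'.reverse ++ k) (by simp [hk', hk]) (fun r => f (k' ++ r)) (hf.2 k' hk') r hr]
      exact Finset.sum_congr rfl fun n _ => by rw [hξ_apply k' k r n hk']
    have hhp : IsBlockPrimitive (a :: L.map Prod.snd) h := by
      refine IsBlockPrimitive.sub ?_ hf c
      have := IsBlockPrimitive.linear (as := a :: L.map Prod.snd) (words (Fin (m + 5)) (a + s))
        (fun n => f n) (f := fun n l => T l n) fun n hn => hprim n (by simpa using hn)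
      exact this.congr fun l _ => Finset.sum_congr rfl fun n _ => mul_comm _ _
    have hort : ∀ g, IsBlockPrimitive (a :: L.map Prod.snd) g →
        ∑ l ∈ words (Fin (m + 5)) (a + s), h l * g l = 0 := by
      intro g hg
      rw [sum_words_append, Finset.sum_comm]
      refine Finset.sum_eq_zero fun r hr => ?_
      rw [mem_words] at hr
      have h1 := hc _ _ (hf.1 r hr) (hg.1 r hr)
      simp only [hh, sub_mul, Finset.sum_sub_distrib]
      rw [sub_eq_zero]
      refine Eq.trans ?_ (h1.trans ?_)
      · rw [Finset.sum_comm]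
        refine Finset.sum_congr rfl fun k hk => ?_
        rw [mem_words] at hk
        rw [hTf k r hk hr, Finset.sum_mul]
        exact Finset.sum_congr rfl fun k' _ => by ring
      · rw [Finset.mul_sum]
        exact Finset.sum_congr rfl fun k _ => by ring
    intro l hl
    exact sub_eq_zero.1 (eq_zero_of_sum_mul_conj (hort _ hhp.conj) hl)

end Irreducible

/-! ### Fixed vectors of words with scalar letters -/

section OrthogonalDecomposition

variable {ι : Type*} [Fintype ι]

theorem exists_orthogonal_decomposition (V : Submodule ℂ (List ι → ℂ)) (k : ℕ) (f : List ι → ℂ) :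
    ∃ g ∈ V, ∀ t ∈ V, ∑ l ∈ words ι k, (f l - g l) * starRingEnd ℂ (t l) = 0 := by
  let r : (List ι → ℂ) →ₗ[ℂ] EuclideanSpace ℂ (words ι k) :=
    { toFun := fun f => WithLp.toLp 2 fun l => f l
      map_add' := fun _ _ => rfl
      map_smul' := fun _ _ => rfl }
  obtain ⟨g, hg, hgf⟩ := ((V.map r).starProjection_apply_mem (r f))
  refine ⟨g, hg, fun t ht => ?_⟩
  have h1 : inner ℂ (r t) (r f - (V.map r).starProjection (r f)) = 0 :=
    (V.map r).sub_starProjection_mem_orthogonal (r f) (r t) (Submodule.mem_map_of_mem ht)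
  rw [← hgf, PiLp.inner_apply] at h1
  rw [← Finset.sum_coe_sort, ← h1]
  rfl

end OrthogonalDecomposition

section Words

variable {ι Z : Type*} [Fintype ι]

/-- All leg sums of `f` vanish, as well as all merges of two legs which are adjacent in the
word `w`. -/
structure IsWordPrimitive (w : List (Option Z)) (f : List ι → ℂ) : Prop where
  sum_eq_zero : ∀ u v, w = u ++ none :: v → ∀ l r : List ι, l.length = legs u →
    r.length = legs v → ∑ j, f (l ++ j :: r) = 0
  merge_eq_zero : ∀ u v, w = u ++ none :: none :: v → ∀ (l : List ι) (j : ι) (r : List ι),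
    l.length = legs u → r.length = legs v → f (l ++ j :: j :: r) = 0

theorem IsWordPrimitive.cons_some {w : List (Option Z)} {f : List ι → ℂ}
    (h : IsWordPrimitive w f) (z : Z) : IsWordPrimitive (some z :: w) f where
  sum_eq_zero u v e l r hl hr := by
    obtain _ | ⟨a, u⟩ := u
    · simp at e
    · obtain ⟨rfl, rfl⟩ := List.cons.inj e
      exact h.sum_eq_zero u v rfl l r hl hr
  merge_eq_zero u v e l j r hl hr := by
    obtain _ | ⟨a, u⟩ := u
    · simp at e
    · obtain ⟨rfl, rfl⟩ := List.cons.inj e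
      exact h.merge_eq_zero u v rfl l j r hl hr

/-- The two notions of primitivity agree on blocks. -/
theorem IsWordPrimitive.isBlockPrimitive {L : List (Circle × ℕ)} {u t : List (Option Circle)}
    (ht : legs t = 0) {f : List ι → ℂ} (h : IsWordPrimitive (u ++ (flat L ++ t)) f) {l : List ι}
    (hl : l.length = legs u) : IsBlockPrimitive (L.map Prod.snd) fun r => f (l ++ r) := by
  induction L generalizing u l with
  | nil => trivial
  | cons b L ih =>
    obtain ⟨ζ, a⟩ := b
    refine ⟨fun r hr => ⟨fun x y hxy => ?_, fun x j y hxy => ?_⟩, fun x hx => ?_⟩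
    · have := h.sum_eq_zero (u ++ some ζ :: List.replicate x.length none)
        (List.replicate y.length none ++ (flat L ++ t)) (by
          simp only at hxy
          rw [flat_cons, ← hxy, add_assoc, List.replicate_add, List.replicate_succ]
          simp) (l ++ x) (y ++ r) (by simp [hl]) (by simp [hr, ht])
      simpa using this
    · have := h.merge_eq_zero (u ++ some ζ :: List.replicate x.length none)
        (List.replicate y.length none ++ (flat L ++ t)) (by
          simp only at hxy
          rw [flat_cons, ← hxy, add_assoc, List.replicate_add, List.replicate_succ,
            List.replicate_succ]
          simp) (l ++ x) j (y ++ r) (by simp [hl]) (by simp [hr, ht])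
      simpa using this
    · have := ih (u := u ++ some ζ :: List.replicate a none) (l := l ++ x)
        (by simpa using h) (by simp [hl, hx])
      simpa using this

/-- A word can be shortened at a letter `1` or at two adjacent letters, or else it consists of some
legs, followed by reduced blocks and at most one letter. -/
theorem exists_normal_form (w : List (Option Circle)) :
    (∃ u v, w = u ++ some 1 :: v) ∨ (∃ u v ζ ζ', w = u ++ some ζ :: some ζ' :: v) ∨
      ∃ a L t, IsReduced L ∧ (t = [] ∨ ∃ ζ, t = [some ζ]) ∧
        w = List.replicate a none ++ (flat L ++ t) := by
  induction w with
  | nil => exact .inr (.inr ⟨0, [], [], by simp [IsReduced], .inl rfl, rfl⟩)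
  | cons x w ih =>
    rcases ih with ⟨u, v, rfl⟩ | ⟨u, v, ζ, ζ', rfl⟩ | ⟨a, L, t, hL, ht, rfl⟩
    · exact .inl ⟨x :: u, v, rfl⟩
    · exact .inr (.inl ⟨x :: u, v, ζ, ζ', rfl⟩)
    · cases x with
      | none => exact .inr (.inr ⟨a + 1, L, t, hL, ht, rfl⟩)
      | some ζ =>
        by_cases hζ : ζ = 1
        · subst hζ
          exact .inl ⟨[], _, rfl⟩
        rcases Nat.eq_zero_or_pos a with rfl | ha
        · obtain _ | ⟨⟨ζ', b⟩, L⟩ := L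
          · rcases ht with rfl | ⟨ζ', rfl⟩
            · exact .inr (.inr ⟨0, [], [some ζ], by simp [IsReduced], .inr ⟨_, rfl⟩, rfl⟩)
            · exact .inr (.inl ⟨[], [], ζ, ζ', rfl⟩)
          · exact .inr (.inl ⟨[], _, ζ, ζ', rfl⟩)
        · refine .inr (.inr ⟨0, (ζ, a) :: L, t, ?_, ht, by simp⟩)
          intro b hb
          rcases List.mem_cons.1 hb with rfl | hb
          · exact ⟨hζ, ha⟩
          · exact hL b hb

end Words

section ModelFixed

variable {m : ℕ}

variable (m) in
/-- The vector `f` is fixed by the word `w` for all points of the flat model and all unitary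
matrices. -/
def IsModelFixed (w : List (Option Circle)) (f : List (Fin (m + 5)) → ℂ) : Prop :=
  ModelHom (m + 5) [] w fun l _ => f l

/-- A fixed vector of reduced blocks that is primitive vanishes: by Schur's lemma its projection
would be a scalar, but the space of primitive vectors has dimension at least two. -/
theorem eq_zero_of_isBlockPrimitive (hH : ∀ k f, IsFlatFixed (m + 5) k f → f ∈ NC (Fin (m + 5)) k)
    {L : List (Circle × ℕ)} (hL : IsReduced L) (hL0 : L ≠ []) {f : List (Fin (m + 5)) → ℂ}
    (hf : IsBlockPrimitive (L.map Prod.snd) f)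
    (hT : ModelHom (m + 5) (flat L) (flat L) fun l n => f l * starRingEnd ℂ (f n))
    {l : List (Fin (m + 5))} (hl : l.length = (L.map Prod.snd).sum) : f l = 0 := by
  obtain ⟨c, hc⟩ := schurProperty hH hL _ hT fun n _ => by
    have := IsBlockPrimitive.linear (Finset.univ : Finset Unit) (fun _ => starRingEnd ℂ (f n))
      (fun _ _ => hf)
    exact this.congr fun l _ => by simp [mul_comm]
  have hc' : ∀ h, IsBlockPrimitive (L.map Prod.snd) h → ∃ d, ∀ l : List (Fin (m + 5)),
      l.length = (L.map Prod.snd).sum → f l * d = c * h l := by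
    intro h hh
    refine ⟨∑ n ∈ words (Fin (m + 5)) (L.map Prod.snd).sum, starRingEnd ℂ (f n) * h n,
      fun l hl => ?_⟩
    rw [← hc h hh l hl, Finset.mul_sum]
    exact Finset.sum_congr rfl fun n _ => by ring
  have hc0 : c = 0 := by
    by_contra hc0
    -- Otherwise two nonzero primitive vectors with disjoint supports are both multiples of `f`.
    obtain ⟨l1, hl1, h1⟩ := exists_blockPrimitive_ne_zero (m := m) false (L.map Prod.snd)
    obtain ⟨l2, hl2, h2⟩ := exists_blockPrimitive_ne_zero (m := m) true (L.map Prod.snd)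
    obtain ⟨d1, hd1⟩ := hc' _ (isBlockPrimitive_blockAltVec (m := m) false (L.map Prod.snd))
    obtain ⟨d2, hd2⟩ := hc' _ (isBlockPrimitive_blockAltVec (m := m) true (L.map Prod.snd))
    have h3 : f l1 ≠ 0 := by
      intro h
      have := hd1 l1 hl1
      rw [h, zero_mul] at this
      exact mul_ne_zero hc0 h1 this.symm
    have h4 : d2 = 0 := by
      have h5 := hd2 l1 hl1
      have h6 : blockAltVec (m := m) true (L.map Prod.snd) l1 = 0 := by
        obtain _ | ⟨⟨ζ, a⟩, L⟩ := L
        · exact absurd rfl hL0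
        have ha : 1 ≤ a := (hL (ζ, a) (by simp)).2
        obtain _ | ⟨i, l1⟩ := l1
        · simp at hl1; omega
        obtain ⟨a, rfl⟩ := Nat.exists_eq_add_of_le' ha
        simp only [List.map_cons, blockAltVec, List.take_succ_cons, altVec] at h1 ⊢
        have := diffVec_mul_not false i
        rw [Bool.not_false] at this
        rw [(mul_eq_zero.1 this).resolve_left fun h => h1 (by simp [h])]
        simp
      rw [h6, mul_zero] at h5
      exact (mul_eq_zero.1 h5).resolve_left h3
    have h5 := hd2 l2 hl2
    rw [h4, mul_zero] at h5
    exact mul_ne_zero hc0 h2 h5.symm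
  have h1 := hc f hf l hl
  rw [hc0, zero_mul] at h1
  simp only [mul_assoc, ← Finset.mul_sum] at h1
  exact (mul_eq_zero.1 h1).elim id fun h2 =>
    eq_zero_of_sum_mul_conj (by simpa only [mul_comm] using h2) hl

/-- If the fixed vectors of the flat model are noncrossing, so are those of all words with scalar
letters. -/
theorem mem_NC_of_isModelFixed (hH : ∀ k f, IsFlatFixed (m + 5) k f → f ∈ NC (Fin (m + 5)) k)
    {w : List (Option Circle)} {f : List (Fin (m + 5)) → ℂ} (hf : IsModelFixed m w f) :
    f ∈ NC (Fin (m + 5)) (legs w) := by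
  induction hn : w.length using Nat.strong_induction_on generalizing w f with
  | _ n ih =>
  subst hn
  rcases exists_normal_form w with ⟨u, v, rfl⟩ | ⟨u, v, ζ, ζ', rfl⟩ | ⟨a, L, t, hL, ht, hw⟩
  · have h1 := ih (u ++ v).length (by simp) (w := u ++ v) (f := f) (fun P U => ?_) rfl
    · simpa using h1
    · refine isFixed_iff.2 fun l hl => ?_
      have h2 := isFixed_iff.1 (hf P U) l (by simpa using hl)
      rw [← h2]
      simp only [legs_append, legs_some]
      refine Finset.sum_congr rfl fun x hx => ?_
      obtain ⟨x1, x2, rfl, hx1⟩ : ∃ a b, x = a ++ b ∧ a.length = legs u :=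
        ⟨x.take (legs u), x.drop (legs u), by simp, by simp at hx ⊢; omega⟩
      obtain ⟨l1, l2, rfl, hl1⟩ : ∃ a b, l = a ++ b ∧ a.length = legs u :=
        ⟨l.take (legs u), l.drop (legs u), by simp, by simp at hl ⊢; omega⟩
      rw [wordMat_append _ _ hl1 hx1, wordMat_append _ _ hl1 hx1, wordMat_some, letterMat_one,
        one_mul]
  · have h1 := ih (u ++ some (ζ * ζ') :: v).length (by simp) (w := u ++ some (ζ * ζ') :: v) (f := f)
      (fun P U => ?_) rfl
    · simpa using h1
    · refine isFixed_iff.2 fun l hl => ?_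
      have h2 := isFixed_iff.1 (hf P U) l (by simpa using hl)
      rw [← h2]
      simp only [legs_append, legs_some]
      refine Finset.sum_congr rfl fun x hx => ?_
      obtain ⟨x1, x2, rfl, hx1⟩ : ∃ a b, x = a ++ b ∧ a.length = legs u :=
        ⟨x.take (legs u), x.drop (legs u), by simp, by simp at hx ⊢; omega⟩
      obtain ⟨l1, l2, rfl, hl1⟩ : ∃ a b, l = a ++ b ∧ a.length = legs u :=
        ⟨l.take (legs u), l.drop (legs u), by simp, by simp at hl ⊢; omega⟩
      rw [wordMat_append _ _ hl1 hx1, wordMat_append _ _ hl1 hx1, wordMat_some, wordMat_some,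
        wordMat_some, ← letterMat_mul, mul_assoc]
  · -- The part of `f` orthogonal to the noncrossing fixed vectors of `w`.
    let V : Submodule ℂ (List (Fin (m + 5)) → ℂ) :=
      { carrier := {t | t ∈ NC (Fin (m + 5)) (legs w) ∧ IsModelFixed m w t}
        zero_mem' := ⟨zero_mem _, fun P U => Intertwines.zero _ _⟩
        add_mem' := fun h h' => ⟨add_mem h.1 h'.1, fun P U => (h.2 P U).add (h'.2 P U)⟩
        smul_mem' := fun c _ h => ⟨Submodule.smul_mem _ c h.1, fun P U => (h.2 P U).smul c⟩ }
    obtain ⟨g, hg, hfg⟩ := exists_orthogonal_decomposition V (legs w) f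
    set h : List (Fin (m + 5)) → ℂ := fun l => f l - g l with hh
    have hfix : IsModelFixed m w h := fun P U =>
      ((hf P U).add ((hg.2 P U).smul (-1))).congr fun l n _ _ => by simp [hh, sub_eq_add_neg]
    have hwp : IsWordPrimitive w h := by
      constructor
      · intro u v e l r hl hr
        have hlt : (u ++ v).length < w.length := by simp [e]
        let s : List (Fin (m + 5)) → ℂ := fun y =>
          ∑ j, h (y.take (legs u) ++ j :: y.drop (legs u))
        have hs : IsModelFixed m (u ++ v) s := fun P U => by
          have h1 := hfix P U
          rw [e] at h1
          exact h1.sum P.magic fun l r _ hl _ _ => by simp [s, ← hl]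
        have hsNC := ih _ hlt hs rfl
        have hins : Ins (legs u) s ∈ V := by
          refine ⟨?_, fun P U => ?_⟩
          · have := NC.ins (legs u) (by simp) hsNC
            rwa [show legs w = legs (u ++ v) + 1 by simp [e]; ring]
          · rw [e]
            exact (hs P U).ins P.magic fun l i r _ hl _ _ => Ins_append hl _ _ _
        have h1 := hfg _ hins
        have h2 : ∑ x ∈ words (Fin (m + 5)) (legs u + legs v), s x * starRingEnd ℂ (s x) = 0 := by
          rw [← h1, e, sum_words_legs, sum_words_append]
          refine Finset.sum_congr rfl fun x hx => Finset.sum_congr rfl fun y _ => ?_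
          rw [mem_words] at hx
          simp only [Ins_append hx, ← Finset.sum_mul]
          congr 1
          simp [s, hh, ← hx]
        have h3 := eq_zero_of_sum_mul_conj h2 (l := l ++ r) (by simp [hl, hr])
        simpa [s, ← hl] using h3
      · intro u v e l j r hl hr
        have hlt : (u ++ none :: v).length < w.length := by simp [e]
        let s : List (Fin (m + 5)) → ℂ := fun y =>
          h (y.take (legs u + 1) ++ y.drop (legs u))
        have hs_apply : ∀ (l : List (Fin (m + 5))) j r, l.length = legs u →
            s (l ++ j :: r) = h (l ++ j :: j :: r) := fun l j r hl => by
          simp [s, ← hl, List.take_append, List.take_of_length_le (Nat.le_succ l.length)]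
        have hs : IsModelFixed m (u ++ none :: v) s := fun P U => by
          have h1 := hfix P U
          rw [e] at h1
          exact h1.merge P.magic fun l j r _ hl _ _ => hs_apply l j r hl
        have hsNC := ih _ hlt hs rfl
        have hdup : Dup (legs u) s ∈ V := by
          refine ⟨?_, fun P U => ?_⟩
          · have := NC.dup (legs u) (by simp) hsNC
            rwa [show legs w = legs (u ++ none :: v) + 1 by simp [e]; ring]
          · rw [e]
            exact (hs P U).dup P.magic fun l i j r _ hl _ _ => Dup_append hl _ _ _ _
        have h1 := hfg _ hdup
        have h2 : ∑ x ∈ words (Fin (m + 5)) (legs u + 1 + legs v), s x * starRingEnd ℂ (s x) = 0 := by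
          rw [← h1, show legs w = legs u + 1 + (legs v + 1) by simp [e]; ring, sum_words_insert,
            sum_words_insert]
          refine Finset.sum_congr rfl fun x hx => ?_
          rw [mem_words] at hx
          rw [sum_words_succ, Finset.sum_comm (s := Finset.univ)]
          refine Finset.sum_congr rfl fun y _ => Finset.sum_congr rfl fun j _ => ?_
          rw [Finset.sum_eq_single j]
          · rw [hs_apply x j y hx, Dup_append hx, if_pos rfl, hs_apply x j y hx]
          · intro i _ hij
            rw [Dup_append hx, if_neg hij, map_zero, mul_zero]
          · simp
        have h3 := eq_zero_of_sum_mul_conj h2 (l := l ++ j :: r) (by simp [hl, hr]; ring)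
        rwa [hs_apply l j r hl] at h3
    have ht0 : legs t = 0 := by rcases ht with rfl | ⟨ζ, rfl⟩ <;> rfl
    rcases Nat.eq_zero_or_pos (legs w) with h0 | h0
    · rw [h0]; exact NC.of_zero f
    suffices H : ∀ l : List (Fin (m + 5)), l.length = legs w → h l = 0 from
      NC.congr hg.1 fun l hl => sub_eq_zero.1 (H l hl)
    have hT : ModelHom (m + 5) w w fun l n => h l * starRingEnd ℂ (h n) := fun P U =>
      ((hfix P U).comp ((hfix P U).adjoint (isUnitaryTest P U))).congr fun l n _ _ => by
        rw [legs_nil, sum_words_zero]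
    -- Legs in front of the first letter form a block after a letter `-1` is added.
    obtain ⟨L1, hL1, hL0, hlegs, hwp1, hT1⟩ : ∃ L1, IsReduced L1 ∧ L1 ≠ [] ∧
        legs w = (L1.map Prod.snd).sum ∧ IsWordPrimitive (flat L1 ++ t) h ∧
        ModelHom (m + 5) (flat L1 ++ t) (flat L1 ++ t) fun l n => h l * starRingEnd ℂ (h n) := by
      rcases Nat.eq_zero_or_pos a with rfl | ha
      · rw [List.replicate_zero, List.nil_append] at hw
        refine ⟨L, hL, ?_, by simp [hw, ht0], hw ▸ hwp, hw ▸ hT⟩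
        rintro rfl
        simp [hw, ht0] at h0
      · have hw1 : flat ((-1, a) :: L) ++ t = some (-1) :: w := by simp [hw]
        refine ⟨(-1, a) :: L, ?_, by simp, by simp [hw, ht0], ?_, ?_⟩
        · intro b hb
          rcases List.mem_cons.1 hb with rfl | hb
          · refine ⟨fun h => ?_, ha⟩
            have h1 : ((-1 : Circle) : ℂ) = ((1 : Circle) : ℂ) := congrArg _ h
            norm_num at h1
          · exact hL b hb
        · rw [hw1]; exact hwp.cons_some _
        · rw [hw1]; exact fun P U => (hT P U).add_left (-1)
    intro l hl
    refine eq_zero_of_isBlockPrimitive hH hL1 hL0 ?_ (fun P U => ?_) (hl.trans hlegs)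
    · exact IsWordPrimitive.isBlockPrimitive (u := []) (l := []) ht0 hwp1 rfl
    · rcases ht with rfl | ⟨ζ, rfl⟩
      · simpa using hT1 P U
      · exact (hT1 P U).strip_right ⟨_, (isUnitaryTest P U).Y_mul_star ζ⟩

end ModelFixed

/-! ### Points of the flat model over an arbitrary index type -/

section Transport

theorem wordMat_map_index {ι κ Z B : Type*} [Semiring B] (p : κ → κ → B) (Y : Z → B) (g : ι → κ)
    (w : List (Option Z)) (l m : List ι) :
    wordMat p Y w (l.map g) (m.map g) = wordMat (fun i j => p (g i) (g j)) Y w l m := by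
  induction w generalizing l m with
  | nil => cases l <;> cases m <;> simp [wordMat]
  | cons a w ih =>
    cases a with
    | none => cases l <;> cases m <;> simp [wordMat, ih]
    | some z => simp [ih]

theorem sum_words_map {ι κ B : Type*} [Fintype ι] [Fintype κ] [AddCommMonoid B] (e : ι ≃ κ) (k : ℕ)
    (F : List κ → B) : ∑ x ∈ words κ k, F x = ∑ x ∈ words ι k, F (x.map e) :=
  Finset.sum_nbij' (fun x => x.map e.symm) (fun x => x.map e) (by simp) (by simp) (by simp)
    (by simp) (by simp)

/-- A magic unitary of rank-one projections, with arbitrary indices. -/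
structure IsFlatPoint {ι : Type*} [Fintype ι] [DecidableEq ι] (P : ι → ι → Matrix ι ι ℂ) :
    Prop where
  proj : ∀ i j, IsStarProjection (P i j)
  rank : ∀ i j, (P i j).rank = 1
  row_sum : ∀ i, ∑ j, P i j = 1
  col_sum : ∀ j, ∑ i, P i j = 1

/-- Vectors fixed by the flat model are fixed by all magic unitaries of rank-one projections, also
over other index types. -/
theorem IsFlatFixed.isFixedPow {ι : Type*} [Fintype ι] [DecidableEq ι] {N k : ℕ} (e : ι ≃ Fin N)
    {P : ι → ι → Matrix ι ι ℂ} (hP : IsFlatPoint P) {f : List (Fin N) → ℂ}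
    (hf : IsFlatFixed N k f) : IsFixedPow P k fun a => f (a.map e) := by
  set φ := Matrix.reindexAlgEquiv ℂ ℂ e with hφ
  have hφstar : ∀ A, star (φ A) = φ (star A) := fun A => by
    ext i j; simp [hφ, Matrix.star_apply]
  have hφ1 : ∀ F : ι → Matrix ι ι ℂ, ∑ i, F i = 1 → ∑ j : Fin N, φ (F (e.symm j)) = 1 := by
    intro F h
    rw [e.symm.sum_comp fun i => φ (F i), ← map_sum, h, map_one]
  have h := hf ⟨Matrix.of fun i j => φ (P (e.symm i) (e.symm j)),
    fun i j => ⟨⟨by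
      change φ _ * φ _ = φ _
      rw [← map_mul, (hP.proj _ _).isIdempotentElem.eq], by
      change star (φ _) = φ _
      rw [hφstar, (hP.proj _ _).isSelfAdjoint.star_eq]⟩, by
      change (φ _).rank = 1
      rw [hφ, Matrix.coe_reindexAlgEquiv, Matrix.rank_reindex, hP.rank]⟩,
    fun i => hφ1 _ (hP.row_sum _), fun j => hφ1 (fun i => P i (e.symm j)) (hP.col_sum _)⟩
  refine isFixedPow_iff.2 fun a ha => φ.injective ?_
  have h1 := isFixedPow_iff.1 h (a.map e) (by simpa using ha)
  rw [map_smul, map_one, ← h1, map_sum, sum_words_map e]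
  refine Finset.sum_congr rfl fun x _ => ?_
  rw [map_smul]
  congr 1
  have h2 := map_wordMat P (Empty.elim : Empty → _) (φ : Matrix ι ι ℂ →+* Matrix (Fin N) (Fin N) ℂ)
    (List.replicate k none) a x
  have h3 := wordMat_map_index (fun i j => φ (P (e.symm i) (e.symm j))) (Empty.elim : Empty → _) e
    (List.replicate k none) a x
  simp only [Equiv.symm_apply_apply] at h3
  refine h2.trans (Eq.trans ?_ h3.symm)
  rw [wordMat_replicate, wordMat_replicate]
  rfl

/-- Vectors fixed by the flat model are invariant under permutations of the indices. -/
theorem IsFlatFixed.map_perm {N k : ℕ} {f : List (Fin N) → ℂ} (hf : IsFlatFixed N k f)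
    (σ : Equiv.Perm (Fin N)) {l : List (Fin N)} (hl : l.length = k) : f (l.map σ) = f l := by
  obtain _ | ⟨i0, l0⟩ := l
  · rfl
  set l := i0 :: l0
  have : NeZero N := ⟨by rintro rfl; exact i0.elim0⟩
  subst hl
  have h := isFixedPow_iff.1 (hf (latinPoint (fun i j => j - σ i)
    (fun i => (Equiv.subRight (σ i)).bijective)
    fun j => ((Equiv.subLeft j).bijective).comp σ.bijective)) l rfl
  have h0 := (sum_wordMat_latinPoint _ _ _ (d := fun i k => k + σ i)
    (fun i j k => sub_eq_iff_eq_add) f l).symm.trans h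
  have h1 := congrFun (congrFun h0 0) 0
  simpa using h1

end Transport

/-! ### Edge colourings of regular relations -/

section Colouring

/-- A relation all of whose rows and columns have `n` elements is a union of `n` permutations, by
Hall's marriage theorem. -/
theorem exists_colouring {α : Type*} [Fintype α] [DecidableEq α] (n : ℕ) (R : α → α → Prop)
    [DecidableRel R] (hr : ∀ a, (Finset.univ.filter fun b => R a b).card = n)
    (hc : ∀ b, (Finset.univ.filter fun a => R a b).card = n) :
    ∃ c : α → α → ℕ, (∀ a b, R a b → c a b < n) ∧
      (∀ a, ∀ k < n, ∃! b, R a b ∧ c a b = k) ∧ ∀ b, ∀ k < n, ∃! a, R a b ∧ c a b = k := by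
  induction n generalizing R with
  | zero =>
    refine ⟨fun _ _ => 0, fun a b h => ?_, fun _ k hk => absurd hk (by simp),
      fun _ k hk => absurd hk (by simp)⟩
    have := Finset.card_eq_zero.1 (hr a)
    exact absurd (Finset.mem_filter.2 ⟨Finset.mem_univ b, h⟩) (by simp [this])
  | succ n ih =>
    obtain ⟨σ, hσ, hσR⟩ := (Fintype.all_card_le_filter_rel_iff_exists_injective R).1 fun A => by
      refine Nat.le_of_mul_le_mul_right (Finset.card_mul_le_card_mul R (m := n + 1) (n := n + 1)
        (fun a ha => ?_) fun b _ => ?_) n.succ_pos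
      · rw [← hr a]
        refine Finset.card_le_card fun b hb => ?_
        have hb' : R a b := by simpa using hb
        simpa [Finset.mem_bipartiteAbove] using ⟨⟨a, ha, hb'⟩, hb'⟩
      · rw [← hc b]
        exact Finset.card_le_card fun a ha => by
          simpa using ((Finset.mem_bipartiteBelow R).1 ha).2
    have hσb : Function.Bijective σ := Finite.injective_iff_bijective.1 hσ
    obtain ⟨c, hlt, hcr, hcc⟩ := ih (fun a b => R a b ∧ b ≠ σ a)
      (fun a => by
        have : (Finset.univ.filter fun b => R a b ∧ b ≠ σ a) =
            (Finset.univ.filter fun b => R a b).erase (σ a) := by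
          ext b; simp [and_comm]
        rw [this, Finset.card_erase_of_mem (by simpa using hσR a), hr a, Nat.add_sub_cancel])
      (fun b => by
        obtain ⟨a0, rfl⟩ := hσb.2 b
        have : (Finset.univ.filter fun a => R a (σ a0) ∧ σ a0 ≠ σ a) =
            (Finset.univ.filter fun a => R a (σ a0)).erase a0 := by
          ext a; simp [and_comm, hσ.eq_iff, eq_comm]
        rw [this, Finset.card_erase_of_mem (by simpa using hσR a0), hc, Nat.add_sub_cancel])
    have key : ∀ a b k, k < n →
        ((R a b ∧ (if b = σ a then n else c a b) = k) ↔ (R a b ∧ b ≠ σ a) ∧ c a b = k) := by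
      intro a b k hk
      by_cases h : b = σ a
      · simp [h]; intro _; omega
      · simp [h]
    have key' : ∀ a b, ((R a b ∧ (if b = σ a then n else c a b) = n) ↔ b = σ a) := by
      intro a b
      by_cases h : b = σ a
      · subst h; simp [hσR]
      · simp only [h, if_false, iff_false, not_and]
        intro hR
        have := hlt a b ⟨hR, h⟩
        omega
    refine ⟨fun a b => if b = σ a then n else c a b, fun a b h => ?_, fun a k hk => ?_,
      fun b k hk => ?_⟩
    · by_cases hb : b = σ a
      · simp [hb]
      · have := hlt a b ⟨h, hb⟩
        simp [hb]; omega
    · rcases Nat.lt_succ_iff_lt_or_eq.1 hk with hk | rfl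
      · simpa only [key _ _ _ hk] using hcr a k hk
      · simp only [key']
        exact ⟨σ a, rfl, fun _ h => h⟩
    · rcases Nat.lt_succ_iff_lt_or_eq.1 hk with hk | rfl
      · simpa only [key _ _ _ hk] using hcc b k hk
      · simp only [key']
        obtain ⟨a, rfl⟩ := hσb.2 b
        exact ⟨a, rfl, fun a' h => (hσ h).symm⟩

end Colouring

/-! ### Extension of points of the flat model -/

section Extension

variable {M n : ℕ}

/-- The projection `U e_k U⋆` onto the line spanned by the column `k` of `U`. -/
def specProj (U : Matrix.unitaryGroup (Fin M) ℂ) (k : Fin M) : Matrix (Fin M) (Fin M) ℂ :=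
  U.1 * Matrix.diagonal (Pi.single k 1) * star U.1

theorem isStarProjection_specProj (U : Matrix.unitaryGroup (Fin M) ℂ) (k : Fin M) :
    IsStarProjection (specProj U k) where
  isIdempotentElem := by
    have h : star U.1 * U.1 = 1 := Unitary.coe_star_mul_self U
    rw [IsIdempotentElem, specProj]
    calc _ = U.1 * Matrix.diagonal (Pi.single k 1) * (star U.1 * U.1) *
          (Matrix.diagonal (Pi.single k 1) * star U.1) := by noncomm_ring
      _ = _ := by
        rw [h, mul_one, ← mul_assoc, mul_assoc U.1, Matrix.diagonal_mul_diagonal]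
        congr 3
        funext i
        by_cases h : i = k <;> simp [h]
  isSelfAdjoint := by
    rw [IsSelfAdjoint, specProj, star_mul, star_mul, star_star, mul_assoc]
    congr 2
    rw [Matrix.star_eq_conjTranspose, Matrix.diagonal_conjTranspose]
    congr 1
    funext i
    by_cases h : i = k <;> simp [h]

theorem rank_specProj (U : Matrix.unitaryGroup (Fin M) ℂ) (k : Fin M) :
    (specProj U k).rank = 1 := by
  have h : star U.1 * U.1 = 1 := Unitary.coe_star_mul_self U
  have h1 : (Matrix.diagonal (Pi.single k (1 : ℂ)) : Matrix (Fin M) (Fin M) ℂ).rank = 1 := by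
    rw [Matrix.rank_diagonal]; simp [Pi.single_apply]
  refine le_antisymm ?_ ?_
  · rw [← h1]
    exact (Matrix.rank_mul_le_left _ _).trans (Matrix.rank_mul_le_right _ _)
  · have h2 : (Matrix.diagonal (Pi.single k (1 : ℂ)) : Matrix (Fin M) (Fin M) ℂ) =
        star U.1 * specProj U k * U.1 := by
      rw [specProj]
      calc _ = (star U.1 * U.1) * Matrix.diagonal (Pi.single k 1) * (star U.1 * U.1) := by
            rw [h, one_mul, mul_one]
        _ = _ := by noncomm_ring
    rw [← h1, h2]
    exact (Matrix.rank_mul_le_left _ _).trans (Matrix.rank_mul_le_right _ _)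

theorem sum_specProj (U : Matrix.unitaryGroup (Fin M) ℂ) : ∑ k, specProj U k = 1 := by
  have h : U.1 * star U.1 = 1 := Unitary.coe_mul_star_self U
  have h1 : ∑ k : Fin M, Matrix.diagonal (Pi.single k (1 : ℂ)) = 1 := by
    ext a b
    rw [Matrix.sum_apply]
    by_cases hab : a = b
    · subst hab; simp [Pi.single_apply]
    · simp [hab]
  simp only [specProj]
  rw [← Finset.sum_mul, ← Finset.mul_sum, h1, mul_one, h]

/-- The projections `specProj U k`, put on the first `M` cyclic diagonals of an `n × n` matrix. -/
def band (U : Matrix.unitaryGroup (Fin M) ℂ) (d : Fin n) : Matrix (Fin M) (Fin M) ℂ :=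
  ∑ k : Fin M, if (k : ℕ) = d then specProj U k else 0

theorem band_of_lt (U : Matrix.unitaryGroup (Fin M) ℂ) {d : Fin n} (h : (d : ℕ) < M) :
    band U d = specProj U ⟨d, h⟩ := by
  rw [band, Finset.sum_eq_single ⟨d, h⟩ (fun k _ hk => if_neg fun h' => hk (Fin.ext h')) (by simp)]
  simp

theorem band_of_le (U : Matrix.unitaryGroup (Fin M) ℂ) {d : Fin n} (h : M ≤ d) :
    band U d = 0 :=
  Finset.sum_eq_zero fun k _ => if_neg (by have := k.2; omega)

theorem sum_smul_band (U : Matrix.unitaryGroup (Fin M) ℂ) (hn : M ≤ n) (ψ : Fin n → ℂ) :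
    ∑ d : Fin n, ψ d • band U d = ∑ k : Fin M, ψ (Fin.castLE hn k) • specProj U k := by
  simp only [band, Finset.smul_sum]
  rw [Finset.sum_comm]
  refine Finset.sum_congr rfl fun k _ => ?_
  rw [Finset.sum_eq_single (Fin.castLE hn k)]
  · simp
  · intro d _ hd
    rw [if_neg fun h => hd (Fin.ext h.symm), smul_zero]
  · simp

theorem sum_band (U : Matrix.unitaryGroup (Fin M) ℂ) (hn : M ≤ n) :
    ∑ d : Fin n, band U d = 1 := by
  simpa [sum_specProj] using sum_smul_band U hn fun _ => 1

/-- Block diagonal matrices with two blocks. -/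
def blockDiag (M n : ℕ) : Matrix (Fin M) (Fin M) ℂ × Matrix (Fin n) (Fin n) ℂ →ₐ[ℂ]
    Matrix (Fin M ⊕ Fin n) (Fin M ⊕ Fin n) ℂ :=
  AlgHom.ofLinearMap
    { toFun := fun A => Matrix.fromBlocks A.1 0 0 A.2
      map_add' := fun A B => by simp [Matrix.fromBlocks_add]
      map_smul' := fun c A => by simp [Matrix.fromBlocks_smul] }
    (by simp) (fun A B => by simp [Matrix.fromBlocks_multiply])

theorem blockDiag_apply (A : Matrix (Fin M) (Fin M) ℂ × Matrix (Fin n) (Fin n) ℂ) :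
    blockDiag M n A = Matrix.fromBlocks A.1 0 0 A.2 := rfl

theorem blockDiag_injective : Function.Injective (blockDiag M n) := by
  intro A B h
  rw [blockDiag_apply, blockDiag_apply, Matrix.fromBlocks_inj] at h
  exact Prod.ext h.1 h.2.2.2

theorem rank_blockDiag_left (A : Matrix (Fin M) (Fin M) ℂ) :
    (blockDiag M n (A, 0)).rank = A.rank := by
  refine le_antisymm ?_ ?_
  · have h : blockDiag M n (A, 0) =
        Matrix.fromRows (1 : Matrix (Fin M) (Fin M) ℂ) (0 : Matrix (Fin n) (Fin M) ℂ) * A *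
          Matrix.fromCols (1 : Matrix (Fin M) (Fin M) ℂ) (0 : Matrix (Fin M) (Fin n) ℂ) := by
      rw [blockDiag_apply, Matrix.fromRows_mul, Matrix.mul_fromCols]
      ext (i | i) (j | j) <;> simp
    rw [h]
    exact (Matrix.rank_mul_le_left _ _).trans (Matrix.rank_mul_le_right _ _)
  · have h : A = (blockDiag M n (A, 0)).submatrix Sum.inl Sum.inl := by
      ext i j; simp [blockDiag_apply]
    conv_lhs => rw [h]
    exact Matrix.rank_submatrix_le _ _ _

variable [NeZero n]

/-- The compression to `ℂ ^ M` of the points of the flat model that extend a point `P`. -/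
def extMat (P : FlatSpace M) (U : Matrix.unitaryGroup (Fin M) ℂ) :
    Fin M ⊕ Fin n → Fin M ⊕ Fin n → Matrix (Fin M) (Fin M) ℂ
  | .inl i, .inl j => P.1 i j
  | .inr x, .inr y => band U (y - x)
  | _, _ => 0

/-- The cells of the extended matrix on which `extMat` vanishes. -/
def IsOuterCell (M n : ℕ) [NeZero n] : Fin M ⊕ Fin n → Fin M ⊕ Fin n → Prop
  | .inl _, .inl _ => False
  | .inr x, .inr y => M ≤ (y - x : Fin n)
  | _, _ => True

instance : DecidableRel (IsOuterCell M n) := Classical.decRel _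

theorem card_isOuterCell (hn : M ≤ n) : (∀ a, (Finset.univ.filter fun b =>
    IsOuterCell M n a b).card = n) ∧ ∀ b, (Finset.univ.filter fun a =>
    IsOuterCell M n a b).card = n := by
  have h1 : ∑ d : Fin n, (if M ≤ (d : ℕ) then 1 else 0) = n - M := by
    rw [Fin.sum_univ_eq_sum_range fun i => if M ≤ i then 1 else 0, ← Finset.card_filter]
    have : (Finset.range n).filter (fun i => M ≤ i) = Finset.Ico M n := by
      ext i; simp [and_comm]
    rw [this, Nat.card_Ico]
  simp only [Finset.card_filter, Fintype.sum_sum_type]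
  refine ⟨?_, ?_⟩
  · rintro (i | x)
    · simp [IsOuterCell]
    · have h2 := (Equiv.subRight x).sum_comp fun d : Fin n => if M ≤ (d : ℕ) then 1 else 0
      rw [h1] at h2
      have h3 : ∑ y : Fin n, (if IsOuterCell M n (.inr x) (.inr y) then 1 else 0) = n - M := by
        rw [← h2]
        exact Finset.sum_congr rfl fun y _ => if_congr Iff.rfl rfl rfl
      rw [h3]
      simp [IsOuterCell]
      omega
  · rintro (i | x)
    · simp [IsOuterCell]
    · have h2 := (Equiv.subLeft x).sum_comp fun d : Fin n => if M ≤ (d : ℕ) then 1 else 0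
      rw [h1] at h2
      have h3 : ∑ y : Fin n, (if IsOuterCell M n (.inr y) (.inr x) then 1 else 0) = n - M := by
        rw [← h2]
        exact Finset.sum_congr rfl fun y _ => if_congr Iff.rfl rfl rfl
      rw [h3]
      simp [IsOuterCell]
      omega

theorem extMat_of_isOuterCell (P : FlatSpace M) (U : Matrix.unitaryGroup (Fin M) ℂ)
    {a b : Fin M ⊕ Fin n} (h : IsOuterCell M n a b) : extMat P U a b = 0 := by
  rcases a with i | x <;> rcases b with j | y
  · exact h.elim
  · rfl
  · rfl
  · exact band_of_le U h

theorem extMat_of_not_isOuterCell (P : FlatSpace M) (U : Matrix.unitaryGroup (Fin M) ℂ)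
    {a b : Fin M ⊕ Fin n} (h : ¬ IsOuterCell M n a b) :
    IsStarProjection (extMat P U a b) ∧ (extMat P U a b).rank = 1 := by
  rcases a with i | x <;> rcases b with j | y
  · exact P.2.1 i j
  · exact absurd trivial h
  · exact absurd trivial h
  · have : extMat P U (.inr x) (.inr y) = _ := band_of_lt U (lt_of_not_ge h)
    rw [this]
    exact ⟨isStarProjection_specProj _ _, rank_specProj _ _⟩

theorem sum_extMat (hn : M ≤ n) (P : FlatSpace M) (U : Matrix.unitaryGroup (Fin M) ℂ) :
    (∀ a, ∑ b : Fin M ⊕ Fin n, extMat P U a b = 1) ∧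
      ∀ b, ∑ a : Fin M ⊕ Fin n, extMat P U a b = 1 := by
  simp only [Fintype.sum_sum_type]
  refine ⟨?_, ?_⟩
  · rintro (i | x)
    · simpa [extMat] using P.2.2.1 i
    · simp only [extMat, Finset.sum_const_zero, zero_add]
      exact ((Equiv.subRight x).sum_comp fun d => band U d).trans (sum_band U hn)
  · rintro (i | x)
    · simpa [extMat] using P.2.2.2 i
    · simp only [extMat, Finset.sum_const_zero, zero_add]
      exact ((Equiv.subLeft x).sum_comp fun d => band U d).trans (sum_band U hn)

/-- The vectors fixed by the flat model for `M + n` indices are fixed by the compressions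
`extMat`: outside the support of `extMat`, a colouring by further unit vectors completes the
matrix. -/
theorem IsFlatFixed.isFixedPow_extMat {N k : ℕ} (hn : M ≤ n) (e : Fin M ⊕ Fin n ≃ Fin N)
    {f : List (Fin N) → ℂ} (hf : IsFlatFixed N k f) (P : FlatSpace M)
    (U : Matrix.unitaryGroup (Fin M) ℂ) : IsFixedPow (extMat P U) k fun a => f (a.map e) := by
  obtain ⟨c, hlt, hcr, hcc⟩ := exists_colouring n (IsOuterCell M n) (card_isOuterCell hn).1
    (card_isOuterCell hn).2
  let D : Fin M ⊕ Fin n → Fin M ⊕ Fin n → Fin n → ℂ := fun a b j =>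
    if IsOuterCell M n a b ∧ c a b = j then 1 else 0
  let q : Fin M ⊕ Fin n → Fin M ⊕ Fin n →
      Matrix (Fin M) (Fin M) ℂ × Matrix (Fin n) (Fin n) ℂ := fun a b =>
    (extMat P U a b, Matrix.diagonal (D a b))
  have hD : ∀ a b, IsStarProjection (Matrix.diagonal (D a b)) := by
    refine fun a b => ⟨?_, ?_⟩
    · rw [IsIdempotentElem, Matrix.diagonal_mul_diagonal]
      congr 1
      funext j
      simp [D]
    · rw [IsSelfAdjoint, Matrix.star_eq_conjTranspose, Matrix.diagonal_conjTranspose]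
      congr 1
      funext j
      simp only [D, Pi.star_apply]
      split_ifs <;> simp
  have hq : IsFlatPoint fun a b => blockDiag M n (q a b) := by
    refine ⟨fun a b => ?_, fun a b => ?_, fun a => ?_, fun b => ?_⟩
    · have h1 : IsStarProjection (extMat P U a b) := by
        by_cases h : IsOuterCell M n a b
        · rw [extMat_of_isOuterCell P U h]
          exact .zero _
        · exact (extMat_of_not_isOuterCell P U h).1
      refine ⟨?_, ?_⟩
      · rw [IsIdempotentElem, ← map_mul]
        congr 1
        exact Prod.ext h1.isIdempotentElem (hD a b).isIdempotentElem
      · have h2 : (extMat P U a b).conjTranspose = _ := h1.isSelfAdjoint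
        have h3 : (Matrix.diagonal (D a b)).conjTranspose = _ := (hD a b).isSelfAdjoint
        rw [IsSelfAdjoint, blockDiag_apply, Matrix.star_eq_conjTranspose,
          Matrix.fromBlocks_conjTranspose, h2, h3, Matrix.conjTranspose_zero,
          Matrix.conjTranspose_zero, ← blockDiag_apply (extMat P U a b, Matrix.diagonal (D a b))]
    · by_cases h : IsOuterCell M n a b
      · have h1 : blockDiag M n (q a b) =
            Matrix.diagonal (Pi.single (Sum.inr ⟨c a b, hlt a b h⟩) 1) := by
          rw [blockDiag_apply]
          simp only [q, extMat_of_isOuterCell P U h]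
          ext (i | i) (j | j)
          · by_cases hij : i = j <;> simp [hij]
          · simp
          · simp
          · by_cases hij : i = j
            · subst hij
              simp [D, h, Pi.single_apply, Fin.ext_iff, eq_comm]
            · simp [hij]
        rw [h1, Matrix.rank_diagonal]
        simp [Pi.single_apply]
      · have h1 : q a b = (extMat P U a b, 0) := by
          simp [q, D, h]
        rw [h1, rank_blockDiag_left]
        exact (extMat_of_not_isOuterCell P U h).2
    · rw [← map_sum, ← map_one (blockDiag M n)]
      congr 1
      refine Prod.ext ?_ ?_
      · rw [Prod.fst_sum]
        exact (sum_extMat hn P U).1 a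
      · rw [Prod.snd_sum]
        ext i j
        rw [Matrix.sum_apply]
        by_cases hij : i = j
        · subst hij
          obtain ⟨b, hb, hb'⟩ := hcr a i i.2
          rw [Finset.sum_eq_single b]
          · simp [q, D, hb]
          · intro b' _ hne
            simp only [q, D, Matrix.diagonal_apply_eq]
            exact if_neg fun h => hne (hb' b' h)
          · simp
        · simp [q, hij]
    · rw [← map_sum, ← map_one (blockDiag M n)]
      congr 1
      refine Prod.ext ?_ ?_
      · rw [Prod.fst_sum]
        exact (sum_extMat hn P U).2 b
      · rw [Prod.snd_sum]
        ext i j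
        rw [Matrix.sum_apply]
        by_cases hij : i = j
        · subst hij
          obtain ⟨a, ha, ha'⟩ := hcc b i i.2
          rw [Finset.sum_eq_single a]
          · simp [q, D, ha]
          · intro a' _ hne
            simp only [q, D, Matrix.diagonal_apply_eq]
            exact if_neg fun h => hne (ha' a' h)
          · simp
        · simp [q, hij]
  have h1 := hf.isFixedPow e hq
  have h2 : IsFixed q (fun z : Empty => 0) (List.replicate k none) fun a => f (a.map e) :=
    Intertwines.of_map (blockDiag M n) blockDiag_injective (isFixed_replicate.2 h1)
  exact isFixed_replicate.1 (h2.map (AlgHom.fst ℂ _ _))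

end Extension

/-! ### Slots of a fixed vector -/

section Slots

variable {M n : ℕ} {B : Type*} [AddCommGroup B] [Module ℂ B]

/-- The partial evaluation of a tensor over `ℂ ^ M ⊕ ℂ ^ n`: at the entries `none` of the pattern the
tensor is restricted to `ℂ ^ M`, and at an entry `some h` it is paired with the vector `h` of
`ℂ ^ n`. -/
def slot : List (Option (Fin n → ℂ)) → (List (Fin M ⊕ Fin n) → B) → List (Fin M) → B
  | [], F, _ => F []
  | none :: s, F, i :: l => slot s (fun x => F (.inl i :: x)) l
  | none :: _, _, [] => 0
  | some h :: s, F, l => ∑ y, h y • slot s (fun x => F (.inr y :: x)) l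

@[simp] theorem slot_nil (F : List (Fin M ⊕ Fin n) → B) (l : List (Fin M)) :
    slot [] F l = F [] := by
  cases l <;> rfl

@[simp] theorem slot_none (s : List (Option (Fin n → ℂ))) (F : List (Fin M ⊕ Fin n) → B)
    (i : Fin M) (l : List (Fin M)) :
    slot (none :: s) F (i :: l) = slot s (fun x => F (.inl i :: x)) l := rfl

@[simp] theorem slot_some (h : Fin n → ℂ) (s : List (Option (Fin n → ℂ)))
    (F : List (Fin M ⊕ Fin n) → B) (l : List (Fin M)) :
    slot (some h :: s) F l = ∑ y, h y • slot s (fun x => F (.inr y :: x)) l := by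
  cases l <;> rfl

theorem slot_congr {s : List (Option (Fin n → ℂ))} {F G : List (Fin M ⊕ Fin n) → B}
    {l : List (Fin M)} (h : ∀ x, x.length = s.length → F x = G x) : slot s F l = slot s G l := by
  induction s generalizing F G l with
  | nil => simpa using h [] rfl
  | cons a s ih =>
    cases a with
    | none =>
      cases l with
      | nil => rfl
      | cons i l => exact ih fun x hx => h _ (by simp [hx])
    | some a =>
      simp only [slot_some]
      exact Finset.sum_congr rfl fun y _ => by rw [ih fun x hx => h _ (by simp [hx])]

theorem slot_map {C : Type*} [AddCommGroup C] [Module ℂ C] (φ : B →ₗ[ℂ] C)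
    (s : List (Option (Fin n → ℂ))) (F : List (Fin M ⊕ Fin n) → B) (l : List (Fin M)) :
    slot s (fun x => φ (F x)) l = φ (slot s F l) := by
  induction s generalizing F l with
  | nil => simp
  | cons a s ih =>
    cases a with
    | none =>
      cases l with
      | nil => exact (map_zero φ).symm
      | cons i l => exact ih _ _
    | some a => simp only [slot_some, ih, map_sum, map_smul]

theorem slot_sum {C : Type*} (t : Finset C) (s : List (Option (Fin n → ℂ)))
    (F : C → List (Fin M ⊕ Fin n) → B) (l : List (Fin M)) :
    slot s (fun x => ∑ c ∈ t, F c x) l = ∑ c ∈ t, slot s (F c) l := by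
  induction s generalizing F l with
  | nil => simp
  | cons a s ih =>
    cases a with
    | none =>
      cases l with
      | nil => exact Finset.sum_const_zero.symm
      | cons i l => exact ih _ _
    | some a =>
      simp only [slot_some, ih, Finset.smul_sum]
      exact Finset.sum_comm

theorem slot_append_sum {C : Type*} (t : Finset C) (c : C → ℂ) (h : C → Fin n → ℂ)
    (u v : List (Option (Fin n → ℂ))) (F : List (Fin M ⊕ Fin n) → B) (l : List (Fin M)) :
    slot (u ++ some (∑ i ∈ t, c i • h i) :: v) F l =
      ∑ i ∈ t, c i • slot (u ++ some (h i) :: v) F l := by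
  induction u generalizing F l with
  | nil =>
    simp only [List.nil_append, slot_some, Finset.sum_apply, Finset.smul_sum, Finset.sum_smul,
      Pi.smul_apply, smul_assoc]
    exact Finset.sum_comm
  | cons a u ih =>
    cases a with
    | none =>
      cases l with
      | nil => exact (Finset.sum_eq_zero fun i _ => smul_zero (c i)).symm
      | cons i l => exact ih _ _
    | some a =>
      simp only [List.cons_append, slot_some, ih, Finset.smul_sum]
      rw [Finset.sum_comm]
      exact Finset.sum_congr rfl fun i _ => Finset.sum_congr rfl fun y _ => smul_comm _ _ _

/-- The word that has the given letters of `Fin n` at the entries `some` of the pattern and the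
letters of `l` at its entries `none`. -/
def fill : List (Option (Fin n)) → List (Fin M) → List (Fin M ⊕ Fin n)
  | [], _ => []
  | none :: s, i :: l => .inl i :: fill s l
  | none :: _, [] => []
  | some y :: s, l => .inr y :: fill s l

@[simp] theorem fill_some (y : Fin n) (s : List (Option (Fin n))) (l : List (Fin M)) :
    fill (some y :: s) l = .inr y :: fill s l := by
  cases l <;> rfl

theorem exists_fill (x : List (Fin M ⊕ Fin n)) : ∃ (s : List (Option (Fin n))) (l : List (Fin M)),
    l.length = legs s ∧ x = fill s l := by
  induction x with
  | nil => exact ⟨[], [], rfl, rfl⟩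
  | cons a x ih =>
    obtain ⟨s, l, hl, rfl⟩ := ih
    cases a with
    | inl i => exact ⟨none :: s, i :: l, by simp [hl], rfl⟩
    | inr y => exact ⟨some y :: s, l, by simpa using hl, by simp⟩

theorem length_fill {s : List (Option (Fin n))} {l : List (Fin M)} (hl : l.length = legs s) :
    (fill s l).length = s.length := by
  induction s generalizing l with
  | nil => cases l <;> rfl
  | cons a s ih =>
    cases a with
    | none =>
      obtain _ | ⟨i, l⟩ := l
      · simp at hl
      · simpa [fill] using ih (by simpa using hl)
    | some y => simpa using ih (by simpa using hl)

theorem fill_replicate (l : List (Fin M)) :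
    fill (List.replicate l.length (none : Option (Fin n))) l = l.map Sum.inl := by
  induction l with
  | nil => rfl
  | cons i l ih => simp [List.replicate_succ, fill, ih]

theorem slot_single {s : List (Option (Fin n))} (F : List (Fin M ⊕ Fin n) → B) {l : List (Fin M)}
    (hl : l.length = legs s) :
    slot (s.map (Option.map fun y => Pi.single y 1)) F l = F (fill s l) := by
  induction s generalizing F l with
  | nil => cases l <;> simp [fill]
  | cons a s ih =>
    cases a with
    | none =>
      obtain _ | ⟨i, l⟩ := l
      · simp at hl
      · simpa [fill] using ih _ (by simpa using hl)
    | some y =>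
      simp only [List.map_cons, Option.map_some, slot_some, fill_some]
      rw [Finset.sum_eq_single y]
      · simpa using ih _ (by simpa using hl)
      · intro b _ hb; simp [hb]
      · simp

@[simp] theorem legs_map {Z Z' : Type*} (g : Z → Z') (w : List (Option Z)) :
    legs (w.map (Option.map g)) = legs w := by
  induction w with
  | nil => rfl
  | cons a w ih => cases a <;> simpa using ih

end Slots

section Outer

variable {n : ℕ}

/-- Noncrossing vectors extend along injections of the index set. -/
theorem NC.exists_extension {ι κ : Type*} [DecidableEq ι] [DecidableEq κ] {k : ℕ} {f : List ι → ℂ}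
    (hf : f ∈ NC ι k) (g : ι → κ) (hg : Function.Injective g) :
    ∃ f' ∈ NC κ k, ∀ l, l.length = k → f' (l.map g) = f l := by
  induction hf using NC.induction with
  | diagram d hd => exact ⟨d.ev, d.ev_mem_NC k, fun l _ => d.ev_map g hg l⟩
  | zero => exact ⟨0, zero_mem _, fun _ _ => rfl⟩
  | add f₁ f₂ _ _ h₁ h₂ =>
    obtain ⟨g₁, hg₁, e₁⟩ := h₁
    obtain ⟨g₂, hg₂, e₂⟩ := h₂
    exact ⟨g₁ + g₂, add_mem hg₁ hg₂, fun l hl => by simp [e₁ l hl, e₂ l hl]⟩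
  | smul c f _ h =>
    obtain ⟨f', hf', e⟩ := h
    exact ⟨c • f', Submodule.smul_mem _ c hf', fun l hl => by simp [e l hl]⟩
  | congr f₁ f₂ _ h hf =>
    obtain ⟨f', hf', e⟩ := hf
    exact ⟨f', hf', fun l hl => (e l hl).trans (h l hl).symm⟩

/-- The number of letters of a word in the second summand. -/
def outer {α β : Type*} (x : List (α ⊕ β)) : ℕ := x.countP Sum.isRight

/-- A filled word either has a letter in the second summand that does not depend on the letters in
the first one, or lies in the first summand. -/
theorem exists_outer_of_fill {M : ℕ} {s : List (Option (Fin n))} {l : List (Fin M)}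
    (hl : l.length = legs s) :
    (∃ y : Fin n, ∀ l' : List (Fin M), l'.length = legs s → Sum.inr y ∈ fill s l') ∨
      fill s l = l.map Sum.inl := by
  induction s generalizing l with
  | nil =>
    rw [legs_nil, List.length_eq_zero_iff] at hl
    exact .inr (by simp [hl, fill])
  | cons a s ih =>
    cases a with
    | none =>
      obtain _ | ⟨i, l⟩ := l
      · simp at hl
      rcases ih (l := l) (by simpa using hl) with ⟨y, hy⟩ | h
      · refine .inl ⟨y, fun l' hl' => ?_⟩
        obtain _ | ⟨i', l'⟩ := l'
        · simp at hl'
        exact List.mem_cons_of_mem _ (hy l' (by simpa using hl'))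
      · exact .inr (by simp [fill, h])
    | some y => exact .inl ⟨y, fun l' _ => by simp⟩

theorem outer_fill {M : ℕ} {s : List (Option (Fin n))} {l l' : List (Fin M)}
    (hl : l.length = legs s) (hl' : l'.length = legs s) :
    outer (fill s l) = outer (fill s l') := by
  induction s generalizing l l' with
  | nil => cases l <;> cases l' <;> rfl
  | cons a s ih =>
    cases a with
    | none =>
      obtain _ | ⟨i, l⟩ := l
      · simp at hl
      obtain _ | ⟨i', l'⟩ := l'
      · simp at hl'
      simpa [fill, outer] using ih (l := l) (l' := l') (by simpa using hl) (by simpa using hl')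
    | some y =>
      have := ih (l := l) (l' := l') hl hl'
      simp only [outer] at this
      rw [fill_some, fill_some, outer, outer, List.countP_cons, List.countP_cons, this]

theorem mem_of_inl_mem_fill {M : ℕ} {s : List (Option (Fin n))} {l : List (Fin M)} {j : Fin M}
    (h : Sum.inl j ∈ fill s l) : j ∈ l := by
  induction s generalizing l with
  | nil => simp [fill] at h
  | cons a s ih =>
    cases a with
    | none =>
      obtain _ | ⟨i, l⟩ := l
      · simp [fill] at h
      rcases List.mem_cons.1 h with h | h
      · simp [Sum.inl.inj h]
      · exact List.mem_cons_of_mem _ (ih h)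
    | some y => exact ih (by simpa using h)

/-- Exchanging a letter of the second summand with an absent letter of the first one decreases
`outer`. -/
theorem outer_map_swap {α β : Type*} [DecidableEq α] [DecidableEq β] {x : List (α ⊕ β)} {j : α}
    (y : β) (hj : Sum.inl j ∉ x) :
    outer (x.map (Equiv.swap (.inl j) (.inr y))) ≤ outer x ∧
      (Sum.inr y ∈ x → outer (x.map (Equiv.swap (.inl j) (.inr y))) < outer x) := by
  induction x with
  | nil => simp [outer]
  | cons a x ih =>
    obtain ⟨h1, h2⟩ := ih fun h => hj (List.mem_cons_of_mem _ h)
    have ha : a ≠ .inl j := fun h => hj (by simp [h])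
    simp only [outer, List.map_cons, List.countP_cons, List.mem_cons] at h1 h2 ⊢
    by_cases hay : a = .inr y
    · subst hay
      simp only [Equiv.swap_apply_right, Sum.isRight_inl, Sum.isRight_inr, if_true,
        Bool.false_eq_true, if_false]
      omega
    · rw [Equiv.swap_apply_of_ne_of_ne ha hay]
      refine ⟨by omega, fun h => ?_⟩
      have := h2 (h.resolve_left fun h => hay h.symm)
      omega

end Outer

/-! ### Characters turn slots into scalar letters -/

section Characters

variable {M n : ℕ} [NeZero n]

/-- The value at `-1` of a character of the cyclic group of order `n`. -/
def charLetter (ψ : AddChar (Fin n) ℂ) : Circle := ⟨ψ (-1), by simp [Submonoid.unitSphere]⟩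

/-- A character of the cyclic group is an eigenvector of the circulant part of `extMat`, with a
scalar letter as eigenvalue. -/
theorem sum_char_smul_band (hn : M ≤ n) (U : Matrix.unitaryGroup (Fin M) ℂ)
    (ψ : AddChar (Fin n) ℂ) (y : Fin n) :
    ∑ x, ψ x • band U (y - x) = ψ y • letterMat U (charLetter ψ) := by
  have hj : ∀ j < n, ((j • (1 : Fin n) : Fin n) : ℕ) = j := by
    intro j hj
    induction j with
    | zero => simp
    | succ j ih =>
      rw [succ_nsmul, Fin.val_add, ih (by omega), Fin.val_one', Nat.add_mod_mod,
        Nat.mod_eq_of_lt hj]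
  have h1 : ∀ k : Fin M, ψ (-Fin.castLE hn k) = (charLetter ψ : ℂ) ^ (k : ℕ) := by
    intro k
    have h2 : -Fin.castLE hn k = (k : ℕ) • (-1 : Fin n) := by
      rw [smul_neg]
      congr 1
      exact Fin.ext (hj k (k.2.trans_le hn)).symm
    rw [h2, AddChar.map_nsmul_eq_pow]
    rfl
  have h3 : letterMat U (charLetter ψ) =
      ∑ k : Fin M, (charLetter ψ : ℂ) ^ (k : ℕ) • specProj U k := by
    have h : Matrix.diagonal (fun i : Fin M => (charLetter ψ : ℂ) ^ (i : ℕ)) =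
        ∑ k : Fin M, (charLetter ψ : ℂ) ^ (k : ℕ) • Matrix.diagonal (Pi.single k 1) := by
      ext a b
      rw [Matrix.sum_apply]
      by_cases hab : a = b
      · subst hab; simp [Pi.single_apply]
      · simp [hab]
    rw [letterMat, h, Finset.mul_sum, Finset.sum_mul]
    simp only [specProj, mul_smul_comm, smul_mul_assoc]
  rw [h3, ← (Equiv.subLeft y).sum_comp]
  simp only [Equiv.subLeft_apply, sub_sub_cancel]
  have h4 := sum_smul_band U hn fun d => ψ (-d)
  simp only [h1] at h4
  rw [← h4, Finset.smul_sum]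
  refine Finset.sum_congr rfl fun d _ => ?_
  rw [smul_smul, ← AddChar.map_add_eq_mul, sub_eq_add_neg]

/-- The action of the powers of `extMat` on tensors becomes the action of words with scalar letters
after pairing with characters. -/
theorem sum_smul_slot_powMat (hn : M ≤ n) (P : FlatSpace M) (U : Matrix.unitaryGroup (Fin M) ℂ)
    (w : List (Option (AddChar (Fin n) ℂ))) (f : List (Fin M ⊕ Fin n) → ℂ) {l : List (Fin M)}
    (hl : l.length = legs w) :
    ∑ x ∈ words _ w.length, f x • slot (w.map (Option.map fun ψ : AddChar (Fin n) ℂ => (ψ : Fin n → ℂ)))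
        (fun a => powMat (extMat P U) w.length a x) l =
      ∑ m ∈ words (Fin M) (legs w),
        slot (w.map (Option.map fun ψ : AddChar (Fin n) ℂ => (ψ : Fin n → ℂ))) f m •
          wordMat (fun i j => P.1 i j) (letterMat U) (w.map (Option.map charLetter)) l m := by
  have hpow : ∀ k a (x : List (Fin M ⊕ Fin n)) b y, powMat (extMat P U) (k + 1) (a :: x) (b :: y) =
      extMat P U a b * powMat (extMat P U) k x y := fun k a x b y => by
    simp [powMat, List.replicate_succ]
  have hmul : ∀ (s : List (Option (Fin n → ℂ))) (b : Matrix (Fin M) (Fin M) ℂ)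
      (F : List (Fin M ⊕ Fin n) → Matrix (Fin M) (Fin M) ℂ) (l : List (Fin M)),
      slot s (fun a => b * F a) l = b * slot s F l := fun s b F l =>
    slot_map (LinearMap.mulLeft ℂ b) s F l
  induction w generalizing f l with
  | nil =>
    rw [legs_nil, List.length_eq_zero_iff] at hl
    subst hl
    simp [powMat]
  | cons a w ih =>
    cases a with
    | none =>
      obtain _ | ⟨i, l⟩ := l
      · simp at hl
      simp only [List.length_cons, List.map_cons, Option.map_none, legs_none, slot_none,
        sum_words_succ, hpow, hmul, wordMat_none, Fintype.sum_sum_type]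
      rw [add_eq_left.2 (Finset.sum_eq_zero fun y _ => by simp [extMat])]
      refine Finset.sum_congr rfl fun j _ => ?_
      have := congrArg (P.1 i j * ·) (ih (fun x => f (.inl j :: x)) (l := l) (by simpa using hl))
      simpa only [Finset.mul_sum, mul_smul_comm, extMat] using this
    | some ψ =>
      simp only [List.length_cons, List.map_cons, Option.map_some, legs_some, slot_some,
        sum_words_succ, hpow, hmul, wordMat_some, Fintype.sum_sum_type]
      rw [add_eq_right.2 (Finset.sum_eq_zero fun y _ => by simp [extMat])]
      have h1 : ∀ y, ∀ x : List (Fin M ⊕ Fin n), ∑ y', ψ y' • (extMat P U (.inr y') (.inr y) *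
          slot (w.map (Option.map fun ψ : AddChar (Fin n) ℂ => (ψ : Fin n → ℂ)))
            (fun a => powMat (extMat P U) w.length a x) l) =
          ψ y • (letterMat U (charLetter ψ) * slot (w.map (Option.map fun ψ : AddChar (Fin n) ℂ => (ψ : Fin n → ℂ)))
            (fun a => powMat (extMat P U) w.length a x) l) := by
        intro y x
        simp only [← smul_mul_assoc, ← Finset.sum_mul, ← sum_char_smul_band hn U ψ y]
        rfl
      simp only [h1, Finset.sum_smul]
      rw [Finset.sum_comm (t := Finset.univ)]
      refine Finset.sum_congr rfl fun y _ => ?_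
      have := congrArg (fun z => ψ y • (letterMat U (charLetter ψ) * z))
        (ih (fun x => f (.inr y :: x)) (l := l) (by simpa using hl))
      simp only [Finset.mul_sum, mul_smul_comm, Finset.smul_sum] at this
      simp only [smul_comm (f _) (ψ y), smul_assoc]
      exact this

end Characters

/-! ### Fixed vectors for more indices -/

section Step

variable {m n : ℕ} [NeZero n] {N k : ℕ}

/-- The pairings of a fixed vector of the flat model with characters are fixed by words with scalar
letters, hence noncrossing. -/
theorem slot_char_mem_NC (hH : ∀ k f, IsFlatFixed (m + 5) k f → f ∈ NC (Fin (m + 5)) k)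
    (hn : m + 5 ≤ n) (e : Fin (m + 5) ⊕ Fin n ≃ Fin N) {f : List (Fin N) → ℂ}
    (hf : IsFlatFixed N k f) {w : List (Option (AddChar (Fin n) ℂ))} (hw : w.length = k) :
    slot (w.map (Option.map fun ψ : AddChar (Fin n) ℂ => (ψ : Fin n → ℂ))) (fun x => f (x.map e)) ∈
      NC (Fin (m + 5)) (legs w) := by
  subst hw
  rw [← legs_map charLetter w]
  refine mem_NC_of_isModelFixed hH fun P U => isFixed_iff.2 fun l hl => ?_
  rw [legs_map] at hl ⊢
  rw [← sum_smul_slot_powMat hn P U w _ hl]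
  have h1 := isFixedPow_iff.1 (hf.isFixedPow_extMat hn e P U)
  have h2 := slot_map (LinearMap.toSpanSingleton ℂ (Matrix (Fin (m + 5)) (Fin (m + 5)) ℂ) 1)
    (w.map (Option.map fun ψ : AddChar (Fin n) ℂ => (ψ : Fin n → ℂ))) (fun x => f (x.map e)) l
  simp only [LinearMap.toSpanSingleton_apply] at h2
  rw [← h2, slot_congr fun x hx => (h1 x (by simpa using hx)).symm, slot_sum]
  exact Finset.sum_congr rfl fun x _ => (slot_map (LinearMap.lsmul ℂ _ (f (x.map e))) _ _ _).symm

/-- The characters span the functions on the cyclic group, so that all slots of fixed vectors are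
noncrossing. -/
theorem slot_mem_NC (hH : ∀ k f, IsFlatFixed (m + 5) k f → f ∈ NC (Fin (m + 5)) k)
    (hn : m + 5 ≤ n) (e : Fin (m + 5) ⊕ Fin n ≃ Fin N) {f : List (Fin N) → ℂ}
    (hf : IsFlatFixed N k f) (v : List (Option (Fin n))) (u : List (Option (AddChar (Fin n) ℂ)))
    (huv : u.length + v.length = k) :
    slot (u.map (Option.map fun ψ : AddChar (Fin n) ℂ => (ψ : Fin n → ℂ)) ++ v.map (Option.map fun y => Pi.single y 1))
      (fun x => f (x.map e)) ∈ NC (Fin (m + 5)) (legs u + legs v) := by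
  induction v generalizing u with
  | nil => simpa using slot_char_mem_NC hH hn e hf (w := u) (by simpa using huv)
  | cons a v ih =>
    cases a with
    | none =>
      have := ih (u ++ [none]) (by simp at huv ⊢; omega)
      simpa [add_assoc, add_comm 1] using this
    | some y =>
      have h1 : (Pi.single y 1 : Fin n → ℂ) =
          ∑ ψ : AddChar (Fin n) ℂ, ((n : ℂ)⁻¹ * ψ (-y)) • (ψ : Fin n → ℂ) := by
        funext z
        have h2 := AddChar.sum_apply_eq_ite (z - y)
        simp only [Finset.sum_apply, Pi.smul_apply, smul_eq_mul, mul_assoc, ← Finset.mul_sum,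
          ← AddChar.map_add_eq_mul, neg_add_eq_sub, h2]
        have hn0 : (n : ℂ) ≠ 0 := Nat.cast_ne_zero.2 (NeZero.ne n)
        by_cases hz : z = y
        · subst hz; simp [hn0]
        · simp [hz, sub_eq_zero]
      simp only [List.map_cons, Option.map_some, legs_some]
      rw [h1]
      have h3 := fun l => slot_append_sum Finset.univ
        (fun ψ : AddChar (Fin n) ℂ => (n : ℂ)⁻¹ * ψ (-y)) (fun ψ => (ψ : Fin n → ℂ))
        (u.map (Option.map fun ψ : AddChar (Fin n) ℂ => (ψ : Fin n → ℂ))) (v.map (Option.map fun y => Pi.single y 1))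
        (fun x : List (Fin (m + 5) ⊕ Fin n) => f (x.map e)) l
      have h4 : ∀ ψ : AddChar (Fin n) ℂ,
          slot (u.map (Option.map fun ψ : AddChar (Fin n) ℂ => (ψ : Fin n → ℂ)) ++
            some (ψ : Fin n → ℂ) :: v.map (Option.map fun y => Pi.single y 1))
            (fun x => f (x.map e)) ∈ NC (Fin (m + 5)) (legs u + legs v) := by
        intro ψ
        simpa using ih (u ++ [some ψ]) (by simp at huv ⊢; omega)
      refine NC.congr (Submodule.sum_mem (t := Finset.univ) _ fun ψ _ =>
        Submodule.smul_mem _ ((n : ℂ)⁻¹ * ψ (-y)) (h4 ψ)) fun l _ => ?_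
      rw [h3, Finset.sum_apply]
      rfl

/-- If the fixed vectors of the flat model for `m + 5` indices are noncrossing, so are those for
`m + 5 + n` indices, `n ≥ m + 5`. After subtraction of a noncrossing vector, a fixed vector vanishes
on the words in the first `m + 5` indices. By induction on the number of other letters it vanishes
everywhere: its slots are noncrossing vectors, and by symmetry they vanish on words that avoid some
letter. -/
theorem mem_NC_of_isFlatFixed_of_le (hH : ∀ k f, IsFlatFixed (m + 5) k f → f ∈ NC (Fin (m + 5)) k)
    (hn : m + 5 ≤ n) (e : Fin (m + 5) ⊕ Fin n ≃ Fin N) {f : List (Fin N) → ℂ}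
    (hf : IsFlatFixed N k f) : f ∈ NC (Fin N) k := by
  have hslot : ∀ g : List (Fin N) → ℂ, IsFlatFixed N k g → ∀ s : List (Option (Fin n)),
      s.length = k → (fun l => g ((fill s l).map e)) ∈ NC (Fin (m + 5)) (legs s) := by
    intro g hg s hs
    have := slot_mem_NC hH hn e hg s [] (by simpa using hs)
    simp only [List.map_nil, List.nil_append, legs_nil, zero_add] at this
    exact NC.congr this fun l hl => (slot_single (fun x => g (x.map e)) hl).symm
  have h0 := hslot f hf (List.replicate k none) (by simp)
  rw [legs_replicate] at h0
  obtain ⟨f', hf', hff'⟩ := NC.exists_extension h0 (fun i => e (.inl i))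
    (e.injective.comp Sum.inl_injective)
  have hg : IsFlatFixed N k (f - f') := fun P => by
    have h1 := (hf P).add
      ((isFixed_of_mem_NC (Y := (Empty.elim : Empty → _)) P.magic hf').smul (-1))
    refine Intertwines.congr h1 fun l x _ _ => ?_
    simp [sub_eq_add_neg]
  suffices h : ∀ x : List (Fin (m + 5) ⊕ Fin n), x.length = k → (f - f') (x.map e) = 0 by
    refine NC.congr hf' fun l hl => sub_eq_zero.1 ?_
    simpa using h (l.map e.symm) (by simpa using hl)
  set g := f - f' with hgdef
  intro x
  induction hq : outer x using Nat.strong_induction_on generalizing x with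
  | _ q ih =>
  intro hx
  obtain ⟨s, l, hl, rfl⟩ := exists_fill x
  have hs : s.length = k := by rw [← hx, length_fill hl]
  rcases exists_outer_of_fill hl with ⟨y, hy⟩ | h
  -- The four letters are `1, …, 4`, so that `0` is free to be exchanged with the outer letter `y`.
  · refine NC.eq_zero_of_four_letters (hslot g hg s hs)
      (e := fun b => (finProdFinEquiv (m := 2) (n := 2)
        (finTwoEquiv.symm b.1, finTwoEquiv.symm b.2)).succ.castLE (by omega)) ?_ ?_ hl
    · intro b b' h
      simpa [Prod.ext_iff] using h
    · intro l' hl'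
      set l₁ := l'.map _ with hl₁
      have hl₁' : l₁.length = legs s := by simpa [hl₁] using hl'
      have hmem : (0 : Fin (m + 5)) ∉ l₁ := by
        rw [hl₁, List.mem_map]
        rintro ⟨b, -, hb⟩
        exact Nat.succ_ne_zero _ (congrArg Fin.val hb)
      have h1 := ih _ (((outer_map_swap y fun h => hmem (mem_of_inl_mem_fill h)).2
        (hy l₁ hl₁')).trans_eq ((outer_fill hl₁' hl).trans hq)) _ rfl
        (by rw [List.length_map, length_fill hl₁', hs])
      have h2 := hg.map_perm (e.permCongr (Equiv.swap (.inl 0) (.inr y)))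
        (l := (fill s l₁).map e) (by rw [List.length_map, length_fill hl₁', hs])
      refine h2.symm.trans (Eq.trans (congrArg g ?_) h1)
      rw [List.map_map, List.map_map]
      refine congrArg (fun φ => (fill s l₁).map φ) (funext fun z => ?_)
      simp
  · rw [h, List.map_map, hgdef, Pi.sub_apply, sub_eq_zero]
    have hlk : l.length = k := by rw [← hs, ← length_fill hl, h, List.length_map]
    have h2 := hff' l hlk
    rw [← hlk, fill_replicate, List.map_map] at h2
    exact h2.symm

end Step

/-! ### The double commutant of a star-algebra of matrices -/

section Commutant

open Matrix in
/-- The double commutant theorem: the space of column vectors is a semisimple module over a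
star-algebra of matrices, so that the Jacobson density theorem applies. -/
theorem mem_of_forall_commute {W : Type*} [Fintype W] [DecidableEq W]
    (B : Subalgebra ℂ (Matrix W W ℂ)) (hB : ∀ b ∈ B, star b ∈ B) {a : Matrix W W ℂ}
    (ha : ∀ T : Matrix W W ℂ, (∀ b ∈ B, T * b = b * T) → T * a = a * T) : a ∈ B := by
  let _ : Module B (W → ℂ) :=
    Module.compHom (W → ℂ) ((Matrix.toLinAlgEquiv' : Matrix W W ℂ ≃ₐ[ℂ] _).toAlgHom.comp
      B.val).toRingHom
  have hsmul : ∀ (b : B) (v : W → ℂ), b • v = b.1 *ᵥ v := fun b v => rfl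
  have hscalar : ∀ (c : ℂ) (v : W → ℂ), c • v = algebraMap ℂ B c • v := fun c v => by
    rw [hsmul]
    change _ = algebraMap ℂ (Matrix W W ℂ) c *ᵥ v
    rw [Algebra.algebraMap_eq_smul_one, smul_mulVec, one_mulVec]
  have : IsSemisimpleModule B (W → ℂ) := by
    refine { exists_isCompl := fun p => ?_ }
    let q : Submodule B (W → ℂ) :=
      { carrier := {v | ∀ x ∈ p, star x ⬝ᵥ v = 0}
        add_mem' := fun {v w} hv hw x hx => by rw [dotProduct_add, hv x hx, hw x hx, add_zero]
        zero_mem' := fun x _ => dotProduct_zero _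
        smul_mem' := fun b v hv x hx => by
          have : star (star b.1 *ᵥ x) ⬝ᵥ v = 0 := hv _ (p.smul_mem ⟨star b.1, hB _ b.2⟩ hx)
          change star x ⬝ᵥ (b.1 *ᵥ v) = 0
          rw [star_mulVec] at this
          rw [dotProduct_mulVec]
          simpa [star_eq_conjTranspose] using this }
    refine ⟨q, ?_, ?_⟩
    · rw [Submodule.disjoint_def]
      refine fun v hv hv' => ?_
      have h : inner ℂ (WithLp.toLp 2 v : EuclideanSpace ℂ W) (WithLp.toLp 2 v) = 0 :=
        (dotProduct_comm _ _).trans (hv' v hv)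
      exact congrArg WithLp.ofLp (inner_self_eq_zero.1 h)
    · rw [codisjoint_iff, Submodule.eq_top_iff']
      intro v
      let K : Submodule ℂ (EuclideanSpace ℂ W) :=
        { carrier := {x | x.ofLp ∈ p}
          add_mem' := fun hx hy => p.add_mem hx hy
          zero_mem' := p.zero_mem
          smul_mem' := fun c x hx => by
            have : c • x.ofLp = algebraMap ℂ B c • x.ofLp := hscalar c _
            change c • x.ofLp ∈ p
            rw [this]
            exact p.smul_mem (algebraMap ℂ B c) hx }
      obtain ⟨y, hy, z, hz, hv⟩ := K.exists_add_mem_mem_orthogonal (WithLp.toLp 2 v)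
      refine Submodule.mem_sup.2 ⟨y.ofLp, hy, z.ofLp, fun x hx => ?_, ?_⟩
      · have := (K.mem_orthogonal z).1 hz (WithLp.toLp 2 x) hx
        rw [EuclideanSpace.inner_eq_star_dotProduct] at this
        rwa [dotProduct_comm]
      · exact (congrArg WithLp.ofLp hv).symm
  let f : Module.End (Module.End B (W → ℂ)) (W → ℂ) :=
    { toFun := fun v => a *ᵥ v
      map_add' := fun v w => mulVec_add _ _ _
      map_smul' := fun T v => by
        let T' : (W → ℂ) →ₗ[ℂ] (W → ℂ) :=
          { toFun := T
            map_add' := map_add T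
            map_smul' := fun c v => by
              rw [hscalar, map_smul, ← hscalar]
              rfl }
        have hT' : ∀ v, LinearMap.toMatrix' T' *ᵥ v = T v := fun v =>
          LinearMap.toMatrix'_mulVec T' v
        have h1 := ha (LinearMap.toMatrix' T') fun b hb => ext_of_mulVec_single fun i => by
          rw [← mulVec_mulVec, ← mulVec_mulVec, hT', hT']
          exact map_smul T (⟨b, hb⟩ : B) _
        have h2 := congrArg (· *ᵥ v) h1
        simp only [← mulVec_mulVec, hT'] at h2
        exact h2.symm }
  obtain ⟨b, hb⟩ := jacobson_density (R := B) f (Finset.univ.image fun i => Pi.single i 1)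
  have : a = b.1 := ext_of_mulVec_single fun i => hb _ (Finset.mem_image_of_mem _ (by simp))
  rw [this]
  exact b.2

end Commutant

/-! ### Hopf star-ideals and the commutant of the powers of the fundamental corepresentation -/

section Tannaka

variable {N : ℕ}

/-- Frobenius reciprocity for several legs, whose order is reversed. -/
theorem Intertwines.bend_out_replicate {ι Z B : Type*} [Fintype ι] [DecidableEq ι] [Semiring B]
    [Algebra ℂ B] {p : ι → ι → B} {Y : Z → B} (hp : Magic p) (a : ℕ) {v w : List (Option Z)}
    {ξ η : List ι → List ι → ℂ} (h : Intertwines p Y v (List.replicate a none ++ w) ξ)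
    (e : ∀ k l m, k.length = a → l.length = legs w → m.length = legs v →
      η l (k ++ m) = ξ (k.reverse ++ l) m) :
    Intertwines p Y (List.replicate a none ++ v) w η := by
  induction a generalizing v ξ with
  | zero => exact h.congr fun l m hl hm => e [] l m rfl hl (by simpa using hm)
  | succ a ih =>
    rw [List.replicate_succ, List.cons_append] at h
    have h1 := h.bend_out hp (η := fun l m => ξ (m.head?.toList ++ l) m.tail)
      fun j l m _ _ => by simp
    have h2 := ih h1 fun k l m hk hl hm => ?_
    · rwa [List.replicate_succ', List.append_assoc]
    · obtain _ | ⟨j, m⟩ := m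
      · simp at hm
      have := e (k ++ [j]) l m (by simp [hk]) hl (by simpa using hm)
      simpa using this

/-- If the fixed vectors of the flat model are noncrossing, its intertwiners are intertwiners of the
fundamental corepresentation. -/
theorem intertwines_u_of_flat (hH : ∀ k f, IsFlatFixed N k f → f ∈ NC (Fin N) k) {k : ℕ}
    {ξ : List (Fin N) → List (Fin N) → ℂ}
    (h : ∀ P : FlatSpace N, Intertwines (fun i j => P.1 i j) (Empty.elim : Empty → _)
      (List.replicate k none) (List.replicate k none) ξ) :
    Intertwines (Alg.u : Fin N → Fin N → Alg N) (Empty.elim : Empty → _)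
      (List.replicate k none) (List.replicate k none) ξ := by
  set f : List (Fin N) → ℂ := fun z => ξ (z.drop k) (z.take k).reverse with hf
  have hfa : ∀ a b : List (Fin N), a.length = k → f (a ++ b) = ξ b a.reverse := by
    intro a b ha
    simp [hf, ← ha]
  have h1 : IsFlatFixed N (k + k) f := by
    intro P
    rw [IsFixedPow, List.replicate_add]
    refine Intertwines.bend_in_replicate P.magic k (ξ := ξ) (by simpa using h P) ?_
    intro a l m ha _ hm
    obtain rfl : m = [] := by simpa using hm
    simpa using hfa a.reverse l (by simpa using ha)
  have h2 : IsFixed _ (Empty.elim : Empty → _) _ f :=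
    isFixed_of_mem_NC Alg.isMagic_u.magic (hH _ _ h1)
  rw [List.replicate_add] at h2
  have h3 := Intertwines.bend_out_replicate Alg.isMagic_u.magic k (η := ξ) h2
    fun a l m ha _ hm => by
      obtain rfl : m = [] := by simpa using hm
      simpa using (hfa a.reverse l (by simpa using ha)).symm
  simpa using h3

/-- The functionals that vanish on a Hopf star-ideal, evaluated on the `k`-th power of the
fundamental corepresentation, form a star-algebra of matrices. -/
def annihilatorAlg {I : Ideal (Alg N)} (hI : IsHopfStarIdeal I) (k : ℕ) :
    Subalgebra ℂ (Matrix (words (Fin N) k) (words (Fin N) k) ℂ) where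
  carrier := {b | ∃ φ : Alg N →ₗ[ℂ] ℂ, (∀ x ∈ I, φ x = 0) ∧
    ∀ l m, b l m = φ (powMat Alg.u k l.1 m.1)}
  add_mem' := by
    rintro a b ⟨φ, hφ, ha⟩ ⟨ψ, hψ, hb⟩
    exact ⟨φ + ψ, fun x hx => by simp [hφ x hx, hψ x hx], fun l m => by simp [ha, hb]⟩
  mul_mem' := by
    rintro a b ⟨φ, hφ, ha⟩ ⟨ψ, hψ, hb⟩
    let J : Submodule ℂ (Alg N) := I.restrictScalars ℂ
    let φ' := J.liftQ φ fun x hx => hφ x hx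
    let ψ' := J.liftQ ψ fun x hx => hψ x hx
    let μ : Alg N ⊗[ℂ] Alg N →ₗ[ℂ] ℂ :=
      LinearMap.mul' ℂ ℂ ∘ₗ TensorProduct.map φ' ψ' ∘ₗ TensorProduct.map J.mkQ J.mkQ
    refine ⟨μ ∘ₗ (Alg.comulHom N).toLinearMap, fun x hx => ?_, fun l m => ?_⟩
    · have h1 : TensorProduct.map J.mkQ J.mkQ (Alg.comulHom N x) = 0 :=
        hI.isHopfIdeal.map_mkQ_comul_eq_zero hx
      change LinearMap.mul' ℂ ℂ (TensorProduct.map φ' ψ'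
        (TensorProduct.map J.mkQ J.mkQ (Alg.comulHom N x))) = 0
      rw [h1, map_zero, map_zero]
    · have h1 : ∀ x y, μ (x ⊗ₜ y) = φ x * ψ y := fun x y => rfl
      rw [LinearMap.comp_apply, AlgHom.toLinearMap_apply,
        comulHom_powMat k (mem_words.1 l.2) (mem_words.1 m.2), map_sum, Matrix.mul_apply]
      simp only [h1, ha, hb]
      exact Finset.sum_coe_sort (words (Fin N) k) fun x =>
        φ (powMat Alg.u k l.1 x) * ψ (powMat Alg.u k x m.1)
  algebraMap_mem' c := by
    refine ⟨c • (Alg.counitHom N).toLinearMap, fun x hx => ?_, fun l m => ?_⟩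
    · have : Alg.counitHom N x = 0 := hI.isHopfIdeal.counit_eq_zero hx
      simp [this]
    · rw [LinearMap.smul_apply, AlgHom.toLinearMap_apply,
        counitHom_powMat k (mem_words.1 l.2) (mem_words.1 m.2), Matrix.algebraMap_matrix_apply]
      simp only [Subtype.ext_iff, smul_eq_mul, mul_ite, mul_one, mul_zero]
      rfl

theorem star_mem_annihilatorAlg {I : Ideal (Alg N)} (hI : IsHopfStarIdeal I) (k : ℕ)
    {b : Matrix (words (Fin N) k) (words (Fin N) k) ℂ} (hb : b ∈ annihilatorAlg hI k) :
    star b ∈ annihilatorAlg hI k := by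
  obtain ⟨φ, hφ, hb⟩ := hb
  refine ⟨{ toFun := fun x => starRingEnd ℂ (φ (star (Alg.antipodeLin N x)))
            map_add' := fun x y => by simp
            map_smul' := fun c x => by simp }, fun x hx => ?_, fun l m => ?_⟩
  · have h1 : Alg.antipodeLin N x ∈ I := hI.isHopfIdeal.antipode_mem hx
    simp [hφ _ (hI.star_mem _ h1)]
  · change _ = starRingEnd ℂ (φ (star (Alg.antipodeLin N _)))
    rw [antipodeLin_powMat k (mem_words.1 l.2) (mem_words.1 m.2), star_star, ← hb]
    rfl

/-- The span of the matrix coefficients of the `k`-th power of the fundamental corepresentation. -/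
def coeffSpan (N k : ℕ) : Submodule ℂ (Alg N) :=
  Submodule.span ℂ {x | ∃ l m : List (Fin N), l.length = k ∧ m.length = k ∧ x = powMat Alg.u k l m}

theorem coeffSpan_mul {a b : ℕ} {x y : Alg N} (hx : x ∈ coeffSpan N a) (hy : y ∈ coeffSpan N b) :
    x * y ∈ coeffSpan N (a + b) := by
  have h := Submodule.mul_mem_mul hx hy
  rw [coeffSpan, coeffSpan, Submodule.span_mul_span] at h
  refine Submodule.span_mono ?_ h
  rintro _ ⟨_, ⟨l, m, hl, hm, rfl⟩, _, ⟨l', m', hl', hm', rfl⟩, rfl⟩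
  refine ⟨l ++ l', m ++ m', by simp [hl, hl'], by simp [hm, hm'], ?_⟩
  change powMat Alg.u a l m * powMat Alg.u b l' m' =
    wordMat Alg.u _ (List.replicate (a + b) none) _ _
  rw [List.replicate_add, wordMat_append _ _ (by simpa using hl) (by simpa using hm)]

theorem one_mem_coeffSpan [NeZero N] (k : ℕ) : (1 : Alg N) ∈ coeffSpan N k := by
  induction k with
  | zero => exact Submodule.subset_span ⟨[], [], rfl, rfl, rfl⟩
  | succ k ih =>
    have h1 : (1 : Alg N) ∈ coeffSpan N 1 := by
      rw [← Alg.isMagic_u.row_sum (0 : Fin N)]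
      refine Submodule.sum_mem _ fun j _ => Submodule.subset_span ⟨[0], [j], rfl, rfl, ?_⟩
      simp [powMat]
    simpa using coeffSpan_mul ih h1

theorem coeffSpan_mono [NeZero N] {a b : ℕ} (h : a ≤ b) : coeffSpan N a ≤ coeffSpan N b := by
  obtain ⟨c, rfl⟩ := Nat.exists_eq_add_of_le h
  exact fun x hx => by simpa using coeffSpan_mul hx (one_mem_coeffSpan c)

/-- Since `1 = ∑ j, u i j`, the spans `coeffSpan N k` increase with `k`, and exhaust the algebra. -/
theorem exists_mem_coeffSpan [NeZero N] (x : Alg N) : ∃ k, x ∈ coeffSpan N k := by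
  induction x using Alg.induction with
  | scalar c =>
    exact ⟨0, by
      rw [Algebra.algebraMap_eq_smul_one]
      exact Submodule.smul_mem _ _ (one_mem_coeffSpan 0)⟩
  | gen i j => exact ⟨1, Submodule.subset_span ⟨[i], [j], rfl, rfl, by simp [powMat]⟩⟩
  | mul a b ha hb =>
    obtain ⟨k, hk⟩ := ha
    obtain ⟨k', hk'⟩ := hb
    exact ⟨_, coeffSpan_mul hk hk'⟩
  | add a b ha hb =>
    obtain ⟨k, hk⟩ := ha
    obtain ⟨k', hk'⟩ := hb
    exact ⟨max k k', add_mem (coeffSpan_mono (le_max_left _ _) hk)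
      (coeffSpan_mono (le_max_right _ _) hk')⟩

/-- If the fixed vectors of the flat model are noncrossing, the flat model is inner faithful. Let
`I` be a Hopf star-ideal in its kernel. The functionals that vanish on `I` give star-algebras of
matrices whose commutants consist of intertwiners of the flat model, hence of the fundamental
corepresentation. By the double commutant theorem, every functional agrees with one that vanishes on
`I` on the coefficients of a given power of the fundamental corepresentation. -/
theorem innerFaithful_of_mem_NC [NeZero N] (hH : ∀ k f, IsFlatFixed N k f → f ∈ NC (Fin N) k) :
    InnerFaithful (universalFlatModel N) := by
  intro I hI hker
  refine (Submodule.eq_bot_iff _).2 fun x hx => ?_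
  obtain ⟨k, hk⟩ := exists_mem_coeffSpan x
  refine (Module.forall_dual_apply_eq_zero_iff ℂ x).1 fun ψ => ?_
  have hmem : Matrix.of (fun l m : words (Fin N) k => ψ (powMat Alg.u k l.1 m.1)) ∈
      annihilatorAlg hI k := by
    refine mem_of_forall_commute _ (fun b => star_mem_annihilatorAlg hI k) fun T hT => ?_
    let ξ : List (Fin N) → List (Fin N) → ℂ := fun l m =>
      if h : l ∈ words (Fin N) k ∧ m ∈ words (Fin N) k then T ⟨l, h.1⟩ ⟨m, h.2⟩ else 0
    have hξ : ∀ l m : words (Fin N) k, ξ l.1 m.1 = T l m := fun l m => dif_pos ⟨l.2, m.2⟩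
    let d : List (Fin N) → List (Fin N) → Alg N := fun l m =>
      ∑ x ∈ words (Fin N) k, ξ x m • powMat Alg.u k l x -
        ∑ y ∈ words (Fin N) k, ξ l y • powMat Alg.u k y m
    have hd : ∀ (φ : Alg N →ₗ[ℂ] ℂ) (l m : words (Fin N) k), φ (d l.1 m.1) =
        (Matrix.of (fun l m : words (Fin N) k => φ (powMat Alg.u k l.1 m.1)) * T) l m -
        (T * Matrix.of (fun l m : words (Fin N) k => φ (powMat Alg.u k l.1 m.1))) l m := by
      intro φ l m
      simp only [d, map_sub, map_sum, map_smul, smul_eq_mul, Matrix.mul_apply, Matrix.of_apply,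
        ← hξ]
      congr 1
      · rw [← Finset.sum_coe_sort (words (Fin N) k) fun x =>
          ξ x m.1 * φ (powMat Alg.u k l.1 x)]
        exact Finset.sum_congr rfl fun x _ => mul_comm _ _
      · exact (Finset.sum_coe_sort (words (Fin N) k) fun x =>
          ξ l.1 x * φ (powMat Alg.u k x m.1)).symm
    have hdI : ∀ l m : words (Fin N) k, d l.1 m.1 ∈ I := by
      intro l m
      have h1 : (I.restrictScalars ℂ).mkQ (d l.1 m.1) = 0 := by
        refine (Module.forall_dual_apply_eq_zero_iff ℂ _).1 fun χ => ?_
        have h2 := hT (Matrix.of fun l m : words (Fin N) k =>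
          (χ ∘ₗ (I.restrictScalars ℂ).mkQ) (powMat Alg.u k l.1 m.1))
          ⟨χ ∘ₗ (I.restrictScalars ℂ).mkQ, fun x hx => by
            have : (I.restrictScalars ℂ).mkQ x = 0 := (Submodule.Quotient.mk_eq_zero _).2 hx
            rw [LinearMap.comp_apply, this, map_zero], fun _ _ => rfl⟩
        have h3 := hd (χ ∘ₗ (I.restrictScalars ℂ).mkQ) l m
        rw [h2, sub_self] at h3
        exact h3
      exact (Submodule.Quotient.mk_eq_zero _).1 h1
    have hu := intertwines_u_of_flat hH (k := k) (ξ := ξ) fun P l m hl hm => by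
      rw [legs_replicate] at hl hm ⊢
      have h1 := congrArg (fun F : C(FlatSpace N, Matrix (Fin N) (Fin N) ℂ) => F P)
        (hker _ (hdI ⟨l, by simpa using hl⟩ ⟨m, by simpa using hm⟩))
      simp only [d, map_sub, map_sum, map_smul, ContinuousMap.sub_apply, ContinuousMap.sum_apply,
        ContinuousMap.smul_apply, universalFlatModel_powMat] at h1
      exact sub_eq_zero.1 h1
    ext l m
    have h1 : d l.1 m.1 = 0 := by
      have := hu l.1 m.1 ((mem_words.1 l.2).trans (legs_replicate k).symm)
        ((mem_words.1 m.2).trans (legs_replicate k).symm)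
      rw [legs_replicate] at this
      exact sub_eq_zero.2 this
    have h2 := hd ψ l m
    rw [h1, map_zero] at h2
    exact (sub_eq_zero.1 h2.symm).symm
  obtain ⟨φ, hφ, hφψ⟩ := hmem
  have h1 : coeffSpan N k ≤ LinearMap.ker (ψ - φ) := by
    refine Submodule.span_le.2 ?_
    rintro _ ⟨l, m, hl, hm, rfl⟩
    have := hφψ ⟨l, by simpa using hl⟩ ⟨m, by simpa using hm⟩
    exact sub_eq_zero.2 this
  have h2 := h1 hk
  rw [LinearMap.mem_ker, LinearMap.sub_apply, hφ x hx, sub_zero] at h2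
  exact h2

end Tannaka

end QPerm
end

theorem proposition4p7 (M N : ℕ) (hM : 5 ≤ M) (hN : 2 * M ≤ N)
    (h : QPerm.InnerFaithful (QPerm.universalFlatModel M)) :
    QPerm.InnerFaithful (QPerm.universalFlatModel N) := by
  obtain ⟨m, rfl⟩ := Nat.exists_eq_add_of_le' hM
  obtain ⟨n, rfl⟩ := Nat.exists_eq_add_of_le (show m + 5 ≤ N by omega)
  have : NeZero n := ⟨by omega⟩
  exact QPerm.innerFaithful_of_mem_NC fun k f hf =>
    QPerm.mem_NC_of_isFlatFixed_of_le (fun k f => QPerm.mem_NC_of_isFlatFixed h) (by omega)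
      finSumFinEquiv hf
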